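/- **Lemma (Preservation).** For all terms $M, M'$, contexts $\Gamma$ and types $A$ of the calculus $\mathrm{Links}^T$ defined below: if $\Gamma \vdash M : A$ and $M \leadsto M'$, then $\Gamma \vdash M' : A$. **The calculus.** Terms, types and constructors are taken up to renaming of bound variables, and bound variables are chosen fresh for the context. *Syntax.* Kinds $K ::= \mathit{Type} \mid \mathit{BaseType} \mid \mathit{Row} \mid \mathit{BaseRow} \mid K_1 \to K_2$, where $\mathit{BaseType} \le \mathit{Type}$ and $\mathit{BaseRow} \le \mathit{Row}$. Write $(\kappa,\varrho)$ for either of the pairs $(\mathit{Type},\mathit{Row})$, $(\mathit{BaseType},\mathit{BaseRow})$. Constructors $C, D$ and row constructors $S$ (a single syntactic category, sorted by kinding; row variables $\rho$ are type variables of a row kind): $$\mathtt{Bool}^* \mid \mathtt{Int}^* \mid \mathtt{String}^* \mid \alpha \mid \lambda\alpha{:}K.C \mid C\,D \mid \mathtt{List}^*\,C \mid \mathtt{Record}^*\,S \mid \mathtt{Trace}^*\,C \mid \mathrm{Typerec}\;C\,(C_B,C_I,C_S,C_L,C_R,C_T) \mid \cdot \mid l{:}C;S \mid \mathrm{Rmap}\;C\,S.$$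 Types $A,B$ and row types $R$: $$\mathtt T(C) \mid \mathtt{Bool} \mid \mathtt{Int} \mid \mathtt{String} \mid A\to B \mid \mathtt{List}\,A \mid \mathtt{Record}\,R \mid \mathtt{Trace}\,A \mid \forall\alpha{:}K.A \mid \cdot \mid l{:}A;R.$$ Write $\langle R\rangle$ for $\mathtt{Record}\,R$. Terms: $$c \mid x \mid \lambda x{:}A.M \mid M\,N \mid \Lambda\alpha{:}K.M \mid M\,C \mid \mathrm{fix}\,f{:}A.M \mid \mathrm{if}\,L\,\mathrm{then}\,M\,\mathrm{else}\,N \mid M+N \mid M{=}{=}N \mid \langle\rangle \mid \langle l=M;N\rangle \mid M.l \mid \mathrm{rmap}^S M\,N \mid \mathrm{rfold}^S L\,M\,N$$ $$\mid [\,] \mid [M] \mid M \mathbin{+\!\!+} N \mid \mathrm{for}\,(x\leftarrow M)\,N \mid \mathrm{table}\,n\,\langle R\rangle \mid \mathtt{Lit}\,M \mid \mathtt{If}\,M \mid \mathtt{For}\,C\,M \mid \mathtt{Cell}\,M \mid \mathtt{OpEq}\,C\,M \mid \mathtt{OpPlus}\,M$$ $$\mid \mathrm{tracecase}\,M\,\mathrm{of}\,(x.M_L,x.M_I,\alpha.x.M_F,x.M_C,\alpha.x.M_E,x.M_P)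 \mid \mathrm{typecase}\,C\,\mathrm{of}\,(M_B,M_I,M_S,\beta.M_L,\rho.M_R,\gamma.M_T),$$ where constants $c$ are Boolean, integer and string literals, with the evident types $\Sigma(c) \in \{\mathtt{Bool},\mathtt{Int},\mathtt{String}\}$. A context $\Gamma$ is a list of entries $\alpha{:}K$ and $x{:}A$; it is well-formed if each $x{:}A$ in it satisfies $\Gamma'\vdash A:\mathit{Type}$ for the part $\Gamma'$ of $\Gamma$ to its left. All judgements below presuppose that $\Gamma$ is well-formed. *Kinding of constructors* ($\Gamma\vdash C:K$). $\mathtt{Bool}^*,\mathtt{Int}^*,\mathtt{String}^*:\mathit{BaseType}$; $\alpha:\Gamma(\alpha)$; $\lambda$ and application as in the simply typed $\lambda$-calculus; $\mathtt{List}^*\,C:\mathit{Type}$ if $C:\mathit{Type}$; $\mathtt{Record}^*\,S:\mathit{Type}$ if $S:\mathit{Row}$; $\mathtt{Trace}^*\,C:\mathit{Type}$ if $C:\mathit{BaseType}$; for $K\in\{\mathit{Type},\mathit{BaseType}\}$, $\mathrm{Typerec}\;C\,(C_B,C_I,C_S,C_L,C_R,C_T):K$ if $C:\mathit{Type}$,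 $C_B,C_I,C_S:K$, $C_L:\mathit{Type}\to K\to K$, $C_R:\mathit{Row}\to\mathit{Row}\to K$, $C_T:\mathit{BaseType}\to K\to K$; $\cdot:\varrho$; $(l{:}C;S):\varrho$ if $C:\kappa$ and $S:\varrho$; $\mathrm{Rmap}\;C\,S:\mathit{Row}$ if $C:\mathit{Type}\to\mathit{Type}$ and $S:\mathit{Row}$; and subsumption along $\le$. *Kinding of types* ($\Gamma\vdash A:K$). $\mathtt T(C):K$ if $C:K$ and $K$ is not an arrow kind; $\mathtt{Bool},\mathtt{Int},\mathtt{String}:\mathit{BaseType}$; $A\to B$, $\mathtt{List}\,A$, $\forall\alpha{:}K.A$ have kind $\mathit{Type}$ if their immediate subtypes have (for $\forall$, in $\Gamma,\alpha{:}K$); $\langle R\rangle:\mathit{Type}$ if $R:\mathit{Row}$; $\mathtt{Trace}\,A:\mathit{Type}$ if $A:\mathit{BaseType}$; $\cdot:\varrho$; $(l{:}A;R):\varrho$ if $A:\kappa$ and $R:\varrho$; subsumption along $\le$. *Constructor computation* $C\leadsto C'$ is the closure under all constructor formers of $(\lambda\alpha{:}K.C)\,D\leadsto C[\alpha:=D]$;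 $\mathrm{Rmap}\;C\,\cdot\leadsto\cdot$; $\mathrm{Rmap}\;C\,(l{:}D;S)\leadsto(l{:}C\,D;\mathrm{Rmap}\;C\,S)$; and, writing $\mathrm{TR}(C)$ for $\mathrm{Typerec}\;C\,(C_B,C_I,C_S,C_L,C_R,C_T)$: $\mathrm{TR}(\mathtt{Bool}^*)\leadsto C_B$, $\mathrm{TR}(\mathtt{Int}^*)\leadsto C_I$, $\mathrm{TR}(\mathtt{String}^*)\leadsto C_S$, $\mathrm{TR}(\mathtt{List}^*D)\leadsto C_L\,D\,\mathrm{TR}(D)$, $\mathrm{TR}(\mathtt{Record}^*S)\leadsto C_R\,S\,(\mathrm{Rmap}\,(\lambda\alpha{:}\mathit{Type}.\mathrm{TR}(\alpha))\,S)$, $\mathrm{TR}(\mathtt{Trace}^*D)\leadsto C_T\,D\,\mathrm{TR}(D)$. *Equivalence.* $\Gamma\vdash C=D:K$ is the least kinded equivalence relation that is closed under all constructor formers and subsumption and contains $\eta$ ($\lambda\alpha{:}K.C\,\alpha=C:K\to K'$ if $C:K\to K'$ and $\alpha$ is not free in $C$), $C=D:K$ whenever $C\leadsto D$ and both have kind $K$,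 and $(l{:}C;l'{:}D;S)=(l'{:}D;l{:}C;S):\varrho$ for well-kinded rows with $l\ne l'$. $\Gamma\vdash A=B:K$ is the least kinded equivalence relation that is closed under all type formers and subsumption and contains the same exchange of adjacent fields with different labels, $\mathtt T(C)=\mathtt T(D):K$ for $C=D:K$ ($K$ not an arrow), and (for well-kinded arguments) $\mathtt T(\mathtt{Bool}^*)=\mathtt{Bool}$, $\mathtt T(\mathtt{Int}^*)=\mathtt{Int}$, $\mathtt T(\mathtt{String}^*)=\mathtt{String}$ (at $\mathit{BaseType}$), $\mathtt T(\mathtt{List}^*C)=\mathtt{List}\,\mathtt T(C)$, $\mathtt T(\mathtt{Record}^*S)=\langle\mathtt T(S)\rangle$, $\mathtt T(\mathtt{Trace}^*C)=\mathtt{Trace}\,\mathtt T(C)$ (at $\mathit{Type}$), $\mathtt T(\cdot)=\cdot$ and $\mathtt T(l{:}C;S)=(l{:}\mathtt T(C);\mathtt T(S))$ (at $\varrho$). *Typing* ($\Gamma\vdash M:A$). The standard rules for constants, variables, $\lambda$, application, $\Lambda$, constructor application ($M\,C:A[\alpha:=C]$ if $M:\forall\alpha{:}K.A$ and $\Gamma\vdash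 C:K$), $\mathrm{fix}$ ($\mathrm{fix}\,f{:}A.M:A$ if $\Gamma\vdash A:\mathit{Type}$ and $\Gamma,f{:}A\vdash M:A$), conditionals, $+$ on $\mathtt{Int}$, and lists; here $[\,]:\mathtt{List}\,A$ if $A:\mathit{Type}$, and $\mathrm{for}\,(x\leftarrow M)\,N:\mathtt{List}\,B$ if $M:\mathtt{List}\,A$ and $\Gamma,x{:}A\vdash N:\mathtt{List}\,B$. Further: - $M{=}{=}N:\mathtt{Bool}$ if $M,N:A$ and $A:\mathit{BaseType}$; $M:A$ if $M:B$ and $\Gamma\vdash A=B:\mathit{Type}$. - $\mathrm{table}\,n\,\langle\mathsf{oid}{:}\mathtt{Int};R\rangle:\mathtt{List}\,\langle\mathsf{oid}{:}\mathtt{Int};R\rangle$ if $\cdot\vdash R:\mathit{BaseRow}$. - $\langle\rangle:\langle\cdot\rangle$; $\langle l=M;N\rangle:\langle l{:}A;R\rangle$ if $M:A$ and $N:\langle R\rangle$; $M.l:A$ if $M:\langle l{:}A;R\rangle$. - $\mathrm{rmap}^SM\,N:\mathtt T(\mathtt{Record}^*(\mathrm{Rmap}\;C\,S))$ if $C:\mathit{Type}\to\mathit{Type}$,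 $M:\forall\alpha{:}\mathit{Type}.\mathtt T(\alpha)\to\mathtt T(C\,\alpha)$ and $N:\mathtt T(\mathtt{Record}^*S)$. - $\mathrm{rfold}^SL\,M\,N:\mathtt T(C)$ if $L:\mathtt T(C)\to\mathtt T(C)\to\mathtt T(C)$, $M:\mathtt T(C)$ and $N:\mathtt T(\mathtt{Record}^*(\mathrm{Rmap}\,(\lambda\alpha{:}\mathit{Type}.C)\,S))$, with $\alpha$ not free in $C$. - $\mathrm{typecase}\,C\,\mathrm{of}\,(M_B,M_I,M_S,\beta.M_L,\rho.M_R,\gamma.M_T):B[\alpha:=C]$ if $C:\mathit{Type}$; $\Gamma,\alpha{:}\mathit{Type}\vdash B:\mathit{Type}$; $M_B:B[\alpha:=\mathtt{Bool}^*]$; $M_I:B[\alpha:=\mathtt{Int}^*]$; $M_S:B[\alpha:=\mathtt{String}^*]$; $\Gamma,\beta{:}\mathit{Type}\vdash M_L:B[\alpha:=\mathtt{List}^*\beta]$; $\Gamma,\rho{:}\mathit{Row}\vdash M_R:B[\alpha:=\mathtt{Record}^*\rho]$; $\Gamma,\gamma{:}\mathit{BaseType}\vdash M_T:B[\alpha:=\mathtt{Trace}^*\gamma]$.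 - Let $\mathtt{TRACE}=\lambda\alpha{:}\mathit{Type}.\mathrm{Typerec}\;\alpha\,(\mathtt{Trace}^*\mathtt{Bool}^*,\mathtt{Trace}^*\mathtt{Int}^*,\mathtt{Trace}^*\mathtt{String}^*,\lambda\_{:}\mathit{Type}.\lambda b{:}\mathit{Type}.\mathtt{List}^*b,\lambda\_{:}\mathit{Row}.\lambda r{:}\mathit{Row}.\mathtt{Record}^*r,\lambda\_{:}\mathit{BaseType}.\lambda b{:}\mathit{Type}.b)$, and let $I_A=\langle\mathsf{cond}{:}\mathtt{Trace\,Bool};\mathsf{out}{:}\mathtt{Trace}\,A\rangle$, $F_{C,A}=\langle\mathsf{in}{:}\mathtt T(\mathtt{TRACE}\,C);\mathsf{out}{:}\mathtt{Trace}\,A\rangle$, $L_A=\langle\mathsf{table}{:}\mathtt{String};\mathsf{column}{:}\mathtt{String};\mathsf{row}{:}\mathtt{Int};\mathsf{data}{:}A\rangle$, $E_C=\langle\mathsf{left}{:}\mathtt T(\mathtt{TRACE}\,C);\mathsf{right}{:}\mathtt T(\mathtt{TRACE}\,C)\rangle$, $P=\langle\mathsf{left}{:}\mathtt{Trace\,Int};\mathsf{right}{:}\mathtt{Trace\,Int}\rangle$.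 Then $\mathtt{Lit}\,c:\mathtt{Trace}\,O$ if $c$ is a constant, $c:O$ and $O\in\{\mathtt{Bool},\mathtt{Int},\mathtt{String}\}$; $\mathtt{If}\,M:\mathtt{Trace}\,A$ if $M:I_A$; $\mathtt{For}\,C\,M:\mathtt{Trace}\,A$ if $C:\mathit{Type}$ and $M:F_{C,A}$; $\mathtt{Cell}\,M:\mathtt{Trace}\,A$ if $A:\mathit{BaseType}$ and $M:L_A$; $\mathtt{OpEq}\,C\,M:\mathtt{Trace\,Bool}$ if $C:\mathit{BaseType}$ and $M:E_C$; $\mathtt{OpPlus}\,M:\mathtt{Trace\,Int}$ if $M:P$; and $\mathrm{tracecase}\,M\,\mathrm{of}\,(x.M_L,x.M_I,\alpha.x.M_F,x.M_C,\alpha.x.M_E,x.M_P):B$ if $M:\mathtt{Trace}\,A$ and $M_L,M_I,M_F,M_C,M_E,M_P$ all have type $B$ in $\Gamma$ extended by, respectively, $x{:}A$; $x{:}I_A$; $\alpha{:}\mathit{Type},x{:}F_{\alpha,A}$; $x{:}L_A$; $\alpha{:}\mathit{BaseType},x{:}E_\alpha$; $x{:}P$ ($\alpha$ not free in $A,B$).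 *Reduction* $M\leadsto M'$ of terms is generated by the following rules. ($\beta$-rules) $(\lambda x{:}A.M)\,N\leadsto M[x:=N]$; $\mathrm{fix}\,f{:}A.M\leadsto M[f:=\mathrm{fix}\,f{:}A.M]$; $(\Lambda\alpha{:}K.M)\,C\leadsto M[\alpha:=C]$; $\mathrm{if}\,\mathrm{true}\,\mathrm{then}\,M\,\mathrm{else}\,N\leadsto M$; $\mathrm{if}\,\mathrm{false}\,\mathrm{then}\,M\,\mathrm{else}\,N\leadsto N$; $P.l\leadsto M$ if $P$ is a record literal $\langle l_1=M_1;\dots\langle l_k=M_k;N\rangle\dots\rangle$ with $l_k=l$, $M_k=M$ and $l_i\neq l$ for $i<k$; for pairwise distinct labels $l_1,\dots,l_n$ ($n\ge0$) and $S=(l_1{:}C_1;\dots;l_n{:}C_n;\cdot)$, $\mathrm{rmap}^SM\,N\leadsto\langle l_1=(M\,C_1)\,N.l_1;\dots;l_n=(M\,C_n)\,N.l_n\rangle$ and $\mathrm{rfold}^SL\,M\,N\leadsto L\,N.l_1\,(L\,N.l_2\cdots(L\,N.l_n\,M)\cdots)$; $\mathrm{for}\,(x\leftarrow[\,])\,N\leadsto[\,]$;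 $\mathrm{for}\,(x\leftarrow[M])\,N\leadsto N[x:=M]$; $\mathrm{tracecase}$ of $\mathtt{Lit}\,M$, $\mathtt{If}\,M$, $\mathtt{For}\,C\,M$, $\mathtt{Cell}\,M$, $\mathtt{OpEq}\,C\,M$, $\mathtt{OpPlus}\,M$ reduces to $M_L[x:=M]$, $M_I[x:=M]$, $M_F[\alpha:=C,x:=M]$, $M_C[x:=M]$, $M_E[\alpha:=C,x:=M]$, $M_P[x:=M]$ respectively; $\mathrm{typecase}$ of $\mathtt{Bool}^*$, $\mathtt{Int}^*$, $\mathtt{String}^*$, $\mathtt{List}^*C$, $\mathtt{Record}^*S$, $\mathtt{Trace}^*C$ reduces to $M_B$, $M_I$, $M_S$, $M_L[\beta:=C]$, $M_R[\rho:=S]$, $M_T[\gamma:=C]$ respectively. (Commuting conversions) A conditional is moved outwards: $\mathcal E[\mathrm{if}\,L\,\mathrm{then}\,M_1\,\mathrm{else}\,M_2]\leadsto\mathrm{if}\,L\,\mathrm{then}\,\mathcal E[M_1]\,\mathrm{else}\,\mathcal E[M_2]$ for $\mathcal E$ one of $[\cdot]\,N$; $[\cdot]\,C$; $[\cdot].l$;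 $\mathrm{if}\,[\cdot]\,\mathrm{then}\,N_1\,\mathrm{else}\,N_2$; $\mathrm{for}\,(x\leftarrow[\cdot])\,N$; $\mathrm{tracecase}\,[\cdot]\,\mathrm{of}\,(\dots)$. Moreover $\mathrm{for}\,(x\leftarrow M_1\mathbin{+\!\!+}M_2)\,N\leadsto(\mathrm{for}\,(x\leftarrow M_1)\,N)\mathbin{+\!\!+}(\mathrm{for}\,(x\leftarrow M_2)\,N)$ and $\mathrm{for}\,(x\leftarrow\mathrm{for}\,(y\leftarrow L)\,M)\,N\leadsto\mathrm{for}\,(y\leftarrow L)\,\mathrm{for}\,(x\leftarrow M)\,N$ ($y$ not free in $N$). (Congruence rules) A step in any immediate subterm, including subterms under binders, and a step $C\leadsto C'$ or $S\leadsto S'$ of constructor computation in any immediate constructor or row constructor argument, is a step of the whole term, except that there is no reduction inside the body of $\mathrm{fix}$ and none inside type annotations (those of $\lambda$, $\mathrm{fix}$ and $\mathrm{table}$). -/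

import Mathlib

/-!
A core calculus with type-level computation (`Typerec`, `Rmap`), run-time type analysis
(`typecase`), generic record operations (`rmap`, `rfold`) and a built-in type of traces.

Binders are represented by de Bruijn indices. Type variables and term variables are numbered
separately. In a unified context, type variable `n` is the `n`-th type-variable entry, and term
variable `n` is the `n`-th term-variable entry, both counted from the right, starting at 0.
-/

namespace LinksT

/-! ### Kinds, constructors, types, terms -/

/-- Record labels: the distinguished labels of tables and traces, and a further label for each
string. All of them are pairwise distinct. -/
inductive Label : Type
  | oid
  | cond
  | out
  | input
  | table
  | column
  | row
  | data
  | left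
  | right
  | other (s : String)

inductive Kind : Type
  | type
  | baseType
  | row
  | baseRow
  | arrow (K₁ K₂ : Kind)

/-- `BaseType` is a subkind of `Type`, and `BaseRow` is a subkind of `Row`. -/
inductive SubKind : Kind → Kind → Prop
  | base : SubKind Kind.baseType Kind.type
  | baseRow : SubKind Kind.baseRow Kind.row

/-- `RowOf κ ρ`: rows of kind `ρ` have fields of kind `κ`. -/
inductive RowOf : Kind → Kind → Prop
  | row : RowOf Kind.type Kind.row
  | baseRow : RowOf Kind.baseType Kind.baseRow

/-- The kinds `Type` and `BaseType`. -/
inductive TypeLike : Kind → Prop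
  | type : TypeLike Kind.type
  | baseType : TypeLike Kind.baseType

/-- The kinds that are not arrows: those of types and of row types. -/
inductive Ground : Kind → Prop
  | type : Ground Kind.type
  | baseType : Ground Kind.baseType
  | row : Ground Kind.row
  | baseRow : Ground Kind.baseRow

/-- Constructors and row constructors. They form one syntactic category that is sorted by kinding,
so that row variables are the type variables of a row kind, and rows can be passed as arguments. -/
inductive Con : Type
  | bool
  | int
  | string
  | var (n : ℕ)
  | lam (K : Kind) (C : Con)
  | app (C D : Con)
  | list (C : Con)
  | record (S : Con)
  | trace (C : Con)
  | typerec (C CB CI CS CL CR CT : Con)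
  | rnil
  | rcons (l : Label) (C S : Con)
  | rmap (C S : Con)

/-- Types and row types; `T C` embeds constructors into types and row constructors into row
types. -/
inductive Ty : Type
  | T (C : Con)
  | bool
  | int
  | string
  | fn (A B : Ty)
  | list (A : Ty)
  | record (R : Ty)
  | trace (A : Ty)
  | all (K : Kind) (A : Ty)
  | rnil
  | rcons (l : Label) (A R : Ty)

inductive Const : Type
  | bool (b : Bool)
  | int (i : ℤ)
  | string (s : String)

/-- The signature: the types of the constants. -/
def Const.ty : Const → Ty
  | .bool _ => .bool
  | .int _ => .int
  | .string _ => .string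

inductive Term : Type
  | const (c : Const)
  | var (n : ℕ)
  /-- `λ x : A. M`, binds a term variable -/
  | lam (A : Ty) (M : Term)
  | app (M N : Term)
  /-- `Λ α : K. M`, binds a type variable -/
  | tlam (K : Kind) (M : Term)
  | tapp (M : Term) (C : Con)
  /-- `fix f : A. M`, binds a term variable -/
  | fix (A : Ty) (M : Term)
  | ite (L M N : Term)
  | plus (M N : Term)
  | eq (M N : Term)
  | rnil
  | rcons (l : Label) (M N : Term)
  | proj (M : Term) (l : Label)
  | rmap (S : Con) (M N : Term)
  | rfold (S : Con) (L M N : Term)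
  | nil
  | single (M : Term)
  | append (M N : Term)
  /-- `for (x ← M) N`, binds a term variable in `N` -/
  | comp (M N : Term)
  | table (n : String) (R : Ty)
  | trLit (M : Term)
  | trIf (M : Term)
  | trFor (C : Con) (M : Term)
  | trCell (M : Term)
  | trOpEq (C : Con) (M : Term)
  | trOpPlus (M : Term)
  /-- `tracecase M of (x.ML, x.MI, α.x.MF, x.MC, α.x.ME, x.MP)` -/
  | tracecase (M ML MI MF MC ME MP : Term)
  /-- `typecase C of (MB, MI, MS, β.ML, ρ.MR, γ.MT)` -/
  | typecase (C : Con) (MB MI MS ML MR MT : Term)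

/-! ### Renaming and substitution -/

/-- Extend a map on indices by a value for index `0`. -/
def scons {X : Type} (a : X) (f : ℕ → X) : ℕ → X
  | 0 => a
  | n + 1 => f n

/-- Lift a renaming under one binder. -/
def upRen (ξ : ℕ → ℕ) : ℕ → ℕ := scons 0 (fun n => ξ n + 1)

def Con.rename (ξ : ℕ → ℕ) : Con → Con
  | .bool => .bool
  | .int => .int
  | .string => .string
  | .var n => .var (ξ n)
  | .lam K C => .lam K (C.rename (upRen ξ))
  | .app C D => .app (C.rename ξ) (D.rename ξ)
  | .list C => .list (C.rename ξ)
  | .record S => .record (S.rename ξ)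
  | .trace C => .trace (C.rename ξ)
  | .typerec C CB CI CS CL CR CT =>
      .typerec (C.rename ξ) (CB.rename ξ) (CI.rename ξ) (CS.rename ξ) (CL.rename ξ)
        (CR.rename ξ) (CT.rename ξ)
  | .rnil => .rnil
  | .rcons l C S => .rcons l (C.rename ξ) (S.rename ξ)
  | .rmap C S => .rmap (C.rename ξ) (S.rename ξ)

/-- Weakening by one type variable. -/
def Con.shift (C : Con) : Con := C.rename Nat.succ

/-- Lift a constructor substitution under one type binder. -/
def upCon (σ : ℕ → Con) : ℕ → Con := scons (.var 0) (fun n => (σ n).shift)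

def Con.subst (σ : ℕ → Con) : Con → Con
  | .bool => .bool
  | .int => .int
  | .string => .string
  | .var n => σ n
  | .lam K C => .lam K (C.subst (upCon σ))
  | .app C D => .app (C.subst σ) (D.subst σ)
  | .list C => .list (C.subst σ)
  | .record S => .record (S.subst σ)
  | .trace C => .trace (C.subst σ)
  | .typerec C CB CI CS CL CR CT =>
      .typerec (C.subst σ) (CB.subst σ) (CI.subst σ) (CS.subst σ) (CL.subst σ)
        (CR.subst σ) (CT.subst σ)
  | .rnil => .rnil
  | .rcons l C S => .rcons l (C.subst σ) (S.subst σ)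
  | .rmap C S => .rmap (C.subst σ) (S.subst σ)

/-- `C[α := D]` for the outermost type variable `α` of `C`. -/
def Con.inst (C D : Con) : Con := C.subst (scons D Con.var)

def Ty.rename (ξ : ℕ → ℕ) : Ty → Ty
  | .T C => .T (C.rename ξ)
  | .bool => .bool
  | .int => .int
  | .string => .string
  | .fn A B => .fn (A.rename ξ) (B.rename ξ)
  | .list A => .list (A.rename ξ)
  | .record R => .record (R.rename ξ)
  | .trace A => .trace (A.rename ξ)
  | .all K A => .all K (A.rename (upRen ξ))
  | .rnil => .rnil
  | .rcons l A R => .rcons l (A.rename ξ) (R.rename ξ)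

/-- Weakening by one type variable. -/
def Ty.shift (A : Ty) : Ty := A.rename Nat.succ

def Ty.subst (σ : ℕ → Con) : Ty → Ty
  | .T C => .T (C.subst σ)
  | .bool => .bool
  | .int => .int
  | .string => .string
  | .fn A B => .fn (A.subst σ) (B.subst σ)
  | .list A => .list (A.subst σ)
  | .record R => .record (R.subst σ)
  | .trace A => .trace (A.subst σ)
  | .all K A => .all K (A.subst (upCon σ))
  | .rnil => .rnil
  | .rcons l A R => .rcons l (A.subst σ) (R.subst σ)

/-- `A[α := C]` for the outermost type variable `α` of `A`. -/
def Ty.inst (A : Ty) (C : Con) : Ty := A.subst (scons C Con.var)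

/-- `B[α := C]`, where `C` lives under a new type variable that replaces `α` in the context. -/
def Ty.instUnder (B : Ty) (C : Con) : Ty := B.subst (scons C (fun n => Con.var (n + 1)))

/-- Rename type variables by `ξ` and term variables by `ζ`. -/
def Term.rename (ξ ζ : ℕ → ℕ) : Term → Term
  | .const c => .const c
  | .var n => .var (ζ n)
  | .lam A M => .lam (A.rename ξ) (M.rename ξ (upRen ζ))
  | .app M N => .app (M.rename ξ ζ) (N.rename ξ ζ)
  | .tlam K M => .tlam K (M.rename (upRen ξ) ζ)
  | .tapp M C => .tapp (M.rename ξ ζ) (C.rename ξ)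
  | .fix A M => .fix (A.rename ξ) (M.rename ξ (upRen ζ))
  | .ite L M N => .ite (L.rename ξ ζ) (M.rename ξ ζ) (N.rename ξ ζ)
  | .plus M N => .plus (M.rename ξ ζ) (N.rename ξ ζ)
  | .eq M N => .eq (M.rename ξ ζ) (N.rename ξ ζ)
  | .rnil => .rnil
  | .rcons l M N => .rcons l (M.rename ξ ζ) (N.rename ξ ζ)
  | .proj M l => .proj (M.rename ξ ζ) l
  | .rmap S M N => .rmap (S.rename ξ) (M.rename ξ ζ) (N.rename ξ ζ)
  | .rfold S L M N => .rfold (S.rename ξ) (L.rename ξ ζ) (M.rename ξ ζ) (N.rename ξ ζ)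
  | .nil => .nil
  | .single M => .single (M.rename ξ ζ)
  | .append M N => .append (M.rename ξ ζ) (N.rename ξ ζ)
  | .comp M N => .comp (M.rename ξ ζ) (N.rename ξ (upRen ζ))
  | .table n R => .table n (R.rename ξ)
  | .trLit M => .trLit (M.rename ξ ζ)
  | .trIf M => .trIf (M.rename ξ ζ)
  | .trFor C M => .trFor (C.rename ξ) (M.rename ξ ζ)
  | .trCell M => .trCell (M.rename ξ ζ)
  | .trOpEq C M => .trOpEq (C.rename ξ) (M.rename ξ ζ)
  | .trOpPlus M => .trOpPlus (M.rename ξ ζ)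
  | .tracecase M ML MI MF MC ME MP =>
      .tracecase (M.rename ξ ζ) (ML.rename ξ (upRen ζ)) (MI.rename ξ (upRen ζ))
        (MF.rename (upRen ξ) (upRen ζ)) (MC.rename ξ (upRen ζ))
        (ME.rename (upRen ξ) (upRen ζ)) (MP.rename ξ (upRen ζ))
  | .typecase C MB MI MS ML MR MT =>
      .typecase (C.rename ξ) (MB.rename ξ ζ) (MI.rename ξ ζ) (MS.rename ξ ζ)
        (ML.rename (upRen ξ) ζ) (MR.rename (upRen ξ) ζ) (MT.rename (upRen ξ) ζ)

/-- Lift a term substitution under one term binder. -/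
def upTm (τ : ℕ → Term) : ℕ → Term := scons (.var 0) (fun n => (τ n).rename id Nat.succ)

/-- Lift a term substitution under one type binder. -/
def wkTm (τ : ℕ → Term) : ℕ → Term := fun n => (τ n).rename Nat.succ id

/-- Substitute type variables by `σ` and term variables by `τ`, simultaneously. -/
def Term.subst (σ : ℕ → Con) (τ : ℕ → Term) : Term → Term
  | .const c => .const c
  | .var n => τ n
  | .lam A M => .lam (A.subst σ) (M.subst σ (upTm τ))
  | .app M N => .app (M.subst σ τ) (N.subst σ τ)
  | .tlam K M => .tlam K (M.subst (upCon σ) (wkTm τ))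
  | .tapp M C => .tapp (M.subst σ τ) (C.subst σ)
  | .fix A M => .fix (A.subst σ) (M.subst σ (upTm τ))
  | .ite L M N => .ite (L.subst σ τ) (M.subst σ τ) (N.subst σ τ)
  | .plus M N => .plus (M.subst σ τ) (N.subst σ τ)
  | .eq M N => .eq (M.subst σ τ) (N.subst σ τ)
  | .rnil => .rnil
  | .rcons l M N => .rcons l (M.subst σ τ) (N.subst σ τ)
  | .proj M l => .proj (M.subst σ τ) l
  | .rmap S M N => .rmap (S.subst σ) (M.subst σ τ) (N.subst σ τ)
  | .rfold S L M N => .rfold (S.subst σ) (L.subst σ τ) (M.subst σ τ) (N.subst σ τ)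
  | .nil => .nil
  | .single M => .single (M.subst σ τ)
  | .append M N => .append (M.subst σ τ) (N.subst σ τ)
  | .comp M N => .comp (M.subst σ τ) (N.subst σ (upTm τ))
  | .table n R => .table n (R.subst σ)
  | .trLit M => .trLit (M.subst σ τ)
  | .trIf M => .trIf (M.subst σ τ)
  | .trFor C M => .trFor (C.subst σ) (M.subst σ τ)
  | .trCell M => .trCell (M.subst σ τ)
  | .trOpEq C M => .trOpEq (C.subst σ) (M.subst σ τ)
  | .trOpPlus M => .trOpPlus (M.subst σ τ)
  | .tracecase M ML MI MF MC ME MP =>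
      .tracecase (M.subst σ τ) (ML.subst σ (upTm τ)) (MI.subst σ (upTm τ))
        (MF.subst (upCon σ) (upTm (wkTm τ))) (MC.subst σ (upTm τ))
        (ME.subst (upCon σ) (upTm (wkTm τ))) (MP.subst σ (upTm τ))
  | .typecase C MB MI MS ML MR MT =>
      .typecase (C.subst σ) (MB.subst σ τ) (MI.subst σ τ) (MS.subst σ τ)
        (ML.subst (upCon σ) (wkTm τ)) (MR.subst (upCon σ) (wkTm τ))
        (MT.subst (upCon σ) (wkTm τ))

/-- `M[x := N]` for the outermost term variable `x` of `M`. -/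
def Term.instTm (M N : Term) : Term := M.subst Con.var (scons N Term.var)

/-- `M[α := C]` for the outermost type variable `α` of `M`. -/
def Term.instTy (M : Term) (C : Con) : Term := M.subst (scons C Con.var) Term.var

/-- `M[α := C, x := N]` for the outermost type variable `α` and term variable `x` of `M`. -/
def Term.instBoth (M : Term) (C : Con) (N : Term) : Term :=
  M.subst (scons C Con.var) (scons N Term.var)

/-- Weaken a term that lives under one term binder by a new term variable just outside of that
binder. -/
def Term.shiftUnder (M : Term) : Term := M.rename id (upRen Nat.succ)

/-! ### Contexts -/

inductive Ctx : Type
  | nil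
  | tvar (Γ : Ctx) (K : Kind)
  | var (Γ : Ctx) (A : Ty)

/-- `Γ(α) = K`. -/
inductive Ctx.TVarAt : Ctx → ℕ → Kind → Prop
  | here {Γ : Ctx} {K : Kind} : TVarAt (.tvar Γ K) 0 K
  | tvar {Γ : Ctx} {n : ℕ} {K K' : Kind} : TVarAt Γ n K → TVarAt (.tvar Γ K') (n + 1) K
  | var {Γ : Ctx} {n : ℕ} {K : Kind} {A : Ty} : TVarAt Γ n K → TVarAt (.var Γ A) n K

/-- `Γ(x) = A`. -/
inductive Ctx.VarAt : Ctx → ℕ → Ty → Prop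
  | here {Γ : Ctx} {A : Ty} : VarAt (.var Γ A) 0 A
  | var {Γ : Ctx} {n : ℕ} {A B : Ty} : VarAt Γ n A → VarAt (.var Γ B) (n + 1) A
  | tvar {Γ : Ctx} {n : ℕ} {A : Ty} {K : Kind} : VarAt Γ n A → VarAt (.tvar Γ K) n A.shift

/-! ### Well-formed contexts, kinding of constructors, kinding of types -/

mutual

inductive WfCtx : Ctx → Prop
  | nil : WfCtx .nil
  | var {Γ : Ctx} {A : Ty} : TyKind Γ A .type → WfCtx (.var Γ A)
  | tvar {Γ : Ctx} {K : Kind} : WfCtx Γ → WfCtx (.tvar Γ K)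

/-- `Γ ⊢ C : K` for constructors and row constructors. -/
inductive ConKind : Ctx → Con → Kind → Prop
  | bool {Γ : Ctx} : WfCtx Γ → ConKind Γ .bool .baseType
  | int {Γ : Ctx} : WfCtx Γ → ConKind Γ .int .baseType
  | string {Γ : Ctx} : WfCtx Γ → ConKind Γ .string .baseType
  | var {Γ : Ctx} {n : ℕ} {K : Kind} : WfCtx Γ → Γ.TVarAt n K → ConKind Γ (.var n) K
  | lam {Γ : Ctx} {K₁ K₂ : Kind} {C : Con} :
      ConKind (.tvar Γ K₁) C K₂ → ConKind Γ (.lam K₁ C) (.arrow K₁ K₂)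
  | app {Γ : Ctx} {K₁ K₂ : Kind} {C D : Con} :
      ConKind Γ C (.arrow K₁ K₂) → ConKind Γ D K₁ → ConKind Γ (.app C D) K₂
  | list {Γ : Ctx} {C : Con} : ConKind Γ C .type → ConKind Γ (.list C) .type
  | record {Γ : Ctx} {S : Con} : ConKind Γ S .row → ConKind Γ (.record S) .type
  | trace {Γ : Ctx} {C : Con} : ConKind Γ C .baseType → ConKind Γ (.trace C) .type
  | typerec {Γ : Ctx} {K : Kind} {C CB CI CS CL CR CT : Con} :
      TypeLike K →
      ConKind Γ C .type →
      ConKind Γ CB K →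
      ConKind Γ CI K →
      ConKind Γ CS K →
      ConKind Γ CL (.arrow .type (.arrow K K)) →
      ConKind Γ CR (.arrow .row (.arrow .row K)) →
      ConKind Γ CT (.arrow .baseType (.arrow K K)) →
      ConKind Γ (.typerec C CB CI CS CL CR CT) K
  | rnil {Γ : Ctx} {κ ρ : Kind} : RowOf κ ρ → WfCtx Γ → ConKind Γ .rnil ρ
  | rcons {Γ : Ctx} {κ ρ : Kind} {l : Label} {C S : Con} :
      RowOf κ ρ → ConKind Γ C κ → ConKind Γ S ρ → ConKind Γ (.rcons l C S) ρ
  | rmap {Γ : Ctx} {C S : Con} :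
      ConKind Γ C (.arrow .type .type) → ConKind Γ S .row → ConKind Γ (.rmap C S) .row
  | sub {Γ : Ctx} {C : Con} {K K' : Kind} : ConKind Γ C K → SubKind K K' → ConKind Γ C K'

/-- `Γ ⊢ A : K` for types and row types. -/
inductive TyKind : Ctx → Ty → Kind → Prop
  | T {Γ : Ctx} {C : Con} {K : Kind} : Ground K → ConKind Γ C K → TyKind Γ (.T C) K
  | bool {Γ : Ctx} : WfCtx Γ → TyKind Γ .bool .baseType
  | int {Γ : Ctx} : WfCtx Γ → TyKind Γ .int .baseType
  | string {Γ : Ctx} : WfCtx Γ → TyKind Γ .string .baseType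
  | sub {Γ : Ctx} {A : Ty} {K K' : Kind} : TyKind Γ A K → SubKind K K' → TyKind Γ A K'
  | all {Γ : Ctx} {K : Kind} {A : Ty} : TyKind (.tvar Γ K) A .type → TyKind Γ (.all K A) .type
  | fn {Γ : Ctx} {A B : Ty} : TyKind Γ A .type → TyKind Γ B .type → TyKind Γ (.fn A B) .type
  | list {Γ : Ctx} {A : Ty} : TyKind Γ A .type → TyKind Γ (.list A) .type
  | record {Γ : Ctx} {R : Ty} : TyKind Γ R .row → TyKind Γ (.record R) .type
  | trace {Γ : Ctx} {A : Ty} : TyKind Γ A .baseType → TyKind Γ (.trace A) .type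
  | rnil {Γ : Ctx} {κ ρ : Kind} : RowOf κ ρ → WfCtx Γ → TyKind Γ .rnil ρ
  | rcons {Γ : Ctx} {κ ρ : Kind} {l : Label} {A R : Ty} :
      RowOf κ ρ → TyKind Γ A κ → TyKind Γ R ρ → TyKind Γ (.rcons l A R) ρ

end

/-! ### Constructor computation and equivalence -/

/-- `C ⤳ C'` for constructors and row constructors. -/
inductive ConStep : Con → Con → Prop
  | rcons_tail {l : Label} {C S S' : Con} : ConStep S S' → ConStep (.rcons l C S) (.rcons l C S')
  | rcons_head {l : Label} {C C' S : Con} : ConStep C C' → ConStep (.rcons l C S) (.rcons l C' S)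
  | app_fun {C C' D : Con} : ConStep C C' → ConStep (.app C D) (.app C' D)
  | app_arg {C D D' : Con} : ConStep D D' → ConStep (.app C D) (.app C D')
  | beta {K : Kind} {C D : Con} : ConStep (.app (.lam K C) D) (C.inst D)
  | lam {K : Kind} {C C' : Con} : ConStep C C' → ConStep (.lam K C) (.lam K C')
  | list {C C' : Con} : ConStep C C' → ConStep (.list C) (.list C')
  | trace {C C' : Con} : ConStep C C' → ConStep (.trace C) (.trace C')
  | record {S S' : Con} : ConStep S S' → ConStep (.record S) (.record S')
  | rmap_rnil {C : Con} : ConStep (.rmap C .rnil) .rnil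
  | rmap_rcons {C D S : Con} {l : Label} :
      ConStep (.rmap C (.rcons l D S)) (.rcons l (.app C D) (.rmap C S))
  | rmap_row {C S S' : Con} : ConStep S S' → ConStep (.rmap C S) (.rmap C S')
  | rmap_fun {C C' S : Con} : ConStep C C' → ConStep (.rmap C S) (.rmap C' S)
  | typerec_scrut {C C' CB CI CS CL CR CT : Con} : ConStep C C' →
      ConStep (.typerec C CB CI CS CL CR CT) (.typerec C' CB CI CS CL CR CT)
  | typerec_B {C CB CB' CI CS CL CR CT : Con} : ConStep CB CB' →
      ConStep (.typerec C CB CI CS CL CR CT) (.typerec C CB' CI CS CL CR CT)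
  | typerec_I {C CB CI CI' CS CL CR CT : Con} : ConStep CI CI' →
      ConStep (.typerec C CB CI CS CL CR CT) (.typerec C CB CI' CS CL CR CT)
  | typerec_S {C CB CI CS CS' CL CR CT : Con} : ConStep CS CS' →
      ConStep (.typerec C CB CI CS CL CR CT) (.typerec C CB CI CS' CL CR CT)
  | typerec_L {C CB CI CS CL CL' CR CT : Con} : ConStep CL CL' →
      ConStep (.typerec C CB CI CS CL CR CT) (.typerec C CB CI CS CL' CR CT)
  | typerec_R {C CB CI CS CL CR CR' CT : Con} : ConStep CR CR' →
      ConStep (.typerec C CB CI CS CL CR CT) (.typerec C CB CI CS CL CR' CT)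
  | typerec_T {C CB CI CS CL CR CT CT' : Con} : ConStep CT CT' →
      ConStep (.typerec C CB CI CS CL CR CT) (.typerec C CB CI CS CL CR CT')
  | typerec_bool {CB CI CS CL CR CT : Con} :
      ConStep (.typerec .bool CB CI CS CL CR CT) CB
  | typerec_int {CB CI CS CL CR CT : Con} :
      ConStep (.typerec .int CB CI CS CL CR CT) CI
  | typerec_string {CB CI CS CL CR CT : Con} :
      ConStep (.typerec .string CB CI CS CL CR CT) CS
  | typerec_list {D CB CI CS CL CR CT : Con} :
      ConStep (.typerec (.list D) CB CI CS CL CR CT)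
        (.app (.app CL D) (.typerec D CB CI CS CL CR CT))
  | typerec_record {S CB CI CS CL CR CT : Con} :
      ConStep (.typerec (.record S) CB CI CS CL CR CT)
        (.app (.app CR S)
          (.rmap (.lam .type (.typerec (.var 0) CB.shift CI.shift CS.shift CL.shift
            CR.shift CT.shift)) S))
  | typerec_trace {D CB CI CS CL CR CT : Con} :
      ConStep (.typerec (.trace D) CB CI CS CL CR CT)
        (.app (.app CT D) (.typerec D CB CI CS CL CR CT))

/-- `Γ ⊢ C = D : K` for constructors and row constructors. Rows are identified up to the order of
fields with different labels. -/
inductive ConEq : Ctx → Con → Con → Kind → Prop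
  | refl {Γ : Ctx} {C : Con} {K : Kind} : ConKind Γ C K → ConEq Γ C C K
  | symm {Γ : Ctx} {C D : Con} {K : Kind} : ConEq Γ D C K → ConEq Γ C D K
  | trans {Γ : Ctx} {C C' C'' : Con} {K : Kind} :
      ConEq Γ C C' K → ConEq Γ C' C'' K → ConEq Γ C C'' K
  | sub {Γ : Ctx} {C D : Con} {K K' : Kind} : ConEq Γ C D K → SubKind K K' → ConEq Γ C D K'
  | eta {Γ : Ctx} {C : Con} {K K' : Kind} : ConKind Γ C (.arrow K K') →
      ConEq Γ (.lam K (.app C.shift (.var 0))) C (.arrow K K')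
  | lam {Γ : Ctx} {C D : Con} {K K' : Kind} : ConEq (.tvar Γ K) C D K' →
      ConEq Γ (.lam K C) (.lam K D) (.arrow K K')
  | app {Γ : Ctx} {C C' D D' : Con} {K K' : Kind} :
      ConEq Γ C C' (.arrow K' K) → ConEq Γ D D' K' → ConEq Γ (.app C D) (.app C' D') K
  | list {Γ : Ctx} {C D : Con} : ConEq Γ C D .type → ConEq Γ (.list C) (.list D) .type
  | record {Γ : Ctx} {S S' : Con} : ConEq Γ S S' .row → ConEq Γ (.record S) (.record S') .type
  | trace {Γ : Ctx} {C D : Con} : ConEq Γ C D .baseType → ConEq Γ (.trace C) (.trace D) .type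
  | step {Γ : Ctx} {C D : Con} {K : Kind} :
      ConKind Γ C K → ConKind Γ D K → ConStep C D → ConEq Γ C D K
  | rnil {Γ : Ctx} {κ ρ : Kind} : RowOf κ ρ → WfCtx Γ → ConEq Γ .rnil .rnil ρ
  | rcons {Γ : Ctx} {κ ρ : Kind} {l : Label} {C D S S' : Con} :
      RowOf κ ρ → ConEq Γ C D κ → ConEq Γ S S' ρ → ConEq Γ (.rcons l C S) (.rcons l D S') ρ
  | swap {Γ : Ctx} {κ ρ : Kind} {l l' : Label} {C D S : Con} :
      RowOf κ ρ → l ≠ l' → ConKind Γ C κ → ConKind Γ D κ → ConKind Γ S ρ →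
      ConEq Γ (.rcons l C (.rcons l' D S)) (.rcons l' D (.rcons l C S)) ρ
  | rmap {Γ : Ctx} {C D S S' : Con} :
      ConEq Γ C D (.arrow .type .type) → ConEq Γ S S' .row →
      ConEq Γ (.rmap C S) (.rmap D S') .row
  | typerec {Γ : Ctx} {K : Kind} {C C' CB CB' CI CI' CS CS' CL CL' CR CR' CT CT' : Con} :
      TypeLike K →
      ConEq Γ C C' .type →
      ConEq Γ CB CB' K →
      ConEq Γ CI CI' K →
      ConEq Γ CS CS' K →
      ConEq Γ CL CL' (.arrow .type (.arrow K K)) →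
      ConEq Γ CR CR' (.arrow .row (.arrow .row K)) →
      ConEq Γ CT CT' (.arrow .baseType (.arrow K K)) →
      ConEq Γ (.typerec C CB CI CS CL CR CT) (.typerec C' CB' CI' CS' CL' CR' CT') K

/-! ### Type equivalence -/

/-- `Γ ⊢ A = B : K` for types and row types. Rows are identified up to the order of fields with
different labels. -/
inductive TyEq : Ctx → Ty → Ty → Kind → Prop
  | refl {Γ : Ctx} {A : Ty} {K : Kind} : TyKind Γ A K → TyEq Γ A A K
  | symm {Γ : Ctx} {A B : Ty} {K : Kind} : TyEq Γ B A K → TyEq Γ A B K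
  | trans {Γ : Ctx} {A B C : Ty} {K : Kind} : TyEq Γ A B K → TyEq Γ B C K → TyEq Γ A C K
  | sub {Γ : Ctx} {A B : Ty} {K K' : Kind} : TyEq Γ A B K → SubKind K K' → TyEq Γ A B K'
  | T_bool {Γ : Ctx} : WfCtx Γ → TyEq Γ (.T .bool) .bool .baseType
  | T_int {Γ : Ctx} : WfCtx Γ → TyEq Γ (.T .int) .int .baseType
  | T_string {Γ : Ctx} : WfCtx Γ → TyEq Γ (.T .string) .string .baseType
  | T_list {Γ : Ctx} {C : Con} : ConKind Γ C .type →
      TyEq Γ (.T (.list C)) (.list (.T C)) .type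
  | T_record {Γ : Ctx} {S : Con} : ConKind Γ S .row →
      TyEq Γ (.T (.record S)) (.record (.T S)) .type
  | T_trace {Γ : Ctx} {C : Con} : ConKind Γ C .baseType →
      TyEq Γ (.T (.trace C)) (.trace (.T C)) .type
  | T_rnil {Γ : Ctx} {κ ρ : Kind} : RowOf κ ρ → WfCtx Γ → TyEq Γ (.T .rnil) .rnil ρ
  | T_rcons {Γ : Ctx} {κ ρ : Kind} {l : Label} {C S : Con} :
      RowOf κ ρ → ConKind Γ C κ → ConKind Γ S ρ →
      TyEq Γ (.T (.rcons l C S)) (.rcons l (.T C) (.T S)) ρ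
  | T_congr {Γ : Ctx} {C D : Con} {K : Kind} : Ground K → ConEq Γ C D K →
      TyEq Γ (.T C) (.T D) K
  | list {Γ : Ctx} {A B : Ty} : TyEq Γ A B .type → TyEq Γ (.list A) (.list B) .type
  | record {Γ : Ctx} {R R' : Ty} : TyEq Γ R R' .row → TyEq Γ (.record R) (.record R') .type
  | trace {Γ : Ctx} {A B : Ty} : TyEq Γ A B .baseType → TyEq Γ (.trace A) (.trace B) .type
  | fn {Γ : Ctx} {A A' B B' : Ty} : TyEq Γ A A' .type → TyEq Γ B B' .type →
      TyEq Γ (.fn A B) (.fn A' B') .type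
  | all {Γ : Ctx} {K : Kind} {A B : Ty} : TyEq (.tvar Γ K) A B .type →
      TyEq Γ (.all K A) (.all K B) .type
  | rnil {Γ : Ctx} {κ ρ : Kind} : RowOf κ ρ → WfCtx Γ → TyEq Γ .rnil .rnil ρ
  | rcons {Γ : Ctx} {κ ρ : Kind} {l : Label} {A B R R' : Ty} :
      RowOf κ ρ → TyEq Γ A B κ → TyEq Γ R R' ρ → TyEq Γ (.rcons l A R) (.rcons l B R') ρ
  | swap {Γ : Ctx} {κ ρ : Kind} {l l' : Label} {A B R : Ty} :
      RowOf κ ρ → l ≠ l' → TyKind Γ A κ → TyKind Γ B κ → TyKind Γ R ρ →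
      TyEq Γ (.rcons l A (.rcons l' B R)) (.rcons l' B (.rcons l A R)) ρ

/-! ### Typing -/

/-- The type-level function
`TRACE = λα. Typerec α (Trace Bool, Trace Int, Trace String, λ_ b. List b, λ_ r. Record r, λ_ b. b)`
that replaces the base types in a query type by their traced versions. -/
def TRACE : Con :=
  .lam .type (.typerec (.var 0) (.trace .bool) (.trace .int) (.trace .string)
    (.lam .type (.lam .type (.list (.var 0))))
    (.lam .row (.lam .row (.record (.var 0))))
    (.lam .baseType (.lam .type (.var 0))))

/-- `T(TRACE C)` -/
def traced (C : Con) : Ty := .T (.app TRACE C)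

/-- `⟨cond : Trace Bool, out : Trace A⟩`, the contents of an `If` trace. -/
def ifTy (A : Ty) : Ty :=
  .record (.rcons .cond (.trace .bool) (.rcons .out (.trace A) .rnil))

/-- `⟨in : T(TRACE C), out : Trace A⟩`, the contents of a `For C` trace. -/
def forTy (C : Con) (A : Ty) : Ty :=
  .record (.rcons .input (traced C) (.rcons .out (.trace A) .rnil))

/-- `⟨table : String, column : String, row : Int, data : A⟩`, the contents of a `Cell` trace. -/
def cellTy (A : Ty) : Ty :=
  .record (.rcons .table .string (.rcons .column .string (.rcons .row .int
    (.rcons .data A .rnil))))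

/-- `⟨left : T(TRACE C), right : T(TRACE C)⟩`, the contents of an `OpEq C` trace. -/
def opEqTy (C : Con) : Ty :=
  .record (.rcons .left (traced C) (.rcons .right (traced C) .rnil))

/-- `⟨left : Trace Int, right : Trace Int⟩`, the contents of an `OpPlus` trace. -/
def opPlusTy : Ty :=
  .record (.rcons .left (.trace .int) (.rcons .right (.trace .int) .rnil))

/-- `Γ ⊢ M : A`. -/
inductive Typed : Ctx → Term → Ty → Prop
  | const {Γ : Ctx} {c : Const} : WfCtx Γ → Typed Γ (.const c) c.ty
  | var {Γ : Ctx} {n : ℕ} {A : Ty} : WfCtx Γ → Γ.VarAt n A → Typed Γ (.var n) A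
  | lam {Γ : Ctx} {A B : Ty} {M : Term} :
      TyKind Γ A .type → Typed (.var Γ A) M B → Typed Γ (.lam A M) (.fn A B)
  | app {Γ : Ctx} {A B : Ty} {M N : Term} :
      Typed Γ M (.fn A B) → Typed Γ N A → Typed Γ (.app M N) B
  | tlam {Γ : Ctx} {K : Kind} {A : Ty} {M : Term} :
      Typed (.tvar Γ K) M A → Typed Γ (.tlam K M) (.all K A)
  | tapp {Γ : Ctx} {K : Kind} {A : Ty} {M : Term} {C : Con} :
      Typed Γ M (.all K A) → ConKind Γ C K → Typed Γ (.tapp M C) (A.inst C)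
  | fix {Γ : Ctx} {A : Ty} {M : Term} :
      TyKind Γ A .type → Typed (.var Γ A) M A → Typed Γ (.fix A M) A
  | ite {Γ : Ctx} {A : Ty} {L M N : Term} :
      Typed Γ L .bool → Typed Γ M A → Typed Γ N A → Typed Γ (.ite L M N) A
  | plus {Γ : Ctx} {M N : Term} :
      Typed Γ M .int → Typed Γ N .int → Typed Γ (.plus M N) .int
  | eq {Γ : Ctx} {A : Ty} {M N : Term} :
      Typed Γ M A → Typed Γ N A → TyKind Γ A .baseType → Typed Γ (.eq M N) .bool
  | table {Γ : Ctx} {n : String} {R : Ty} :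
      WfCtx Γ → TyKind .nil R .baseRow →
      Typed Γ (.table n (.rcons .oid .int R)) (.list (.record (.rcons .oid .int R)))
  | nil {Γ : Ctx} {A : Ty} : TyKind Γ A .type → Typed Γ .nil (.list A)
  | single {Γ : Ctx} {A : Ty} {M : Term} : Typed Γ M A → Typed Γ (.single M) (.list A)
  | append {Γ : Ctx} {A : Ty} {M N : Term} :
      Typed Γ M (.list A) → Typed Γ N (.list A) → Typed Γ (.append M N) (.list A)
  | comp {Γ : Ctx} {A B : Ty} {M N : Term} :
      Typed Γ M (.list A) → Typed (.var Γ A) N (.list B) → Typed Γ (.comp M N) (.list B)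
  | rnil {Γ : Ctx} : WfCtx Γ → Typed Γ .rnil (.record .rnil)
  | rcons {Γ : Ctx} {l : Label} {A R : Ty} {M N : Term} :
      Typed Γ M A → Typed Γ N (.record R) → Typed Γ (.rcons l M N) (.record (.rcons l A R))
  | proj {Γ : Ctx} {l : Label} {A R : Ty} {M : Term} :
      Typed Γ M (.record (.rcons l A R)) → Typed Γ (.proj M l) A
  | conv {Γ : Ctx} {A B : Ty} {M : Term} :
      Typed Γ M B → TyEq Γ A B .type → Typed Γ M A
  | rmap {Γ : Ctx} {C S : Con} {M N : Term} :
      ConKind Γ C (.arrow .type .type) →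
      Typed Γ M (.all .type (.fn (.T (.var 0)) (.T (.app C.shift (.var 0))))) →
      Typed Γ N (.T (.record S)) →
      Typed Γ (.rmap S M N) (.T (.record (.rmap C S)))
  | rfold {Γ : Ctx} {C S : Con} {L M N : Term} :
      Typed Γ L (.fn (.T C) (.fn (.T C) (.T C))) →
      Typed Γ M (.T C) →
      Typed Γ N (.T (.record (.rmap (.lam .type C.shift) S))) →
      Typed Γ (.rfold S L M N) (.T C)
  | typecase {Γ : Ctx} {C : Con} {B : Ty} {MB MI MS ML MR MT : Term} :
      ConKind Γ C .type →
      TyKind (.tvar Γ .type) B .type →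
      Typed Γ MB (B.inst .bool) →
      Typed Γ MI (B.inst .int) →
      Typed Γ MS (B.inst .string) →
      Typed (.tvar Γ .type) ML (B.instUnder (.list (.var 0))) →
      Typed (.tvar Γ .row) MR (B.instUnder (.record (.var 0))) →
      Typed (.tvar Γ .baseType) MT (B.instUnder (.trace (.var 0))) →
      Typed Γ (.typecase C MB MI MS ML MR MT) (B.inst C)
  | trLit_bool {Γ : Ctx} {c : Const} :
      Typed Γ (.const c) .bool → Typed Γ (.trLit (.const c)) (.trace .bool)
  | trLit_int {Γ : Ctx} {c : Const} :
      Typed Γ (.const c) .int → Typed Γ (.trLit (.const c)) (.trace .int)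
  | trLit_string {Γ : Ctx} {c : Const} :
      Typed Γ (.const c) .string → Typed Γ (.trLit (.const c)) (.trace .string)
  | trIf {Γ : Ctx} {A : Ty} {M : Term} :
      Typed Γ M (ifTy A) → Typed Γ (.trIf M) (.trace A)
  | trFor {Γ : Ctx} {A : Ty} {C : Con} {M : Term} :
      ConKind Γ C .type → Typed Γ M (forTy C A) → Typed Γ (.trFor C M) (.trace A)
  | trCell {Γ : Ctx} {A : Ty} {M : Term} :
      TyKind Γ A .baseType → Typed Γ M (cellTy A) → Typed Γ (.trCell M) (.trace A)
  | trOpEq {Γ : Ctx} {C : Con} {M : Term} :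
      ConKind Γ C .baseType → Typed Γ M (opEqTy C) → Typed Γ (.trOpEq C M) (.trace .bool)
  | trOpPlus {Γ : Ctx} {M : Term} :
      Typed Γ M opPlusTy → Typed Γ (.trOpPlus M) (.trace .int)
  | tracecase {Γ : Ctx} {A B : Ty} {M ML MI MF MC ME MP : Term} :
      Typed Γ M (.trace A) →
      Typed (.var Γ A) ML B →
      Typed (.var Γ (ifTy A)) MI B →
      Typed (.var (.tvar Γ .type) (forTy (.var 0) A.shift)) MF B.shift →
      Typed (.var Γ (cellTy A)) MC B →
      Typed (.var (.tvar Γ .baseType) (opEqTy (.var 0))) ME B.shift →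
      Typed (.var Γ opPlusTy) MP B →
      Typed Γ (.tracecase M ML MI MF MC ME MP) B

/-! ### Reduction of terms -/

/-- The closed row constructor `l₁ : C₁; …; lₙ : Cₙ; ·`. -/
def Con.ofFields : List (Label × Con) → Con
  | [] => .rnil
  | (l, C) :: fs => .rcons l C (Con.ofFields fs)

/-- `⟨l₁ = (M C₁) N.l₁; …; lₙ = (M Cₙ) N.lₙ⟩` -/
def unrollMap (M N : Term) : List (Label × Con) → Term
  | [] => .rnil
  | (l, C) :: fs => .rcons l (.app (.tapp M C) (.proj N l)) (unrollMap M N fs)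

/-- `L N.l₁ (L N.l₂ … (L N.lₙ M) …)` -/
def unrollFold (L M N : Term) : List (Label × Con) → Term
  | [] => M
  | (l, _) :: fs => .app (.app L (.proj N l)) (unrollFold L M N fs)

/-- `FieldOf l P M`: the record term `P` is a record literal whose (first) `l`-field is `M`. -/
inductive FieldOf (l : Label) : Term → Term → Prop
  | here {M N : Term} : FieldOf l (.rcons l M N) M
  | there {l' : Label} {M M' N : Term} : l' ≠ l → FieldOf l N M → FieldOf l (.rcons l' M' N) M

/-- `M ⤳ M'` for terms. -/
inductive Step : Term → Term → Prop
  -- β-rules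
  | beta {A : Ty} {M N : Term} : Step (.app (.lam A M) N) (M.instTm N)
  | fix {A : Ty} {M : Term} : Step (.fix A M) (M.instTm (.fix A M))
  | tbeta {K : Kind} {M : Term} {C : Con} : Step (.tapp (.tlam K M) C) (M.instTy C)
  | ite_true {M N : Term} : Step (.ite (.const (.bool true)) M N) M
  | ite_false {M N : Term} : Step (.ite (.const (.bool false)) M N) N
  | proj_record {l : Label} {P M : Term} : FieldOf l P M → Step (.proj P l) M
  | rmap_unroll {fs : List (Label × Con)} {M N : Term} : (fs.map Prod.fst).Nodup →
      Step (.rmap (Con.ofFields fs) M N) (unrollMap M N fs)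
  | rfold_unroll {fs : List (Label × Con)} {L M N : Term} : (fs.map Prod.fst).Nodup →
      Step (.rfold (Con.ofFields fs) L M N) (unrollFold L M N fs)
  | comp_nil {N : Term} : Step (.comp .nil N) .nil
  | comp_single {M N : Term} : Step (.comp (.single M) N) (N.instTm M)
  | tracecase_lit {M ML MI MF MC ME MP : Term} :
      Step (.tracecase (.trLit M) ML MI MF MC ME MP) (ML.instTm M)
  | tracecase_if {M ML MI MF MC ME MP : Term} :
      Step (.tracecase (.trIf M) ML MI MF MC ME MP) (MI.instTm M)
  | tracecase_for {C : Con} {M ML MI MF MC ME MP : Term} :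
      Step (.tracecase (.trFor C M) ML MI MF MC ME MP) (MF.instBoth C M)
  | tracecase_cell {M ML MI MF MC ME MP : Term} :
      Step (.tracecase (.trCell M) ML MI MF MC ME MP) (MC.instTm M)
  | tracecase_opEq {C : Con} {M ML MI MF MC ME MP : Term} :
      Step (.tracecase (.trOpEq C M) ML MI MF MC ME MP) (ME.instBoth C M)
  | tracecase_opPlus {M ML MI MF MC ME MP : Term} :
      Step (.tracecase (.trOpPlus M) ML MI MF MC ME MP) (MP.instTm M)
  | typecase_bool {MB MI MS ML MR MT : Term} :
      Step (.typecase .bool MB MI MS ML MR MT) MB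
  | typecase_int {MB MI MS ML MR MT : Term} :
      Step (.typecase .int MB MI MS ML MR MT) MI
  | typecase_string {MB MI MS ML MR MT : Term} :
      Step (.typecase .string MB MI MS ML MR MT) MS
  | typecase_list {C : Con} {MB MI MS ML MR MT : Term} :
      Step (.typecase (.list C) MB MI MS ML MR MT) (ML.instTy C)
  | typecase_record {S : Con} {MB MI MS ML MR MT : Term} :
      Step (.typecase (.record S) MB MI MS ML MR MT) (MR.instTy S)
  | typecase_trace {C : Con} {MB MI MS ML MR MT : Term} :
      Step (.typecase (.trace C) MB MI MS ML MR MT) (MT.instTy C)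
  -- commuting conversions
  | app_ite {L M₁ M₂ N : Term} :
      Step (.app (.ite L M₁ M₂) N) (.ite L (.app M₁ N) (.app M₂ N))
  | tapp_ite {L M₁ M₂ : Term} {C : Con} :
      Step (.tapp (.ite L M₁ M₂) C) (.ite L (.tapp M₁ C) (.tapp M₂ C))
  | proj_ite {L M N : Term} {l : Label} :
      Step (.proj (.ite L M N) l) (.ite L (.proj M l) (.proj N l))
  | comp_append {M₁ M₂ N : Term} :
      Step (.comp (.append M₁ M₂) N) (.append (.comp M₁ N) (.comp M₂ N))
  | comp_comp {L M N : Term} :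
      Step (.comp (.comp L M) N) (.comp L (.comp M N.shiftUnder))
  | ite_ite {L M₁ M₂ N₁ N₂ : Term} :
      Step (.ite (.ite L M₁ M₂) N₁ N₂) (.ite L (.ite M₁ N₁ N₂) (.ite M₂ N₁ N₂))
  | comp_ite {L M₁ M₂ N : Term} :
      Step (.comp (.ite L M₁ M₂) N) (.ite L (.comp M₁ N) (.comp M₂ N))
  | tracecase_ite {L M₁ M₂ ML MI MF MC ME MP : Term} :
      Step (.tracecase (.ite L M₁ M₂) ML MI MF MC ME MP)
        (.ite L (.tracecase M₁ ML MI MF MC ME MP) (.tracecase M₂ ML MI MF MC ME MP))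
  -- congruence rules
  | lam {A : Ty} {M M' : Term} : Step M M' → Step (.lam A M) (.lam A M')
  | app_fun {M M' N : Term} : Step M M' → Step (.app M N) (.app M' N)
  | app_arg {M N N' : Term} : Step N N' → Step (.app M N) (.app M N')
  | tlam {K : Kind} {M M' : Term} : Step M M' → Step (.tlam K M) (.tlam K M')
  | tapp_fun {M M' : Term} {C : Con} : Step M M' → Step (.tapp M C) (.tapp M' C)
  | tapp_arg {M : Term} {C C' : Con} : ConStep C C' → Step (.tapp M C) (.tapp M C')
  | ite_cond {L L' M N : Term} : Step L L' → Step (.ite L M N) (.ite L' M N)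
  | ite_then {L M M' N : Term} : Step M M' → Step (.ite L M N) (.ite L M' N)
  | ite_else {L M N N' : Term} : Step N N' → Step (.ite L M N) (.ite L M N')
  | rcons_head {l : Label} {M M' N : Term} : Step M M' → Step (.rcons l M N) (.rcons l M' N)
  | rcons_tail {l : Label} {M N N' : Term} : Step N N' → Step (.rcons l M N) (.rcons l M N')
  | proj {M M' : Term} {l : Label} : Step M M' → Step (.proj M l) (.proj M' l)
  | rmap_row {S S' : Con} {M N : Term} : ConStep S S' → Step (.rmap S M N) (.rmap S' M N)
  | rmap_fun {S : Con} {M M' N : Term} : Step M M' → Step (.rmap S M N) (.rmap S M' N)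
  | rmap_arg {S : Con} {M N N' : Term} : Step N N' → Step (.rmap S M N) (.rmap S M N')
  | rfold_row {S S' : Con} {L M N : Term} :
      ConStep S S' → Step (.rfold S L M N) (.rfold S' L M N)
  | rfold_fun {S : Con} {L L' M N : Term} : Step L L' → Step (.rfold S L M N) (.rfold S L' M N)
  | rfold_init {S : Con} {L M M' N : Term} : Step M M' → Step (.rfold S L M N) (.rfold S L M' N)
  | rfold_arg {S : Con} {L M N N' : Term} : Step N N' → Step (.rfold S L M N) (.rfold S L M N')
  | single {M M' : Term} : Step M M' → Step (.single M) (.single M')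
  | append_left {M M' N : Term} : Step M M' → Step (.append M N) (.append M' N)
  | append_right {M N N' : Term} : Step N N' → Step (.append M N) (.append M N')
  | eq_left {M M' N : Term} : Step M M' → Step (.eq M N) (.eq M' N)
  | eq_right {M N N' : Term} : Step N N' → Step (.eq M N) (.eq M N')
  | plus_left {M M' N : Term} : Step M M' → Step (.plus M N) (.plus M' N)
  | plus_right {M N N' : Term} : Step N N' → Step (.plus M N) (.plus M N')
  | comp_src {M M' N : Term} : Step M M' → Step (.comp M N) (.comp M' N)
  | comp_body {M N N' : Term} : Step N N' → Step (.comp M N) (.comp M N')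
  | trLit {M M' : Term} : Step M M' → Step (.trLit M) (.trLit M')
  | trIf {M M' : Term} : Step M M' → Step (.trIf M) (.trIf M')
  | trFor_con {C C' : Con} {M : Term} : ConStep C C' → Step (.trFor C M) (.trFor C' M)
  | trFor {C : Con} {M M' : Term} : Step M M' → Step (.trFor C M) (.trFor C M')
  | trCell {M M' : Term} : Step M M' → Step (.trCell M) (.trCell M')
  | trOpEq_con {C C' : Con} {M : Term} : ConStep C C' → Step (.trOpEq C M) (.trOpEq C' M)
  | trOpEq {C : Con} {M M' : Term} : Step M M' → Step (.trOpEq C M) (.trOpEq C M')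
  | trOpPlus {M M' : Term} : Step M M' → Step (.trOpPlus M) (.trOpPlus M')
  | tracecase_scrut {M M' ML MI MF MC ME MP : Term} : Step M M' →
      Step (.tracecase M ML MI MF MC ME MP) (.tracecase M' ML MI MF MC ME MP)
  | tracecase_L {M ML ML' MI MF MC ME MP : Term} : Step ML ML' →
      Step (.tracecase M ML MI MF MC ME MP) (.tracecase M ML' MI MF MC ME MP)
  | tracecase_I {M ML MI MI' MF MC ME MP : Term} : Step MI MI' →
      Step (.tracecase M ML MI MF MC ME MP) (.tracecase M ML MI' MF MC ME MP)
  | tracecase_F {M ML MI MF MF' MC ME MP : Term} : Step MF MF' →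
      Step (.tracecase M ML MI MF MC ME MP) (.tracecase M ML MI MF' MC ME MP)
  | tracecase_C {M ML MI MF MC MC' ME MP : Term} : Step MC MC' →
      Step (.tracecase M ML MI MF MC ME MP) (.tracecase M ML MI MF MC' ME MP)
  | tracecase_E {M ML MI MF MC ME ME' MP : Term} : Step ME ME' →
      Step (.tracecase M ML MI MF MC ME MP) (.tracecase M ML MI MF MC ME' MP)
  | tracecase_P {M ML MI MF MC ME MP MP' : Term} : Step MP MP' →
      Step (.tracecase M ML MI MF MC ME MP) (.tracecase M ML MI MF MC ME MP')
  | typecase_scrut {C C' : Con} {MB MI MS ML MR MT : Term} : ConStep C C' →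
      Step (.typecase C MB MI MS ML MR MT) (.typecase C' MB MI MS ML MR MT)
  | typecase_B {C : Con} {MB MB' MI MS ML MR MT : Term} : Step MB MB' →
      Step (.typecase C MB MI MS ML MR MT) (.typecase C MB' MI MS ML MR MT)
  | typecase_I {C : Con} {MB MI MI' MS ML MR MT : Term} : Step MI MI' →
      Step (.typecase C MB MI MS ML MR MT) (.typecase C MB MI' MS ML MR MT)
  | typecase_S {C : Con} {MB MI MS MS' ML MR MT : Term} : Step MS MS' →
      Step (.typecase C MB MI MS ML MR MT) (.typecase C MB MI MS' ML MR MT)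
  | typecase_L {C : Con} {MB MI MS ML ML' MR MT : Term} : Step ML ML' →
      Step (.typecase C MB MI MS ML MR MT) (.typecase C MB MI MS ML' MR MT)
  | typecase_R {C : Con} {MB MI MS ML MR MR' MT : Term} : Step MR MR' →
      Step (.typecase C MB MI MS ML MR MT) (.typecase C MB MI MS ML MR' MT)
  | typecase_T {C : Con} {MB MI MS ML MR MT MT' : Term} : Step MT MT' →
      Step (.typecase C MB MI MS ML MR MT) (.typecase C MB MI MS ML MR MT')

end LinksT

namespace LinksT

/-! ### Substitution algebra for constructors and types -/

-- The proof is by induction on the typing derivation, so that uses of the conversion rule are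
-- absorbed by the induction hypothesis. In a β-step an introduction form meets an elimination form,
-- and inversion of the introduction form, which is possible only up to conversion, gives an
-- equation such as `A → B = A' → B'`. The contractum is typable because such an equation splits
-- into equations between the components. Injectivity of the type formers under `TyEq` is thus the
-- heart of the matter. It cannot be read off the rules: equivalence is closed under transitivity
-- and mixes β, η, `Typerec`, `Rmap` and the exchange of fields.
--
-- Injectivity is obtained semantically. Weak head reduction `Whr` is deterministic. Over it,
-- `LogRel` is a Kripke logical relation, defined by recursion on kinds. At the kinds of types, both
-- sides evaluate to the same head constructor with related arguments, or both to neutral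
-- constructors. At the kinds of rows, equal labels have related first fields. At arrow kinds,
-- related arguments have related results in every renamed context. Looking only at first fields
-- makes the relation blind to the exchange of different labels, yet keeps all that projection
-- needs. The relation descends into arguments and fields because `Typerec` recurses through them
-- (`TypeRel.typerec`). `ConEq` itself is a conjunct at every kind, so equations can be read back at
-- once. The fundamental theorem is `ConKind.valid` together with `ConEq.valid`; it says in
-- particular that equivalent constructors are related (`ConEq.logRel`) and that a type respects
-- equivalence of the constructors substituted into it (`TyKind.subst_eq`).
--
-- Types need no second logical relation, since type-level computation consumes constructors and
-- never types. A direct induction (`TyEq.sameShape`) shows that equivalent types have the same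
-- outermost former with equivalent components, and that equivalent row types have equivalent first
-- fields. The transitivity case works because the former and the field map are determined by the
-- type. From this follow `TyEq.fn_inj`, `TyEq.list_inj`, `TyEq.trace_inj`, `TyEq.all_inj` and
-- `TyEq.record_fields`.
--
-- What remains is syntactic: subject reduction for constructors (`ConStep.kind`), substitution in
-- typing derivations (`Typed.substOf`), inversion of typing up to conversion, and records. A step
-- inside a constructor argument may change the type of the term, which `TyKind.inst_eq` and the
-- congruence rules repair by conversion. Unrolling `rmap` and `rfold` requires each field to be
-- brought to the front of its row, and here the labels must be distinct (`ConEq.field_first`).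

theorem upCon_var_comp (ξ : ℕ → ℕ) :
    upCon (fun n => .var (ξ n)) = fun n => .var (upRen ξ n) := by
  funext n; cases n <;> rfl

theorem Con.rename_eq_subst (C : Con) (ξ : ℕ → ℕ) :
    C.rename ξ = C.subst (fun n => .var (ξ n)) := by
  induction C generalizing ξ <;> simp_all [Con.rename, Con.subst, upCon_var_comp]

theorem upCon_var : upCon Con.var = Con.var := by
  funext n; cases n <;> rfl

theorem Con.subst_var (C : Con) : C.subst Con.var = C := by
  induction C <;> simp_all [Con.subst, upCon_var]

theorem Con.rename_id (C : Con) : C.rename id = C := by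
  rw [Con.rename_eq_subst]; exact C.subst_var

theorem upCon_comp_upRen (σ : ℕ → Con) (ξ : ℕ → ℕ) :
    (fun n => upCon σ (upRen ξ n)) = upCon (fun n => σ (ξ n)) := by
  funext n; cases n <;> rfl

/-- The composition laws come in stages: lifting a substitution under a binder weakens its values by
a renaming, so each law relies on the previous ones at the binder. -/
theorem Con.rename_subst (C : Con) (ξ : ℕ → ℕ) (σ : ℕ → Con) :
    (C.rename ξ).subst σ = C.subst (fun n => σ (ξ n)) := by
  induction C generalizing ξ σ <;> simp_all [Con.rename, Con.subst, upCon_comp_upRen]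

theorem Con.rename_rename (C : Con) (ξ ξ' : ℕ → ℕ) :
    (C.rename ξ).rename ξ' = C.rename (fun n => ξ' (ξ n)) := by
  rw [Con.rename_eq_subst, Con.rename_subst, ← Con.rename_eq_subst]

theorem upCon_rename (σ : ℕ → Con) (ξ : ℕ → ℕ) :
    (fun n => (upCon σ n).rename (upRen ξ)) = upCon (fun n => (σ n).rename ξ) := by
  funext n
  cases n with
  | zero => rfl
  | succ n => simp only [upCon, scons, Con.shift, Con.rename_rename]; rfl

theorem Con.subst_rename (C : Con) (σ : ℕ → Con) (ξ : ℕ → ℕ) :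
    (C.subst σ).rename ξ = C.subst (fun n => (σ n).rename ξ) := by
  induction C generalizing ξ σ <;> simp_all [Con.rename, Con.subst, upCon_rename]

theorem upCon_subst (σ σ' : ℕ → Con) :
    (fun n => (upCon σ n).subst (upCon σ')) = upCon (fun n => (σ n).subst σ') := by
  funext n
  cases n with
  | zero => rfl
  | succ n =>
    simp only [upCon, scons, Con.shift, Con.rename_subst, Con.subst_rename]

theorem Con.subst_subst (C : Con) (σ σ' : ℕ → Con) :
    (C.subst σ).subst σ' = C.subst (fun n => (σ n).subst σ') := by
  induction C generalizing σ σ' <;> simp_all [Con.subst, upCon_subst]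

theorem Con.shift_subst_scons (C D : Con) (σ : ℕ → Con) :
    C.shift.subst (scons D σ) = C.subst σ :=
  Con.rename_subst _ _ _

theorem Con.shift_subst_upCon (C : Con) (σ : ℕ → Con) :
    C.shift.subst (upCon σ) = (C.subst σ).shift := by
  simp only [Con.shift, Con.rename_subst, Con.subst_rename]; rfl

theorem Con.shift_inst (C D : Con) : C.shift.inst D = C := by
  rw [Con.inst, Con.shift_subst_scons, Con.subst_var]

theorem subst_scons_var (D : Con) (σ : ℕ → Con) :
    (fun n => (scons D Con.var n).subst σ) = scons (D.subst σ) σ := by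
  funext n; cases n <;> rfl

theorem upCon_subst_scons (D : Con) (σ σ' : ℕ → Con) :
    (fun n => (upCon σ n).subst (scons D σ')) = scons D (fun n => (σ n).subst σ') := by
  funext n
  cases n with
  | zero => rfl
  | succ n => exact Con.shift_subst_scons _ _ _

theorem Con.inst_subst (C D : Con) (σ : ℕ → Con) :
    (C.inst D).subst σ = (C.subst (upCon σ)).inst (D.subst σ) := by
  simp only [Con.inst, Con.subst_subst, subst_scons_var, upCon_subst_scons, Con.subst_var]

theorem Con.subst_upCon_inst (C D : Con) (σ : ℕ → Con) :
    (C.subst (upCon σ)).inst D = C.subst (scons D σ) := by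
  simp only [Con.inst, Con.subst_subst, upCon_subst_scons, Con.subst_var]

theorem Con.shift_eq_subst (C : Con) : C.shift = C.subst (fun n => .var (n + 1)) :=
  Con.rename_eq_subst _ _

theorem Ty.rename_eq_subst (A : Ty) (ξ : ℕ → ℕ) :
    A.rename ξ = A.subst (fun n => .var (ξ n)) := by
  induction A generalizing ξ <;>
    simp_all [Ty.rename, Ty.subst, upCon_var_comp, Con.rename_eq_subst]

theorem Ty.subst_var (A : Ty) : A.subst Con.var = A := by
  induction A <;> simp_all [Ty.subst, upCon_var, Con.subst_var]

theorem Ty.rename_id (A : Ty) : A.rename id = A := by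
  rw [Ty.rename_eq_subst]; exact A.subst_var

theorem Ty.subst_subst (A : Ty) (σ σ' : ℕ → Con) :
    (A.subst σ).subst σ' = A.subst (fun n => (σ n).subst σ') := by
  induction A generalizing σ σ' <;> simp_all [Ty.subst, upCon_subst, Con.subst_subst]

theorem Ty.rename_subst (A : Ty) (ξ : ℕ → ℕ) (σ : ℕ → Con) :
    (A.rename ξ).subst σ = A.subst (fun n => σ (ξ n)) := by
  rw [Ty.rename_eq_subst, Ty.subst_subst]; rfl

theorem Ty.shift_subst_scons (A : Ty) (D : Con) (σ : ℕ → Con) :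
    A.shift.subst (scons D σ) = A.subst σ :=
  Ty.rename_subst _ _ _

theorem Ty.shift_eq_subst (A : Ty) : A.shift = A.subst (fun n => .var (n + 1)) :=
  Ty.rename_eq_subst _ _

theorem Ty.shift_subst_upCon (A : Ty) (σ : ℕ → Con) :
    A.shift.subst (upCon σ) = (A.subst σ).shift := by
  simp only [Ty.shift_eq_subst, Ty.subst_subst]
  congr 1
  funext n
  exact Con.shift_eq_subst _

theorem Ty.inst_subst (A : Ty) (D : Con) (σ : ℕ → Con) :
    (A.inst D).subst σ = (A.subst (upCon σ)).inst (D.subst σ) := by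
  simp only [Ty.inst, Ty.subst_subst, subst_scons_var, upCon_subst_scons, Con.subst_var]

theorem Ty.shift_inst (A : Ty) (D : Con) : A.shift.inst D = A := by
  rw [Ty.inst, Ty.shift_subst_scons, Ty.subst_var]

theorem Ty.instUnder_subst (A : Ty) (D : Con) (σ : ℕ → Con) :
    (A.instUnder D).subst (upCon σ) = (A.subst (upCon σ)).instUnder (D.subst (upCon σ)) := by
  simp only [Ty.instUnder, Ty.subst_subst]
  congr 1
  funext n
  cases n with
  | zero => rfl
  | succ n =>
    change (σ n).shift = (σ n).shift.subst _
    rw [Con.shift_subst_scons, Con.shift_eq_subst]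

/-- This is what types the contractum of `typecase`: for instance `B[α := List β][β := C]` is `B[α
:= List C]`. -/
theorem Ty.instUnder_inst (A : Ty) (D E : Con) :
    (A.instUnder D).inst E = A.inst (D.inst E) := by
  simp only [Ty.instUnder, Ty.inst, Ty.subst_subst]
  congr 1
  funext n
  cases n <;> rfl

/-! ### Kinding of constructors -/

/-- Kinding is mutual with well-formedness of contexts only through the leaves of derivations.
Trivial motives for the other two judgements leave an ordinary induction principle. -/
theorem ConKind.induction {motive : ∀ Γ C K, ConKind Γ C K → Prop}
    (bool : ∀ {Γ} (w : WfCtx Γ), motive Γ .bool .baseType (.bool w))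
    (int : ∀ {Γ} (w : WfCtx Γ), motive Γ .int .baseType (.int w))
    (string : ∀ {Γ} (w : WfCtx Γ), motive Γ .string .baseType (.string w))
    (var : ∀ {Γ n K} (w : WfCtx Γ) (h : Γ.TVarAt n K), motive Γ (.var n) K (.var w h))
    (lam : ∀ {Γ K₁ K₂ C} (h : ConKind (.tvar Γ K₁) C K₂), motive (.tvar Γ K₁) C K₂ h →
      motive Γ (.lam K₁ C) (.arrow K₁ K₂) (.lam h))
    (app : ∀ {Γ K₁ K₂ C D} (h : ConKind Γ C (.arrow K₁ K₂)) (h' : ConKind Γ D K₁),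
      motive Γ C (.arrow K₁ K₂) h → motive Γ D K₁ h' → motive Γ (.app C D) K₂ (.app h h'))
    (list : ∀ {Γ C} (h : ConKind Γ C .type), motive Γ C .type h →
      motive Γ (.list C) .type (.list h))
    (record : ∀ {Γ S} (h : ConKind Γ S .row), motive Γ S .row h →
      motive Γ (.record S) .type (.record h))
    (trace : ∀ {Γ C} (h : ConKind Γ C .baseType), motive Γ C .baseType h →
      motive Γ (.trace C) .type (.trace h))
    (typerec : ∀ {Γ K C CB CI CS CL CR CT} (t : TypeLike K)
      (h : ConKind Γ C .type) (hB : ConKind Γ CB K) (hI : ConKind Γ CI K) (hS : ConKind Γ CS K)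
      (hL : ConKind Γ CL (.arrow .type (.arrow K K)))
      (hR : ConKind Γ CR (.arrow .row (.arrow .row K)))
      (hT : ConKind Γ CT (.arrow .baseType (.arrow K K))),
      motive Γ C .type h → motive Γ CB K hB → motive Γ CI K hI → motive Γ CS K hS →
      motive Γ CL (.arrow .type (.arrow K K)) hL →
      motive Γ CR (.arrow .row (.arrow .row K)) hR →
      motive Γ CT (.arrow .baseType (.arrow K K)) hT →
      motive Γ (.typerec C CB CI CS CL CR CT) K (.typerec t h hB hI hS hL hR hT))
    (rnil : ∀ {Γ κ ρ} (r : RowOf κ ρ) (w : WfCtx Γ), motive Γ .rnil ρ (.rnil r w))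
    (rcons : ∀ {Γ κ ρ l C S} (r : RowOf κ ρ) (h : ConKind Γ C κ) (h' : ConKind Γ S ρ),
      motive Γ C κ h → motive Γ S ρ h' → motive Γ (.rcons l C S) ρ (.rcons r h h'))
    (rmap : ∀ {Γ C S} (h : ConKind Γ C (.arrow .type .type)) (h' : ConKind Γ S .row),
      motive Γ C (.arrow .type .type) h → motive Γ S .row h' →
      motive Γ (.rmap C S) .row (.rmap h h'))
    (sub : ∀ {Γ C K K'} (h : ConKind Γ C K) (s : SubKind K K'), motive Γ C K h →
      motive Γ C K' (.sub h s))
    {Γ : Ctx} {C : Con} {K : Kind} (h : ConKind Γ C K) : motive Γ C K h :=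
  ConKind.rec (motive_1 := fun _ _ => True) (motive_2 := motive)
    (motive_3 := fun _ _ _ _ => True)
    trivial (fun _ _ => trivial) (fun _ _ => trivial)
    (fun w _ => bool w) (fun w _ => int w) (fun w _ => string w) (fun w h _ => var w h)
    lam app list record trace typerec (fun r w _ => rnil r w) rcons rmap sub
    (fun _ _ _ => trivial) (fun _ _ => trivial) (fun _ _ => trivial) (fun _ _ => trivial)
    (fun _ _ _ => trivial) (fun _ _ => trivial) (fun _ _ _ _ => trivial) (fun _ _ => trivial)
    (fun _ _ => trivial) (fun _ _ => trivial) (fun _ _ _ => trivial)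
    (fun _ _ _ _ _ => trivial) h

theorem TyKind.induction {motive : ∀ Γ A K, TyKind Γ A K → Prop}
    (T : ∀ {Γ C K} (g : Ground K) (h : ConKind Γ C K), motive Γ (.T C) K (.T g h))
    (bool : ∀ {Γ} (w : WfCtx Γ), motive Γ .bool .baseType (.bool w))
    (int : ∀ {Γ} (w : WfCtx Γ), motive Γ .int .baseType (.int w))
    (string : ∀ {Γ} (w : WfCtx Γ), motive Γ .string .baseType (.string w))
    (sub : ∀ {Γ A K K'} (h : TyKind Γ A K) (s : SubKind K K'), motive Γ A K h →
      motive Γ A K' (.sub h s))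
    (all : ∀ {Γ K A} (h : TyKind (.tvar Γ K) A .type), motive (.tvar Γ K) A .type h →
      motive Γ (.all K A) .type (.all h))
    (fn : ∀ {Γ A B} (h : TyKind Γ A .type) (h' : TyKind Γ B .type), motive Γ A .type h →
      motive Γ B .type h' → motive Γ (.fn A B) .type (.fn h h'))
    (list : ∀ {Γ A} (h : TyKind Γ A .type), motive Γ A .type h →
      motive Γ (.list A) .type (.list h))
    (record : ∀ {Γ R} (h : TyKind Γ R .row), motive Γ R .row h →
      motive Γ (.record R) .type (.record h))
    (trace : ∀ {Γ A} (h : TyKind Γ A .baseType), motive Γ A .baseType h →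
      motive Γ (.trace A) .type (.trace h))
    (rnil : ∀ {Γ κ ρ} (r : RowOf κ ρ) (w : WfCtx Γ), motive Γ .rnil ρ (.rnil r w))
    (rcons : ∀ {Γ κ ρ l A R} (r : RowOf κ ρ) (h : TyKind Γ A κ) (h' : TyKind Γ R ρ),
      motive Γ A κ h → motive Γ R ρ h' → motive Γ (.rcons l A R) ρ (.rcons r h h'))
    {Γ : Ctx} {A : Ty} {K : Kind} (h : TyKind Γ A K) : motive Γ A K h :=
  TyKind.rec (motive_1 := fun _ _ => True) (motive_2 := fun _ _ _ _ => True)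
    (motive_3 := motive)
    trivial (fun _ _ => trivial) (fun _ _ => trivial)
    (fun _ _ => trivial) (fun _ _ => trivial) (fun _ _ => trivial) (fun _ _ _ => trivial)
    (fun _ _ => trivial) (fun _ _ _ _ => trivial) (fun _ _ => trivial)
    (fun _ _ => trivial) (fun _ _ => trivial)
    (fun _ _ _ _ _ _ _ _ _ _ _ _ _ _ _ => trivial)
    (fun _ _ _ => trivial) (fun _ _ _ _ _ => trivial)
    (fun _ _ _ _ => trivial) (fun _ _ _ => trivial)
    (fun g h _ => T g h) (fun w _ => bool w) (fun w _ => int w) (fun w _ => string w)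
    sub all fn list record trace (fun r w _ => rnil r w) rcons h

theorem ConKind.wf {Γ : Ctx} {C : Con} {K : Kind} (h : ConKind Γ C K) : WfCtx Γ := by
  induction h using ConKind.induction with
  | lam _ ih => cases ih; assumption
  | _ => assumption

theorem TyKind.wf {Γ : Ctx} {A : Ty} {K : Kind} (h : TyKind Γ A K) : WfCtx Γ := by
  induction h using TyKind.induction with
  | T _ h => exact h.wf
  | all _ ih => cases ih; assumption
  | _ => assumption

/-- Type variables of `Γ` are renamed by `ξ` to type variables of `Γ'` of the same kind. -/
structure Ren (Γ Γ' : Ctx) (ξ : ℕ → ℕ) : Prop where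
  wf : WfCtx Γ'
  tvar : ∀ {n K}, Γ.TVarAt n K → Γ'.TVarAt (ξ n) K

theorem Ren.up {Γ Γ' : Ctx} {ξ : ℕ → ℕ} (h : Ren Γ Γ' ξ) (K : Kind) :
    Ren (.tvar Γ K) (.tvar Γ' K) (upRen ξ) where
  wf := .tvar h.wf
  tvar hn := by
    cases hn with
    | here => exact .here
    | tvar hn => exact .tvar (h.tvar hn)

theorem Ren.id {Γ : Ctx} (h : WfCtx Γ) : Ren Γ Γ id := ⟨h, fun h => h⟩

theorem Ren.comp {Γ Γ' Γ'' : Ctx} {ξ ξ' : ℕ → ℕ} (h : Ren Γ Γ' ξ) (h' : Ren Γ' Γ'' ξ') :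
    Ren Γ Γ'' (fun n => ξ' (ξ n)) := ⟨h'.wf, fun hn => h'.tvar (h.tvar hn)⟩

theorem Ren.succ {Γ : Ctx} (h : WfCtx Γ) (K : Kind) : Ren Γ (.tvar Γ K) Nat.succ :=
  ⟨.tvar h, .tvar⟩

theorem Ren.addVar {Γ : Ctx} {A : Ty} (h : WfCtx (.var Γ A)) : Ren Γ (.var Γ A) (fun n => n) :=
  ⟨h, .var⟩

theorem WfCtx.of_var {Γ : Ctx} {A : Ty} (h : WfCtx (.var Γ A)) : TyKind Γ A .type := by
  cases h; assumption

/-- Kinds depend on the type variables alone, and these are numbered separately, so the identity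
renaming removes a term variable. -/
theorem Ren.dropVar {Γ : Ctx} {A : Ty} (h : WfCtx (.var Γ A)) : Ren (.var Γ A) Γ (fun n => n) :=
  ⟨h.of_var.wf, fun hn => by cases hn; assumption⟩

theorem ConKind.rename {Γ Γ' : Ctx} {C : Con} {K : Kind} {ξ : ℕ → ℕ} (h : ConKind Γ C K)
    (hξ : Ren Γ Γ' ξ) : ConKind Γ' (C.rename ξ) K := by
  induction h using ConKind.induction generalizing Γ' ξ with
  | bool => exact .bool hξ.wf
  | int => exact .int hξ.wf
  | string => exact .string hξ.wf
  | var _ h => exact .var hξ.wf (hξ.tvar h)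
  | lam _ ih => exact .lam (ih (hξ.up _))
  | app _ _ ih ih' => exact .app (ih hξ) (ih' hξ)
  | list _ ih => exact .list (ih hξ)
  | record _ ih => exact .record (ih hξ)
  | trace _ ih => exact .trace (ih hξ)
  | typerec hK _ _ _ _ _ _ _ h hB hI hS hL hR hT =>
    exact .typerec hK (h hξ) (hB hξ) (hI hξ) (hS hξ) (hL hξ) (hR hξ) (hT hξ)
  | rnil r => exact .rnil r hξ.wf
  | rcons r _ _ ih ih' => exact .rcons r (ih hξ) (ih' hξ)
  | rmap _ _ ih ih' => exact .rmap (ih hξ) (ih' hξ)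
  | sub _ s ih => exact .sub (ih hξ) s

theorem ConKind.shift {Γ : Ctx} {C : Con} {K : Kind} (h : ConKind Γ C K) (K' : Kind) :
    ConKind (.tvar Γ K') C.shift K := h.rename (.succ h.wf K')

/-- `σ` maps the type variables of `Γ` to constructors of the same kind over `Γ'`. -/
structure ConSub (Γ Γ' : Ctx) (σ : ℕ → Con) : Prop where
  wf : WfCtx Γ'
  tvar : ∀ {n K}, Γ.TVarAt n K → ConKind Γ' (σ n) K

theorem ConSub.up {Γ Γ' : Ctx} {σ : ℕ → Con} (h : ConSub Γ Γ' σ) (K : Kind) :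
    ConSub (.tvar Γ K) (.tvar Γ' K) (upCon σ) where
  wf := .tvar h.wf
  tvar hn := by
    cases hn with
    | here => exact .var (.tvar h.wf) .here
    | tvar hn => exact (h.tvar hn).shift K

theorem ConSub.scons {Γ Γ' : Ctx} {σ : ℕ → Con} {D : Con} {K : Kind} (h : ConSub Γ Γ' σ)
    (hD : ConKind Γ' D K) : ConSub (.tvar Γ K) Γ' (LinksT.scons D σ) where
  wf := h.wf
  tvar hn := by
    cases hn with
    | here => exact hD
    | tvar hn => exact h.tvar hn

theorem Ren.conSub {Γ Γ' : Ctx} {ξ : ℕ → ℕ} (h : Ren Γ Γ' ξ) :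
    ConSub Γ Γ' (fun n => .var (ξ n)) := ⟨h.wf, fun hn => .var h.wf (h.tvar hn)⟩

theorem ConSub.id {Γ : Ctx} (h : WfCtx Γ) : ConSub Γ Γ Con.var := (Ren.id h).conSub

theorem ConKind.subst {Γ Γ' : Ctx} {C : Con} {K : Kind} {σ : ℕ → Con} (h : ConKind Γ C K)
    (hσ : ConSub Γ Γ' σ) : ConKind Γ' (C.subst σ) K := by
  induction h using ConKind.induction generalizing Γ' σ with
  | bool => exact .bool hσ.wf
  | int => exact .int hσ.wf
  | string => exact .string hσ.wf
  | var _ h => exact hσ.tvar h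
  | lam _ ih => exact .lam (ih (hσ.up _))
  | app _ _ ih ih' => exact .app (ih hσ) (ih' hσ)
  | list _ ih => exact .list (ih hσ)
  | record _ ih => exact .record (ih hσ)
  | trace _ ih => exact .trace (ih hσ)
  | typerec hK _ _ _ _ _ _ _ h hB hI hS hL hR hT =>
    exact .typerec hK (h hσ) (hB hσ) (hI hσ) (hS hσ) (hL hσ) (hR hσ) (hT hσ)
  | rnil r => exact .rnil r hσ.wf
  | rcons r _ _ ih ih' => exact .rcons r (ih hσ) (ih' hσ)
  | rmap _ _ ih ih' => exact .rmap (ih hσ) (ih' hσ)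
  | sub _ s ih => exact .sub (ih hσ) s

theorem ConKind.inst {Γ : Ctx} {C D : Con} {K K' : Kind} (h : ConKind (.tvar Γ K') C K)
    (hD : ConKind Γ D K') : ConKind Γ (C.inst D) K :=
  h.subst ((ConSub.id hD.wf).scons hD)

/-! ### Inversion of kinding -/

/-- The reflexive closure of subkinding. -/
inductive KindLe : Kind → Kind → Prop
  | refl {K : Kind} : KindLe K K
  | sub {K K' : Kind} : SubKind K K' → KindLe K K'

/-- No kind is both above and below another one, so chains of subkinding have length at most one and
the reflexive closure is already transitive. -/
theorem KindLe.trans_sub {K₁ K₂ K₃ : Kind} (h : KindLe K₁ K₂) (s : SubKind K₂ K₃) :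
    KindLe K₁ K₃ := by
  cases h with
  | refl => exact .sub s
  | sub h => cases h <;> cases s

theorem ConKind.le {Γ : Ctx} {C : Con} {K K' : Kind} (h : ConKind Γ C K) (l : KindLe K K') :
    ConKind Γ C K' := by
  cases l with
  | refl => exact h
  | sub s => exact .sub h s

theorem ConEq.le {Γ : Ctx} {C D : Con} {K K' : Kind} (h : ConEq Γ C D K) (l : KindLe K K') :
    ConEq Γ C D K' := by
  cases l with
  | refl => exact h
  | sub s => exact .sub h s

theorem TypeLike.le {K : Kind} (h : TypeLike K) : KindLe K .type := by
  cases h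
  exacts [.refl, .sub .base]

theorem RowOf.le {κ ρ : Kind} (h : RowOf κ ρ) : KindLe κ .type ∧ KindLe ρ .row := by
  cases h
  exacts [⟨.refl, .refl⟩, ⟨.sub .base, .sub .baseRow⟩]

/-- Arrow kinds take no part in subkinding, so here inversion is exact and not merely up to
`KindLe`. -/
theorem ConKind.lam_inv {Γ : Ctx} {K₁ K : Kind} {C : Con} (h : ConKind Γ (.lam K₁ C) K) :
    ∃ K₂, K = .arrow K₁ K₂ ∧ ConKind (.tvar Γ K₁) C K₂ := by
  generalize e : Con.lam K₁ C = X at h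
  induction h using ConKind.induction with
  | lam h => cases e; exact ⟨_, rfl, h⟩
  | sub _ s ih => obtain ⟨_, rfl, _⟩ := ih e; cases s
  | _ => cases e

theorem ConKind.app_inv {Γ : Ctx} {K : Kind} {C D : Con} (h : ConKind Γ (.app C D) K) :
    ∃ K₁ K₂, ConKind Γ C (.arrow K₁ K₂) ∧ ConKind Γ D K₁ ∧ KindLe K₂ K := by
  generalize e : Con.app C D = X at h
  induction h using ConKind.induction with
  | app h h' => cases e; exact ⟨_, _, h, h', .refl⟩
  | sub _ s ih => obtain ⟨_, _, h, h', l⟩ := ih e; exact ⟨_, _, h, h', l.trans_sub s⟩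
  | _ => cases e

theorem ConKind.list_inv {Γ : Ctx} {K : Kind} {C : Con} (h : ConKind Γ (.list C) K) :
    K = .type ∧ ConKind Γ C .type := by
  generalize e : Con.list C = X at h
  induction h using ConKind.induction with
  | list h => cases e; exact ⟨rfl, h⟩
  | sub _ s ih => obtain ⟨rfl, _⟩ := ih e; cases s
  | _ => cases e

theorem ConKind.record_inv {Γ : Ctx} {K : Kind} {S : Con} (h : ConKind Γ (.record S) K) :
    K = .type ∧ ConKind Γ S .row := by
  generalize e : Con.record S = X at h
  induction h using ConKind.induction with
  | record h => cases e; exact ⟨rfl, h⟩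
  | sub _ s ih => obtain ⟨rfl, _⟩ := ih e; cases s
  | _ => cases e

theorem ConKind.trace_inv {Γ : Ctx} {K : Kind} {C : Con} (h : ConKind Γ (.trace C) K) :
    K = .type ∧ ConKind Γ C .baseType := by
  generalize e : Con.trace C = X at h
  induction h using ConKind.induction with
  | trace h => cases e; exact ⟨rfl, h⟩
  | sub _ s ih => obtain ⟨rfl, _⟩ := ih e; cases s
  | _ => cases e

theorem ConKind.rmap_inv {Γ : Ctx} {K : Kind} {C S : Con} (h : ConKind Γ (.rmap C S) K) :
    K = .row ∧ ConKind Γ C (.arrow .type .type) ∧ ConKind Γ S .row := by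
  generalize e : Con.rmap C S = X at h
  induction h using ConKind.induction with
  | rmap h h' => cases e; exact ⟨rfl, h, h'⟩
  | sub _ s ih => obtain ⟨rfl, _⟩ := ih e; cases s
  | _ => cases e

theorem ConKind.rcons_inv {Γ : Ctx} {K : Kind} {l : Label} {C S : Con}
    (h : ConKind Γ (.rcons l C S) K) :
    ∃ κ ρ, RowOf κ ρ ∧ ConKind Γ C κ ∧ ConKind Γ S ρ ∧ KindLe ρ K := by
  generalize e : Con.rcons l C S = X at h
  induction h using ConKind.induction with
  | rcons r h h' => cases e; exact ⟨_, _, r, h, h', .refl⟩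
  | sub _ s ih => obtain ⟨_, _, r, h, h', l⟩ := ih e; exact ⟨_, _, r, h, h', l.trans_sub s⟩
  | _ => cases e

theorem ConKind.typerec_inv {Γ : Ctx} {K : Kind} {C CB CI CS CL CR CT : Con}
    (h : ConKind Γ (.typerec C CB CI CS CL CR CT) K) :
    ∃ K', TypeLike K' ∧ ConKind Γ C .type ∧ ConKind Γ CB K' ∧ ConKind Γ CI K' ∧
      ConKind Γ CS K' ∧ ConKind Γ CL (.arrow .type (.arrow K' K')) ∧
      ConKind Γ CR (.arrow .row (.arrow .row K')) ∧
      ConKind Γ CT (.arrow .baseType (.arrow K' K')) ∧ KindLe K' K := by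
  generalize e : Con.typerec C CB CI CS CL CR CT = X at h
  induction h using ConKind.induction with
  | typerec t h hB hI hS hL hR hT => cases e; exact ⟨_, t, h, hB, hI, hS, hL, hR, hT, .refl⟩
  | sub _ s ih =>
    obtain ⟨_, t, h, hB, hI, hS, hL, hR, hT, l⟩ := ih e
    exact ⟨_, t, h, hB, hI, hS, hL, hR, hT, l.trans_sub s⟩
  | _ => cases e


/-! ### Constructor equivalence under renaming -/

theorem ConEq.regular {Γ : Ctx} {C D : Con} {K : Kind} (h : ConEq Γ C D K) :
    ConKind Γ C K ∧ ConKind Γ D K := by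
  induction h with
  | refl h => exact ⟨h, h⟩
  | symm _ ih => exact ⟨ih.2, ih.1⟩
  | trans _ _ ih ih' => exact ⟨ih.1, ih'.2⟩
  | sub _ s ih => exact ⟨.sub ih.1 s, .sub ih.2 s⟩
  | eta h => exact ⟨.lam (.app (h.shift _) (.var (.tvar h.wf) .here)), h⟩
  | lam _ ih => exact ⟨.lam ih.1, .lam ih.2⟩
  | app _ _ ih ih' => exact ⟨.app ih.1 ih'.1, .app ih.2 ih'.2⟩
  | list _ ih => exact ⟨.list ih.1, .list ih.2⟩
  | record _ ih => exact ⟨.record ih.1, .record ih.2⟩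
  | trace _ ih => exact ⟨.trace ih.1, .trace ih.2⟩
  | step h h' _ => exact ⟨h, h'⟩
  | rnil r w => exact ⟨.rnil r w, .rnil r w⟩
  | rcons r _ _ ih ih' => exact ⟨.rcons r ih.1 ih'.1, .rcons r ih.2 ih'.2⟩
  | swap r _ h h' hS => exact ⟨.rcons r h (.rcons r h' hS), .rcons r h' (.rcons r h hS)⟩
  | rmap _ _ ih ih' => exact ⟨.rmap ih.1 ih'.1, .rmap ih.2 ih'.2⟩
  | typerec t _ _ _ _ _ _ _ h hB hI hS hL hR hT =>
    exact ⟨.typerec t h.1 hB.1 hI.1 hS.1 hL.1 hR.1 hT.1,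
      .typerec t h.2 hB.2 hI.2 hS.2 hL.2 hR.2 hT.2⟩

theorem ConEq.wf {Γ : Ctx} {C D : Con} {K : Kind} (h : ConEq Γ C D K) : WfCtx Γ :=
  h.regular.1.wf

theorem ConStep.subst {C D : Con} (h : ConStep C D) (σ : ℕ → Con) :
    ConStep (C.subst σ) (D.subst σ) := by
  induction h generalizing σ with
  | beta => rw [Con.inst_subst]; exact .beta
  | typerec_record =>
    simp only [Con.subst, Con.shift_subst_upCon]; exact .typerec_record
  | lam _ ih => exact .lam (ih _)
  | _ => simp only [Con.subst]; constructor <;> apply_assumption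

theorem ConStep.rename {C D : Con} (h : ConStep C D) (ξ : ℕ → ℕ) :
    ConStep (C.rename ξ) (D.rename ξ) := by
  simp only [Con.rename_eq_subst]; exact h.subst _

theorem Con.shift_rename_upRen (C : Con) (ξ : ℕ → ℕ) :
    C.shift.rename (upRen ξ) = (C.rename ξ).shift := by
  simp only [Con.shift, Con.rename_rename]; rfl

/-- Stability under renaming is needed already to set up the Kripke relation; stability under
substitution is a consequence of its fundamental theorem. -/
theorem ConEq.rename {Γ Γ' : Ctx} {C D : Con} {K : Kind} {ξ : ℕ → ℕ} (h : ConEq Γ C D K)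
    (hξ : Ren Γ Γ' ξ) : ConEq Γ' (C.rename ξ) (D.rename ξ) K := by
  induction h generalizing Γ' ξ with
  | refl h => exact .refl (h.rename hξ)
  | symm _ ih => exact .symm (ih hξ)
  | trans _ _ ih ih' => exact .trans (ih hξ) (ih' hξ)
  | sub _ s ih => exact .sub (ih hξ) s
  | eta h =>
    have := ConEq.eta (h.rename hξ)
    rwa [← Con.shift_rename_upRen] at this
  | lam _ ih => exact .lam (ih (hξ.up _))
  | app _ _ ih ih' => exact .app (ih hξ) (ih' hξ)
  | list _ ih => exact .list (ih hξ)
  | record _ ih => exact .record (ih hξ)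
  | trace _ ih => exact .trace (ih hξ)
  | step h h' s => exact .step (h.rename hξ) (h'.rename hξ) (s.rename ξ)
  | rnil r _ => exact .rnil r hξ.wf
  | rcons r _ _ ih ih' => exact .rcons r (ih hξ) (ih' hξ)
  | swap r n h h' hS => exact .swap r n (h.rename hξ) (h'.rename hξ) (hS.rename hξ)
  | rmap _ _ ih ih' => exact .rmap (ih hξ) (ih' hξ)
  | typerec t _ _ _ _ _ _ _ h hB hI hS hL hR hT =>
    exact .typerec t (h hξ) (hB hξ) (hI hξ) (hS hξ) (hL hξ) (hR hξ) (hT hξ)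

theorem ConEq.shift {Γ : Ctx} {C D : Con} {K : Kind} (h : ConEq Γ C D K) (K' : Kind) :
    ConEq (.tvar Γ K') C.shift D.shift K := h.rename (.succ h.wf K')

/-! ### Weak head reduction of constructors -/

/-- Weak head reduction: constructor computation at the head position only. -/
inductive Whr : Con → Con → Prop
  | app {C C' D : Con} : Whr C C' → Whr (.app C D) (.app C' D)
  | beta {K : Kind} {C D : Con} : Whr (.app (.lam K C) D) (C.inst D)
  | rmap {C S S' : Con} : Whr S S' → Whr (.rmap C S) (.rmap C S')
  | rmap_rnil {C : Con} : Whr (.rmap C .rnil) .rnil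
  | rmap_rcons {C D S : Con} {l : Label} :
      Whr (.rmap C (.rcons l D S)) (.rcons l (.app C D) (.rmap C S))
  | typerec {C C' CB CI CS CL CR CT : Con} : Whr C C' →
      Whr (.typerec C CB CI CS CL CR CT) (.typerec C' CB CI CS CL CR CT)
  | typerec_bool {CB CI CS CL CR CT : Con} : Whr (.typerec .bool CB CI CS CL CR CT) CB
  | typerec_int {CB CI CS CL CR CT : Con} : Whr (.typerec .int CB CI CS CL CR CT) CI
  | typerec_string {CB CI CS CL CR CT : Con} : Whr (.typerec .string CB CI CS CL CR CT) CS
  | typerec_list {D CB CI CS CL CR CT : Con} :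
      Whr (.typerec (.list D) CB CI CS CL CR CT)
        (.app (.app CL D) (.typerec D CB CI CS CL CR CT))
  | typerec_record {S CB CI CS CL CR CT : Con} :
      Whr (.typerec (.record S) CB CI CS CL CR CT)
        (.app (.app CR S)
          (.rmap (.lam .type (.typerec (.var 0) CB.shift CI.shift CS.shift CL.shift
            CR.shift CT.shift)) S))
  | typerec_trace {D CB CI CS CL CR CT : Con} :
      Whr (.typerec (.trace D) CB CI CS CL CR CT)
        (.app (.app CT D) (.typerec D CB CI CS CL CR CT))

/-- Constructors whose computation is blocked by a variable in head position. -/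
inductive Neutral : Con → Prop
  | var {n : ℕ} : Neutral (.var n)
  | app {C D : Con} : Neutral C → Neutral (.app C D)
  | rmap {C S : Con} : Neutral S → Neutral (.rmap C S)
  | typerec {C CB CI CS CL CR CT : Con} : Neutral C →
      Neutral (.typerec C CB CI CS CL CR CT)

theorem Whr.conStep {C D : Con} (h : Whr C D) : ConStep C D := by
  induction h <;> constructor <;> assumption

theorem Whr.subst {C D : Con} (h : Whr C D) (σ : ℕ → Con) : Whr (C.subst σ) (D.subst σ) := by
  induction h with
  | beta => rw [Con.inst_subst]; exact .beta
  | typerec_record =>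
    simp only [Con.subst, Con.shift_subst_upCon]; exact .typerec_record
  | _ => simp only [Con.subst]; constructor <;> assumption

theorem Whr.rename {C D : Con} (h : Whr C D) (ξ : ℕ → ℕ) : Whr (C.rename ξ) (D.rename ξ) := by
  simp only [Con.rename_eq_subst]; exact h.subst _

theorem Neutral.rename {C : Con} (h : Neutral C) (ξ : ℕ → ℕ) : Neutral (C.rename ξ) := by
  induction h <;> constructor <;> assumption

theorem Neutral.not_whr {C D : Con} (h : Neutral C) : ¬ Whr C D := by
  intro w
  induction h generalizing D with
  | var => cases w
  | app h ih => cases w with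
    | app w => exact ih w
    | beta => cases h
  | rmap h ih => cases w with
    | rmap w => exact ih w
    | _ => cases h
  | typerec h ih => cases w with
    | typerec w => exact ih w
    | _ => cases h

/-- Only the position of the function, the mapped row or the scrutinee is reduced, and a head former
in that position does not itself reduce, so no two rules overlap. Transitivity of the relations
below rests on this. -/
theorem Whr.deterministic {C D D' : Con} (h : Whr C D) (h' : Whr C D') : D = D' := by
  induction h generalizing D' with
  | app h ih => cases h' with
    | app h' => rw [ih h']
    | beta => cases h
  | rmap h ih => cases h' with
    | rmap h' => rw [ih h']
    | _ => cases h
  | typerec h ih => cases h' with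
    | typerec h' => rw [ih h']
    | _ => cases h
  | _ => cases h' <;> first | rfl | (rename_i w; cases w)

theorem Whr.conEq {Γ : Ctx} {C D : Con} {K : Kind} (w : Whr C D) (h : ConKind Γ C K)
    (h' : ConKind Γ D K) : ConEq Γ C D K := .step h h' w.conStep

/-! ### Field maps of row constructors -/

open Classical in
/-- `RowView S f`: the row constructor `S` evaluates to fields followed by `·` or a neutral row;
`f` assigns to each label its first field. -/
inductive RowView : Con → (Label → Option Con) → Prop
  | rnil : RowView .rnil (fun _ => none)
  | ne {S : Con} : Neutral S → RowView S (fun _ => none)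
  | rcons {l : Label} {C S : Con} {f : Label → Option Con} : RowView S f →
      RowView (.rcons l C S) (Function.update f l (some C))
  | whr {S S' : Con} {f : Label → Option Con} : Whr S S' → RowView S' f → RowView S f

/-- The overlap of the rules for `·` and for neutral rows is harmless, since both give the empty
map: a view does not record how a row ends. -/
theorem RowView.deterministic {S : Con} {f g : Label → Option Con} (h : RowView S f)
    (h' : RowView S g) : f = g := by
  induction h generalizing g with
  | rnil => cases h' with
    | whr w => cases w
    | _ => rfl
  | ne n => cases h' with
    | whr w => exact (n.not_whr w).elim
    | rcons => cases n
    | _ => rfl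
  | rcons _ ih => cases h' with
    | rcons h' => rw [ih h']
    | ne n => cases n
    | whr w => cases w
  | whr w _ ih => cases h' with
    | whr w' h' => cases w.deterministic w'; exact ih h'
    | ne n => exact (n.not_whr w).elim
    | _ => cases w

theorem RowView.rename {S : Con} {f : Label → Option Con} (h : RowView S f) (ξ : ℕ → ℕ) :
    RowView (S.rename ξ) (fun l => (f l).map (Con.rename ξ)) := by
  induction h with
  | rnil => exact .rnil
  | ne n => exact .ne (n.rename ξ)
  | @rcons l C S f _ ih =>
    convert RowView.rcons (l := l) (C := C.rename ξ) ih using 1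
    · rfl
    funext l'
    by_cases e : l' = l
    · subst e; simp
    · simp [e]
  | whr w _ ih => exact .whr (w.rename ξ) ih

/-- `Rmap` computes field by field and is stuck exactly where its row argument is stuck. -/
theorem RowView.rmap {S : Con} {f : Label → Option Con} (h : RowView S f) (F : Con) :
    RowView (.rmap F S) (fun l => (f l).map (Con.app F)) := by
  induction h with
  | rnil => exact .whr .rmap_rnil .rnil
  | ne n => exact .ne (.rmap n)
  | @rcons l C S f _ ih =>
    refine .whr .rmap_rcons ?_
    convert RowView.rcons (l := l) (C := .app F C) ih using 1
    funext l'
    by_cases e : l' = l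
    · subst e; simp
    · simp [e]
  | whr w _ ih => exact .whr (.rmap w) ih

/-! ### The logical relation at the kinds of types and rows -/

/-- `P` relates the values of two partial maps, which have the same domain. -/
structure Pointwise {X : Type} (P : X → X → Prop) (f g : Label → Option X) : Prop where
  dom : ∀ l, (f l).isSome = (g l).isSome
  rel : ∀ {l C D}, f l = some C → g l = some D → P C D

theorem Pointwise.mono {X : Type} {P Q : X → X → Prop} {f g : Label → Option X}
    (h : Pointwise P f g) (hPQ : ∀ {C D}, P C D → Q C D) : Pointwise Q f g :=
  ⟨h.dom, fun e e' => hPQ (h.rel e e')⟩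

theorem Pointwise.symm {X : Type} {P : X → X → Prop} {f g : Label → Option X}
    (h : Pointwise P f g) : Pointwise (fun C D => P D C) g f :=
  ⟨fun l => (h.dom l).symm, fun e e' => h.rel e' e⟩

theorem Pointwise.exists_right {X : Type} {P : X → X → Prop} {f g : Label → Option X}
    (h : Pointwise P f g) {l : Label} {C : X} (e : f l = some C) :
    ∃ D, g l = some D ∧ P C D := by
  have := h.dom l
  rw [e] at this
  obtain ⟨D, e'⟩ := Option.isSome_iff_exists.mp this.symm
  exact ⟨D, e', h.rel e e'⟩

theorem Pointwise.trans {X : Type} {P Q : X → X → Prop} {f g k : Label → Option X}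
    (h : Pointwise P f g) (h' : Pointwise Q g k) :
    Pointwise (fun C E => ∃ D, P C D ∧ Q D E) f k :=
  ⟨fun l => (h.dom l).trans (h'.dom l), fun e e' => by
    obtain ⟨D, e'', p⟩ := h.exists_right e
    exact ⟨D, p, h'.rel e'' e'⟩⟩

theorem Pointwise.none {X : Type} {P : X → X → Prop} :
    Pointwise P (fun _ => none) (fun _ => none) :=
  ⟨fun _ => rfl, fun e => by cases e⟩

theorem Pointwise.map {X Y : Type} {P : X → X → Prop} {Q : Y → Y → Prop} {u v : X → Y}
    {f g : Label → Option X} (h : Pointwise P f g) (hQ : ∀ {C D}, P C D → Q (u C) (v D)) :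
    Pointwise Q (fun l => (f l).map u) (fun l => (g l).map v) := by
  refine ⟨fun l => by simpa using h.dom l, fun {l C D} e e' => ?_⟩
  simp only [Option.map_eq_some_iff] at e e'
  obtain ⟨C, e, rfl⟩ := e
  obtain ⟨D, e', rfl⟩ := e'
  exact hQ (h.rel e e')

open Classical in
theorem Pointwise.update {X : Type} {P : X → X → Prop} {f g : Label → Option X}
    (h : Pointwise P f g) {C D : X} (hCD : P C D) (l : Label) :
    Pointwise P (Function.update f l (some C)) (Function.update g l (some D)) := by
  refine ⟨fun l' => ?_, fun {l' E F} => ?_⟩ <;> by_cases e : l' = l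
  · subst e; simp
  · simpa [e] using h.dom l'
  · subst e
    simp only [Function.update_self, Option.some.injEq]
    rintro rfl rfl; exact hCD
  · simpa [e] using h.rel

/-- The logical relation for types: both sides evaluate to the same head constructor, with related
arguments, or both evaluate to neutral constructors. -/
inductive TypeRel (Γ : Ctx) : Con → Con → Prop
  | bool : TypeRel Γ .bool .bool
  | int : TypeRel Γ .int .int
  | string : TypeRel Γ .string .string
  | list {C D : Con} : ConEq Γ C D .type → TypeRel Γ C D → TypeRel Γ (.list C) (.list D)
  | trace {C D : Con} : ConEq Γ C D .baseType → TypeRel Γ C D → TypeRel Γ (.trace C) (.trace D)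
  | record {S S' : Con} {f g : Label → Option Con} : ConEq Γ S S' .row → RowView S f →
      RowView S' g → Pointwise (fun C D => ConEq Γ C D .type) f g →
      (∀ l, (f l).isSome = (g l).isSome) →
      (∀ {l C D}, f l = some C → g l = some D → TypeRel Γ C D) →
      TypeRel Γ (.record S) (.record S')
  | ne {C D : Con} : Neutral C → Neutral D → ConEq Γ C D .type → TypeRel Γ C D
  | whr_left {C C' D : Con} : Whr C C' → TypeRel Γ C' D → TypeRel Γ C D
  | whr_right {C D D' : Con} : Whr D D' → TypeRel Γ C D' → TypeRel Γ C D

theorem TypeRel.symm {Γ : Ctx} {C D : Con} (h : TypeRel Γ C D) : TypeRel Γ D C := by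
  induction h with
  | bool => exact .bool
  | int => exact .int
  | string => exact .string
  | list e _ ih => exact .list e.symm ih
  | trace e _ ih => exact .trace e.symm ih
  | record e v v' p d _ ih =>
    exact .record e.symm v' v (p.symm.mono .symm) (fun l => (d l).symm) fun e e' => ih e' e
  | ne n n' e => exact .ne n' n e.symm
  | whr_left w _ ih => exact .whr_right w ih
  | whr_right w _ ih => exact .whr_left w ih

/-- The rules build in closure under expansion only. Closure under reduction follows because the
reduct is unique and evaluated or neutral constructors have none. -/
theorem TypeRel.reduce_left {Γ : Ctx} {C C' D : Con} (h : TypeRel Γ C D) (w : Whr C C') :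
    TypeRel Γ C' D := by
  induction h with
  | ne n _ _ => exact (n.not_whr w).elim
  | whr_left w' h _ => cases w.deterministic w'; exact h
  | whr_right w' _ ih => exact .whr_right w' (ih w)
  | _ => cases w

/-- Once the first derivation has evaluated the middle constructor, the second must exhibit the same
former for it. An inner induction strips the evaluation steps on the far side. -/
theorem TypeRel.trans {Γ : Ctx} {C D E : Con} (h : TypeRel Γ C D) (h' : TypeRel Γ D E) :
    TypeRel Γ C E := by
  induction h generalizing E with
  | bool => exact h'
  | int => exact h'
  | string => exact h'
  | list e _ ih =>
    generalize hX : Con.list _ = X at h'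
    induction h' with
    | list e' h' _ => cases hX; exact .list (e.trans e') (ih h')
    | ne n => subst hX; cases n
    | whr_left w => subst hX; cases w
    | whr_right w _ ih => exact .whr_right w (ih hX)
    | _ => cases hX
  | trace e _ ih =>
    generalize hX : Con.trace _ = X at h'
    induction h' with
    | trace e' h' _ => cases hX; exact .trace (e.trans e') (ih h')
    | ne n => subst hX; cases n
    | whr_left w => subst hX; cases w
    | whr_right w _ ih => exact .whr_right w (ih hX)
    | _ => cases hX
  | record e v v' p d _ ih =>
    generalize hX : Con.record _ = X at h'
    induction h' with
    | record e' u u' q d' h' _ =>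
      cases hX
      -- Both derivations bring a field map for the middle row; they coincide, which makes the two
      -- comparisons composable.
      cases v'.deterministic u
      refine .record (e.trans e') v u' ((p.trans q).mono fun ⟨_, h, h'⟩ => h.trans h')
        (fun l => (d l).trans (d' l)) fun e e' => ?_
      obtain ⟨_, e'', _⟩ := p.exists_right e
      exact ih e e'' (h' e'' e')
    | ne n => subst hX; cases n
    | whr_left w => subst hX; cases w
    | whr_right w _ ih => exact .whr_right w (ih hX)
    | _ => cases hX
  | ne n n' e =>
    induction h' with
    | ne _ m e' => exact .ne n m (e.trans e')
    | whr_left w => exact (n'.not_whr w).elim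
    | whr_right w _ ih => exact .whr_right w (ih n' e)
    | _ => cases n'
  | whr_left w _ ih => exact .whr_left w (ih h')
  | whr_right w _ ih => exact ih (h'.reduce_left w)

theorem TypeRel.rename {Γ Γ' : Ctx} {C D : Con} {ξ : ℕ → ℕ} (h : TypeRel Γ C D)
    (hξ : Ren Γ Γ' ξ) : TypeRel Γ' (C.rename ξ) (D.rename ξ) := by
  induction h with
  | bool => exact .bool
  | int => exact .int
  | string => exact .string
  | list e _ ih => exact .list (e.rename hξ) ih
  | trace e _ ih => exact .trace (e.rename hξ) ih
  | record e v v' p d _ ih =>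
    have q := Pointwise.map (Pointwise.mk d ih) (Q := TypeRel Γ') fun h => h
    exact .record (e.rename hξ) (v.rename ξ) (v'.rename ξ) (p.map fun e => e.rename hξ)
      q.dom q.rel
  | ne n n' e => exact .ne (n.rename ξ) (n'.rename ξ) (e.rename hξ)
  | whr_left w _ ih => exact .whr_left (w.rename ξ) ih
  | whr_right w _ ih => exact .whr_right (w.rename ξ) ih

/-- The logical relation for rows: equal labels have related first fields. -/
def RowRel (Γ : Ctx) (S S' : Con) : Prop :=
  ∃ f g, RowView S f ∧ RowView S' g ∧
    Pointwise (fun C D => ConEq Γ C D .type ∧ TypeRel Γ C D) f g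

theorem RowRel.symm {Γ : Ctx} {S S' : Con} (h : RowRel Γ S S') : RowRel Γ S' S := by
  obtain ⟨f, g, v, v', p⟩ := h
  exact ⟨g, f, v', v, p.symm.mono fun h => ⟨h.1.symm, h.2.symm⟩⟩

theorem RowRel.trans {Γ : Ctx} {S S' S'' : Con} (h : RowRel Γ S S') (h' : RowRel Γ S' S'') :
    RowRel Γ S S'' := by
  obtain ⟨f, g, v, v', p⟩ := h
  obtain ⟨f', g', u, u', q⟩ := h'
  cases v'.deterministic u
  exact ⟨f, g', v, u', (p.trans q).mono fun ⟨_, h, h'⟩ => ⟨h.1.trans h'.1, h.2.trans h'.2⟩⟩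

theorem RowRel.rename {Γ Γ' : Ctx} {S S' : Con} {ξ : ℕ → ℕ} (h : RowRel Γ S S')
    (hξ : Ren Γ Γ' ξ) : RowRel Γ' (S.rename ξ) (S'.rename ξ) := by
  obtain ⟨f, g, v, v', p⟩ := h
  exact ⟨_, _, v.rename ξ, v'.rename ξ, p.map fun h => ⟨h.1.rename hξ, h.2.rename hξ⟩⟩

theorem RowRel.whr_left {Γ : Ctx} {S T S' : Con} (w : Whr S T) (h : RowRel Γ T S') :
    RowRel Γ S S' := by
  obtain ⟨f, g, v, v', p⟩ := h
  exact ⟨f, g, .whr w v, v', p⟩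

theorem TypeRel.ofRow {Γ : Ctx} {S S' : Con} (e : ConEq Γ S S' .row) (h : RowRel Γ S S') :
    TypeRel Γ (.record S) (.record S') := by
  obtain ⟨f, g, v, v', p⟩ := h
  exact .record e v v' (p.mono fun h => h.1) p.dom fun e e' => (p.rel e e').2

/-! ### The logical relation at all kinds -/

/-- The Kripke logical relation for constructor equivalence. -/
def LogRel : Kind → Ctx → Con → Con → Prop
  | .type, Γ, C, D => ConEq Γ C D .type ∧ TypeRel Γ C D
  | .baseType, Γ, C, D => ConEq Γ C D .baseType ∧ TypeRel Γ C D
  | .row, Γ, C, D => ConEq Γ C D .row ∧ RowRel Γ C D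
  | .baseRow, Γ, C, D => ConEq Γ C D .baseRow ∧ RowRel Γ C D
  | .arrow K₁ K₂, Γ, C, D => ConEq Γ C D (.arrow K₁ K₂) ∧
      ∀ {Γ' ξ E F}, Ren Γ Γ' ξ → LogRel K₁ Γ' E F →
        LogRel K₂ Γ' (.app (C.rename ξ) E) (.app (D.rename ξ) F)

/-- Since equivalence is a conjunct of the relation at every kind, reading it back needs no mutual
induction with the statement about neutral constructors. -/
theorem LogRel.conEq {K : Kind} {Γ : Ctx} {C D : Con} (h : LogRel K Γ C D) :
    ConEq Γ C D K := by
  cases K <;> exact h.1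

theorem LogRel.symm {K : Kind} {Γ : Ctx} {C D : Con} (h : LogRel K Γ C D) :
    LogRel K Γ D C := by
  induction K generalizing Γ C D with
  | type => exact ⟨h.1.symm, h.2.symm⟩
  | baseType => exact ⟨h.1.symm, h.2.symm⟩
  | row => exact ⟨h.1.symm, h.2.symm⟩
  | baseRow => exact ⟨h.1.symm, h.2.symm⟩
  | arrow K₁ K₂ ih₁ ih₂ => exact ⟨h.1.symm, fun hξ e => ih₂ (h.2 hξ (ih₁ e))⟩

theorem LogRel.trans {K : Kind} {Γ : Ctx} {C D E : Con} (h : LogRel K Γ C D)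
    (h' : LogRel K Γ D E) : LogRel K Γ C E := by
  induction K generalizing Γ C D E with
  | type => exact ⟨h.1.trans h'.1, h.2.trans h'.2⟩
  | baseType => exact ⟨h.1.trans h'.1, h.2.trans h'.2⟩
  | row => exact ⟨h.1.trans h'.1, h.2.trans h'.2⟩
  | baseRow => exact ⟨h.1.trans h'.1, h.2.trans h'.2⟩
  | arrow K₁ K₂ ih₁ ih₂ =>
    -- The intermediate result applies the middle function to the left argument, which is related to
    -- itself by symmetry and transitivity.
    exact ⟨h.1.trans h'.1, fun hξ e => ih₂ (h.2 hξ (ih₁ e e.symm)) (h'.2 hξ e)⟩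

theorem LogRel.rename {K : Kind} {Γ Γ' : Ctx} {C D : Con} {ξ : ℕ → ℕ} (h : LogRel K Γ C D)
    (hξ : Ren Γ Γ' ξ) : LogRel K Γ' (C.rename ξ) (D.rename ξ) := by
  cases K with
  | type => exact ⟨h.1.rename hξ, h.2.rename hξ⟩
  | baseType => exact ⟨h.1.rename hξ, h.2.rename hξ⟩
  | row => exact ⟨h.1.rename hξ, h.2.rename hξ⟩
  | baseRow => exact ⟨h.1.rename hξ, h.2.rename hξ⟩
  | arrow K₁ K₂ =>
    refine ⟨h.1.rename hξ, fun hξ' e => ?_⟩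
    rw [Con.rename_rename, Con.rename_rename]
    exact h.2 (hξ.comp hξ') e

theorem LogRel.sub {K K' : Kind} {Γ : Ctx} {C D : Con} (h : LogRel K Γ C D)
    (s : SubKind K K') : LogRel K' Γ C D := by
  cases s <;> exact ⟨.sub h.1 (by constructor), h.2⟩

theorem LogRel.le {K K' : Kind} {Γ : Ctx} {C D : Con} (h : LogRel K Γ C D)
    (l : KindLe K K') : LogRel K' Γ C D := by
  cases l with
  | refl => exact h
  | sub s => exact h.sub s

/-- Closure under head expansion, the standard property behind the cases for abstractions. The
kinding hypothesis is there because the relation contains `ConEq`, and a redex may be ill-kinded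
although its reduct is well-kinded. -/
theorem LogRel.whr_left {K : Kind} {Γ : Ctx} {C C' D : Con} (w : Whr C C')
    (hC : ConKind Γ C K) (h : LogRel K Γ C' D) : LogRel K Γ C D := by
  have e : ConEq Γ C D K := (w.conEq hC h.conEq.regular.1).trans h.conEq
  induction K generalizing Γ C C' D with
  | type => exact ⟨e, .whr_left w h.2⟩
  | baseType => exact ⟨e, .whr_left w h.2⟩
  | row => exact ⟨e, h.2.whr_left w⟩
  | baseRow => exact ⟨e, h.2.whr_left w⟩
  | arrow K₁ K₂ _ ih =>
    refine ⟨e, fun hξ r => ih (w.rename _).app ?_ (h.2 hξ r) ?_⟩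
    · exact .app (hC.rename hξ) r.conEq.regular.1
    · exact .app (e.rename hξ) r.conEq

theorem LogRel.whr_right {K : Kind} {Γ : Ctx} {C D D' : Con} (w : Whr D D')
    (hD : ConKind Γ D K) (h : LogRel K Γ C D') : LogRel K Γ C D :=
  (h.symm.whr_left w hD).symm

/-- A neutral constructor stays neutral when applied, so the induction on kinds descends to the
ground kinds. In particular variables are related to themselves, so identity and lifted
substitutions are related. -/
theorem LogRel.ofNeutral {K : Kind} {Γ : Ctx} {C D : Con} (n : Neutral C) (n' : Neutral D)
    (e : ConEq Γ C D K) : LogRel K Γ C D := by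
  induction K generalizing Γ C D with
  | type => exact ⟨e, .ne n n' e⟩
  | baseType => exact ⟨e, .ne n n' (.sub e .base)⟩
  | row => exact ⟨e, _, _, .ne n, .ne n', .none⟩
  | baseRow => exact ⟨e, _, _, .ne n, .ne n', .none⟩
  | arrow K₁ K₂ _ ih =>
    exact ⟨e, fun hξ r => ih (n.rename _).app (n'.rename _).app (.app (e.rename hξ) r.conEq)⟩

theorem LogRel.app {K₁ K₂ : Kind} {Γ : Ctx} {C C' D D' : Con}
    (h : LogRel (.arrow K₁ K₂) Γ C C') (h' : LogRel K₁ Γ D D') :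
    LogRel K₂ Γ (.app C D) (.app C' D') := by
  have := h.2 (.id h.1.wf) h'
  rwa [Con.rename_id, Con.rename_id] at this

theorem LogRel.typeLike {K : Kind} (t : TypeLike K) {Γ : Ctx} {C D : Con} :
    LogRel K Γ C D ↔ ConEq Γ C D K ∧ TypeRel Γ C D := by
  cases t <;> rfl

theorem LogRel.rowOf {κ ρ : Kind} (r : RowOf κ ρ) {Γ : Ctx} {C D : Con} :
    LogRel ρ Γ C D ↔ ConEq Γ C D ρ ∧ RowRel Γ C D := by
  cases r <;> rfl

theorem LogRel.rcons {κ ρ : Kind} {Γ : Ctx} {C D S S' : Con} (l : Label) (r : RowOf κ ρ)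
    (h : LogRel κ Γ C D) (h' : LogRel ρ Γ S S') : LogRel ρ Γ (.rcons l C S) (.rcons l D S') := by
  refine (LogRel.rowOf r).2 ⟨.rcons r h.conEq h'.conEq, ?_⟩
  obtain ⟨f, g, v, v', p⟩ := ((LogRel.rowOf r).1 h').2
  exact ⟨_, _, v.rcons, v'.rcons, p.update (h.le r.le.1) l⟩

open Classical in
-- Updates of a field map at different labels commute, so exchanging the two fields leaves the map
-- unchanged.
theorem LogRel.swap {κ ρ : Kind} {Γ : Ctx} {C C' D D' S S' : Con} {l l' : Label}
    (r : RowOf κ ρ) (n : l ≠ l') (h : LogRel κ Γ C C') (h' : LogRel κ Γ D D')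
    (hS : LogRel ρ Γ S S') :
    LogRel ρ Γ (.rcons l C (.rcons l' D S)) (.rcons l' D' (.rcons l C' S')) := by
  have e := ((h.rcons l r (h'.rcons l' r hS))).conEq.trans <| .swap r n h.conEq.regular.2
    h'.conEq.regular.2 hS.conEq.regular.2
  refine (LogRel.rowOf r).2 ⟨e, ?_⟩
  obtain ⟨f, g, v, v', p⟩ := ((LogRel.rowOf r).1 hS).2
  refine ⟨_, _, v.rcons.rcons, v'.rcons.rcons, ?_⟩
  rw [Function.update_comm n.symm]
  exact (p.update (h.le r.le.1) l).update (h'.le r.le.1) l'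

theorem LogRel.rmap {Γ : Ctx} {C D S S' : Con} (h : LogRel (.arrow .type .type) Γ C D)
    (h' : LogRel .row Γ S S') : LogRel .row Γ (.rmap C S) (.rmap D S') := by
  obtain ⟨e, f, g, v, v', p⟩ := h'
  exact ⟨.rmap h.1 e, _, _, v.rmap C, v'.rmap D, p.map fun r => h.app r⟩

/-- Related arguments of `Typerec`, apart from the first. -/
structure ArgsRel (K : Kind) (Γ : Ctx)
    (CB CI CS CL CR CT CB' CI' CS' CL' CR' CT' : Con) : Prop where
  bool : LogRel K Γ CB CB'
  int : LogRel K Γ CI CI'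
  string : LogRel K Γ CS CS'
  list : LogRel (.arrow .type (.arrow K K)) Γ CL CL'
  record : LogRel (.arrow .row (.arrow .row K)) Γ CR CR'
  trace : LogRel (.arrow .baseType (.arrow K K)) Γ CT CT'

/-- Induction on the derivation of `TypeRel` replaces a termination argument for `Typerec`: every
recursive call concerns an argument or a field for which that derivation contains a subderivation.
-/
theorem TypeRel.typerec {K : Kind} (t : TypeLike K) {Γ : Ctx}
    {C D CB CI CS CL CR CT CB' CI' CS' CL' CR' CT' : Con}
    (a : ArgsRel K Γ CB CI CS CL CR CT CB' CI' CS' CL' CR' CT') (h : TypeRel Γ C D) :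
    TypeRel Γ (.typerec C CB CI CS CL CR CT) (.typerec D CB' CI' CS' CL' CR' CT') := by
  have congr {C D : Con} (e : ConEq Γ C D .type) :
      ConEq Γ (.typerec C CB CI CS CL CR CT) (.typerec D CB' CI' CS' CL' CR' CT') K :=
    .typerec t e a.bool.conEq a.int.conEq a.string.conEq a.list.conEq a.record.conEq
      a.trace.conEq
  have out {C D : Con} (h : LogRel K Γ C D) : TypeRel Γ C D := ((LogRel.typeLike t).1 h).2
  induction h with
  | bool => exact .whr_left .typerec_bool (.whr_right .typerec_bool (out a.bool))
  | int => exact .whr_left .typerec_int (.whr_right .typerec_int (out a.int))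
  | string => exact .whr_left .typerec_string (.whr_right .typerec_string (out a.string))
  | list e h ih =>
    refine .whr_left .typerec_list (.whr_right .typerec_list (out ?_))
    exact (a.list.app ⟨e, h⟩).app ((LogRel.typeLike t).2 ⟨congr e, ih⟩)
  | trace e h ih =>
    refine .whr_left .typerec_trace (.whr_right .typerec_trace (out ?_))
    exact (a.trace.app ⟨e, h⟩).app ((LogRel.typeLike t).2 ⟨congr (.sub e .base), ih⟩)
  | record e v v' p d h ih =>
    refine .whr_left .typerec_record (.whr_right .typerec_record (out ?_))
    have hfun : ConEq Γ
        (.lam .type (.typerec (.var 0) CB.shift CI.shift CS.shift CL.shift CR.shift CT.shift))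
        (.lam .type (.typerec (.var 0) CB'.shift CI'.shift CS'.shift CL'.shift CR'.shift
          CT'.shift)) (.arrow .type .type) :=
      .lam <| .le (.typerec t (.refl (.var (.tvar e.wf) .here)) (a.bool.conEq.shift _)
        (a.int.conEq.shift _) (a.string.conEq.shift _) (a.list.conEq.shift _)
        (a.record.conEq.shift _) (a.trace.conEq.shift _)) t.le
    refine (a.record.app ⟨e, _, _, v, v', p.dom, fun i j => ⟨p.rel i j, h i j⟩⟩).app
      ⟨.rmap hfun e, _, _, v.rmap _, v'.rmap _, ?_⟩
    refine Pointwise.map ⟨p.dom, fun i j => And.intro (p.rel i j) (ih i j)⟩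
      fun r => ⟨.app hfun r.1, ?_⟩
    -- A field of the mapped row is `(λα. TR(α)) D`. One β-step on each side exposes `TR(D)`, to
    -- which the induction hypothesis for the fields applies.
    refine .whr_left .beta (.whr_right .beta ?_)
    simpa only [Con.inst, Con.subst, Con.shift_subst_scons, Con.subst_var, scons] using r.2
  | ne n n' e => exact .ne n.typerec n'.typerec ((congr e).le t.le)
  | whr_left w _ ih => exact .whr_left (.typerec w) ih
  | whr_right w _ ih => exact .whr_right (.typerec w) ih


/-! ### The fundamental theorem of the logical relation -/

/-- Logically related substitutions. -/
structure SubRel (Γ Γ' : Ctx) (σ σ' : ℕ → Con) : Prop where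
  wf : WfCtx Γ'
  tvar : ∀ {n K}, Γ.TVarAt n K → LogRel K Γ' (σ n) (σ' n)

theorem SubRel.scons {Γ Γ' : Ctx} {σ σ' : ℕ → Con} {D D' : Con} {K : Kind}
    (h : SubRel Γ Γ' σ σ') (hD : LogRel K Γ' D D') :
    SubRel (.tvar Γ K) Γ' (LinksT.scons D σ) (LinksT.scons D' σ') where
  wf := h.wf
  tvar hn := by
    cases hn with
    | here => exact hD
    | tvar hn => exact h.tvar hn

theorem SubRel.rename {Γ Γ' Γ'' : Ctx} {σ σ' : ℕ → Con} {ξ : ℕ → ℕ} (h : SubRel Γ Γ' σ σ')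
    (hξ : Ren Γ' Γ'' ξ) :
    SubRel Γ Γ'' (fun n => (σ n).rename ξ) (fun n => (σ' n).rename ξ) :=
  ⟨hξ.wf, fun hn => (h.tvar hn).rename hξ⟩

theorem SubRel.up {Γ Γ' : Ctx} {σ σ' : ℕ → Con} (h : SubRel Γ Γ' σ σ') (K : Kind) :
    SubRel (.tvar Γ K) (.tvar Γ' K) (upCon σ) (upCon σ') :=
  (h.rename (.succ h.wf K)).scons
    (.ofNeutral .var .var (.refl (.var (.tvar h.wf) .here)))

theorem SubRel.refl_left {Γ Γ' : Ctx} {σ σ' : ℕ → Con} (h : SubRel Γ Γ' σ σ') :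
    SubRel Γ Γ' σ σ := ⟨h.wf, fun hn => (h.tvar hn).trans (h.tvar hn).symm⟩

theorem SubRel.symm {Γ Γ' : Ctx} {σ σ' : ℕ → Con} (h : SubRel Γ Γ' σ σ') :
    SubRel Γ Γ' σ' σ := ⟨h.wf, fun hn => (h.tvar hn).symm⟩

theorem SubRel.id {Γ : Ctx} (h : WfCtx Γ) : SubRel Γ Γ Con.var Con.var :=
  ⟨h, fun hn => .ofNeutral .var .var (.refl (.var h hn))⟩

/-- Two constructors are sent to related constructors by related substitutions. -/
structure ValidEq (Γ : Ctx) (C D : Con) (K : Kind) : Prop where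
  rel : ∀ {Γ' σ σ'}, SubRel Γ Γ' σ σ' → LogRel K Γ' (C.subst σ) (D.subst σ')

/-- The hypothesis is used twice: under the lifted substitutions it gives the equation between the
abstractions, and under substitutions extended by the arguments it relates the β-reducts. -/
theorem ValidEq.lam {Γ : Ctx} {K₁ K₂ : Kind} {C D : Con} (h : ValidEq (.tvar Γ K₁) C D K₂) :
    ValidEq Γ (.lam K₁ C) (.lam K₁ D) (.arrow K₁ K₂) := by
  refine ⟨fun {Γ' σ σ'} hσ => ?_⟩
  have e : ConEq Γ' ((Con.lam K₁ C).subst σ) ((Con.lam K₁ D).subst σ') (.arrow K₁ K₂) :=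
    .lam (h.rel (hσ.up K₁)).conEq
  refine ⟨e, fun {Γ'' ξ E F} hξ r => ?_⟩
  have red {C E : Con} {σ : ℕ → Con} : Whr (.app (((Con.lam K₁ C).subst σ).rename ξ) E)
      (C.subst (LinksT.scons E fun n => (σ n).rename ξ)) := by
    rw [Con.subst_rename, ← Con.subst_upCon_inst]; exact .beta
  exact .whr_left red (.app (e.rename hξ).regular.1 r.conEq.regular.1) <|
    .whr_right red (.app (e.rename hξ).regular.2 r.conEq.regular.2) <|
    h.rel ((hσ.rename hξ).scons r)

theorem ValidEq.app {Γ : Ctx} {K₁ K₂ : Kind} {C C' D D' : Con}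
    (h : ValidEq Γ C C' (.arrow K₁ K₂)) (h' : ValidEq Γ D D' K₁) :
    ValidEq Γ (.app C D) (.app C' D') K₂ := ⟨fun hσ => (h.rel hσ).app (h'.rel hσ)⟩

theorem ValidEq.list {Γ : Ctx} {C D : Con} (h : ValidEq Γ C D .type) :
    ValidEq Γ (.list C) (.list D) .type :=
  ⟨fun hσ => ⟨.list (h.rel hσ).1, .list (h.rel hσ).1 (h.rel hσ).2⟩⟩

theorem ValidEq.record {Γ : Ctx} {S S' : Con} (h : ValidEq Γ S S' .row) :
    ValidEq Γ (.record S) (.record S') .type :=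
  ⟨fun hσ => ⟨.record (h.rel hσ).1, .ofRow (h.rel hσ).1 (h.rel hσ).2⟩⟩

theorem ValidEq.trace {Γ : Ctx} {C D : Con} (h : ValidEq Γ C D .baseType) :
    ValidEq Γ (.trace C) (.trace D) .type :=
  ⟨fun hσ => ⟨.trace (h.rel hσ).1, .trace (h.rel hσ).1 (h.rel hσ).2⟩⟩

theorem ValidEq.rnil {Γ : Ctx} {κ ρ : Kind} (r : RowOf κ ρ) : ValidEq Γ .rnil .rnil ρ :=
  ⟨fun hσ => (LogRel.rowOf r).2 ⟨.rnil r hσ.wf, _, _, .rnil, .rnil, .none⟩⟩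

theorem ValidEq.rcons {Γ : Ctx} {κ ρ : Kind} {l : Label} {C D S S' : Con} (r : RowOf κ ρ)
    (h : ValidEq Γ C D κ) (h' : ValidEq Γ S S' ρ) :
    ValidEq Γ (.rcons l C S) (.rcons l D S') ρ := ⟨fun hσ => (h.rel hσ).rcons l r (h'.rel hσ)⟩

theorem ValidEq.rmap {Γ : Ctx} {C D S S' : Con} (h : ValidEq Γ C D (.arrow .type .type))
    (h' : ValidEq Γ S S' .row) : ValidEq Γ (.rmap C S) (.rmap D S') .row :=
  ⟨fun hσ => (h.rel hσ).rmap (h'.rel hσ)⟩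

theorem ValidEq.typerec {Γ : Ctx} {K : Kind}
    {C C' CB CB' CI CI' CS CS' CL CL' CR CR' CT CT' : Con} (t : TypeLike K)
    (h : ValidEq Γ C C' .type) (hB : ValidEq Γ CB CB' K) (hI : ValidEq Γ CI CI' K)
    (hS : ValidEq Γ CS CS' K) (hL : ValidEq Γ CL CL' (.arrow .type (.arrow K K)))
    (hR : ValidEq Γ CR CR' (.arrow .row (.arrow .row K)))
    (hT : ValidEq Γ CT CT' (.arrow .baseType (.arrow K K))) :
    ValidEq Γ (.typerec C CB CI CS CL CR CT) (.typerec C' CB' CI' CS' CL' CR' CT') K :=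
  ⟨fun hσ => (LogRel.typeLike t).2
    ⟨.typerec t (h.rel hσ).1 (hB.rel hσ).conEq (hI.rel hσ).conEq (hS.rel hσ).conEq (hL.rel hσ).conEq
      (hR.rel hσ).conEq (hT.rel hσ).conEq, .typerec t
        ⟨hB.rel hσ, hI.rel hσ, hS.rel hσ, hL.rel hσ, hR.rel hσ, hT.rel hσ⟩ (h.rel hσ).2⟩⟩

theorem ValidEq.le {Γ : Ctx} {C D : Con} {K K' : Kind} (h : ValidEq Γ C D K)
    (l : KindLe K K') : ValidEq Γ C D K' := ⟨fun hσ => (h.rel hσ).le l⟩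

theorem ValidEq.whr {Γ : Ctx} {C C' D : Con} {K : Kind} (w : Whr C C') (hC : ConKind Γ C K)
    (h : ValidEq Γ C' D K) : ValidEq Γ C D K := by
  refine ⟨fun {Γ' σ σ'} hσ => ?_⟩
  exact .whr_left (w.subst σ)
    (hC.subst ⟨hσ.wf, fun hn => (hσ.tvar hn).conEq.regular.1⟩) (h.rel hσ)

/-- The fundamental theorem for kinding. Being stated for two related substitutions, it also says
that a constructor respects equivalence in its free variables. -/
theorem ConKind.valid {Γ : Ctx} {C : Con} {K : Kind} (h : ConKind Γ C K) : ValidEq Γ C C K := by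
  induction h using ConKind.induction with
  | bool => exact ⟨fun hσ => ⟨.refl (.bool hσ.wf), .bool⟩⟩
  | int => exact ⟨fun hσ => ⟨.refl (.int hσ.wf), .int⟩⟩
  | string => exact ⟨fun hσ => ⟨.refl (.string hσ.wf), .string⟩⟩
  | var _ hn => exact ⟨fun hσ => hσ.tvar hn⟩
  | lam _ ih => exact .lam ih
  | app _ _ ih ih' => exact .app ih ih'
  | list _ ih => exact .list ih
  | record _ ih => exact .record ih
  | trace _ ih => exact .trace ih
  | typerec t _ _ _ _ _ _ _ h hB hI hS hL hR hT => exact .typerec t h hB hI hS hL hR hT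
  | rnil r => exact .rnil r
  | rcons r _ _ ih ih' => exact .rcons r ih ih'
  | rmap _ _ ih ih' => exact .rmap ih ih'
  | sub _ s ih => exact .le ih (.sub s)

/-! ### Subject reduction for constructors -/

/-- The function that `Typerec` maps over the fields of a record. Its results may have kind
`BaseType`, while `Rmap` wants a function into `Type`, hence the final subsumption. -/
theorem ConKind.typerec_body {Γ : Ctx} {K : Kind} {CB CI CS CL CR CT : Con} (t : TypeLike K)
    (hB : ConKind Γ CB K) (hI : ConKind Γ CI K)
    (hS : ConKind Γ CS K) (hL : ConKind Γ CL (.arrow .type (.arrow K K)))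
    (hR : ConKind Γ CR (.arrow .row (.arrow .row K)))
    (hT : ConKind Γ CT (.arrow .baseType (.arrow K K))) :
    ConKind Γ (.lam .type (.typerec (.var 0) CB.shift CI.shift CS.shift CL.shift
      CR.shift CT.shift)) (.arrow .type .type) :=
  .lam <| .le (.typerec t (.var (.tvar hB.wf) .here) (hB.shift _) (hI.shift _) (hS.shift _)
    (hL.shift _) (hR.shift _) (hT.shift _)) t.le

theorem Whr.kind {Γ : Ctx} {C D : Con} {K : Kind} (w : Whr C D) (h : ConKind Γ C K) :
    ConKind Γ D K := by
  induction w generalizing K with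
  | app _ ih => obtain ⟨_, _, h, h', l⟩ := h.app_inv; exact .le (.app (ih h) h') l
  | beta =>
    obtain ⟨_, _, h, h', l⟩ := h.app_inv
    obtain ⟨_, e, h⟩ := h.lam_inv
    cases e
    exact .le (h.inst h') l
  | rmap _ ih => obtain ⟨rfl, h, h'⟩ := h.rmap_inv; exact .rmap h (ih h')
  | rmap_rnil => obtain ⟨rfl, h, h'⟩ := h.rmap_inv; exact .rnil .row h.wf
  | rmap_rcons =>
    obtain ⟨rfl, h, h'⟩ := h.rmap_inv
    obtain ⟨_, _, r, hD, hS, _⟩ := h'.rcons_inv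
    -- The argument may have been formed as a base row. `Rmap` lives at kind `Row`, so the field and
    -- the rest are raised first.
    exact .rcons .row (.app h (hD.le r.le.1)) (.rmap h (hS.le r.le.2))
  | typerec _ ih =>
    obtain ⟨_, t, h, hB, hI, hS, hL, hR, hT, l⟩ := h.typerec_inv
    exact .le (.typerec t (ih h) hB hI hS hL hR hT) l
  | typerec_bool => obtain ⟨_, t, h, hB, hI, hS, hL, hR, hT, l⟩ := h.typerec_inv; exact hB.le l
  | typerec_int => obtain ⟨_, t, h, hB, hI, hS, hL, hR, hT, l⟩ := h.typerec_inv; exact hI.le l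
  | typerec_string =>
    obtain ⟨_, t, h, hB, hI, hS, hL, hR, hT, l⟩ := h.typerec_inv; exact hS.le l
  | typerec_list =>
    obtain ⟨_, t, h, hB, hI, hS, hL, hR, hT, l⟩ := h.typerec_inv
    have h := h.list_inv.2
    exact .le (.app (.app hL h) (.typerec t h hB hI hS hL hR hT)) l
  | typerec_record =>
    obtain ⟨_, t, h, hB, hI, hS, hL, hR, hT, l⟩ := h.typerec_inv
    have h := h.record_inv.2
    exact .le (.app (.app hR h) (.rmap (.typerec_body t hB hI hS hL hR hT) h)) l
  | typerec_trace =>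
    obtain ⟨_, t, h, hB, hI, hS, hL, hR, hT, l⟩ := h.typerec_inv
    have h := h.trace_inv.2
    exact .le (.app (.app hT h) (.typerec t (.sub h .base) hB hI hS hL hR hT)) l

theorem ValidEq.ofWhr {Γ : Ctx} {C D : Con} {K : Kind} (w : Whr C D) (h : ConKind Γ C K) :
    ConKind Γ D K ∧ ValidEq Γ C D K := ⟨w.kind h, .whr w h (w.kind h).valid⟩

/-- Subject reduction and validity of a step share every inversion of kinding, so one induction
proves both. Redexes at the root are weak head steps, covered by closure under head expansion. -/
theorem ConStep.kind_valid {Γ : Ctx} {C D : Con} {K : Kind} (s : ConStep C D)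
    (h : ConKind Γ C K) : ConKind Γ D K ∧ ValidEq Γ C D K := by
  induction s generalizing Γ K with
  | beta => exact ValidEq.ofWhr .beta h
  | rmap_rnil => exact ValidEq.ofWhr .rmap_rnil h
  | rmap_rcons => exact ValidEq.ofWhr .rmap_rcons h
  | typerec_bool => exact ValidEq.ofWhr .typerec_bool h
  | typerec_int => exact ValidEq.ofWhr .typerec_int h
  | typerec_string => exact ValidEq.ofWhr .typerec_string h
  | typerec_list => exact ValidEq.ofWhr .typerec_list h
  | typerec_record => exact ValidEq.ofWhr .typerec_record h
  | typerec_trace => exact ValidEq.ofWhr .typerec_trace h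
  | rcons_tail _ ih =>
    obtain ⟨_, _, r, h, h', l⟩ := h.rcons_inv
    have ⟨k, v⟩ := ih h'
    exact ⟨.le (.rcons r h k) l, .le (.rcons r h.valid v) l⟩
  | rcons_head _ ih =>
    obtain ⟨_, _, r, h, h', l⟩ := h.rcons_inv
    have ⟨k, v⟩ := ih h
    exact ⟨.le (.rcons r k h') l, .le (.rcons r v h'.valid) l⟩
  | app_fun _ ih =>
    obtain ⟨_, _, h, h', l⟩ := h.app_inv
    have ⟨k, v⟩ := ih h
    exact ⟨.le (.app k h') l, .le (.app v h'.valid) l⟩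
  | app_arg _ ih =>
    obtain ⟨_, _, h, h', l⟩ := h.app_inv
    have ⟨k, v⟩ := ih h'
    exact ⟨.le (.app h k) l, .le (.app h.valid v) l⟩
  | lam _ ih =>
    obtain ⟨_, rfl, hC⟩ := h.lam_inv
    have ⟨k, v⟩ := ih hC
    exact ⟨.lam k, .lam v⟩
  | list _ ih =>
    obtain ⟨rfl, hC⟩ := h.list_inv
    have ⟨k, v⟩ := ih hC
    exact ⟨.list k, .list v⟩
  | trace _ ih =>
    obtain ⟨rfl, hC⟩ := h.trace_inv
    have ⟨k, v⟩ := ih hC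
    exact ⟨.trace k, .trace v⟩
  | record _ ih =>
    obtain ⟨rfl, hC⟩ := h.record_inv
    have ⟨k, v⟩ := ih hC
    exact ⟨.record k, .record v⟩
  | rmap_row _ ih =>
    obtain ⟨rfl, hC, hS⟩ := h.rmap_inv
    have ⟨k, v⟩ := ih hS
    exact ⟨.rmap hC k, .rmap hC.valid v⟩
  | rmap_fun _ ih =>
    obtain ⟨rfl, hC, hS⟩ := h.rmap_inv
    have ⟨k, v⟩ := ih hC
    exact ⟨.rmap k hS, .rmap v hS.valid⟩
  | typerec_scrut _ ih =>
    obtain ⟨_, t, h, hB, hI, hS, hL, hR, hT, l⟩ := h.typerec_inv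
    have ⟨k, v⟩ := ih h
    exact ⟨.le (.typerec t k hB hI hS hL hR hT) l,
      .le (.typerec t v hB.valid hI.valid hS.valid hL.valid hR.valid hT.valid) l⟩
  | typerec_B _ ih =>
    obtain ⟨_, t, h, hB, hI, hS, hL, hR, hT, l⟩ := h.typerec_inv
    have ⟨k, v⟩ := ih hB
    exact ⟨.le (.typerec t h k hI hS hL hR hT) l,
      .le (.typerec t h.valid v hI.valid hS.valid hL.valid hR.valid hT.valid) l⟩
  | typerec_I _ ih =>
    obtain ⟨_, t, h, hB, hI, hS, hL, hR, hT, l⟩ := h.typerec_inv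
    have ⟨k, v⟩ := ih hI
    exact ⟨.le (.typerec t h hB k hS hL hR hT) l,
      .le (.typerec t h.valid hB.valid v hS.valid hL.valid hR.valid hT.valid) l⟩
  | typerec_S _ ih =>
    obtain ⟨_, t, h, hB, hI, hS, hL, hR, hT, l⟩ := h.typerec_inv
    have ⟨k, v⟩ := ih hS
    exact ⟨.le (.typerec t h hB hI k hL hR hT) l,
      .le (.typerec t h.valid hB.valid hI.valid v hL.valid hR.valid hT.valid) l⟩
  | typerec_L _ ih =>
    obtain ⟨_, t, h, hB, hI, hS, hL, hR, hT, l⟩ := h.typerec_inv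
    have ⟨k, v⟩ := ih hL
    exact ⟨.le (.typerec t h hB hI hS k hR hT) l,
      .le (.typerec t h.valid hB.valid hI.valid hS.valid v hR.valid hT.valid) l⟩
  | typerec_R _ ih =>
    obtain ⟨_, t, h, hB, hI, hS, hL, hR, hT, l⟩ := h.typerec_inv
    have ⟨k, v⟩ := ih hR
    exact ⟨.le (.typerec t h hB hI hS hL k hT) l,
      .le (.typerec t h.valid hB.valid hI.valid hS.valid hL.valid v hT.valid) l⟩
  | typerec_T _ ih =>
    obtain ⟨_, t, h, hB, hI, hS, hL, hR, hT, l⟩ := h.typerec_inv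
    have ⟨k, v⟩ := ih hT
    exact ⟨.le (.typerec t h hB hI hS hL hR k) l,
      .le (.typerec t h.valid hB.valid hI.valid hS.valid hL.valid hR.valid v) l⟩

theorem ConStep.kind {Γ : Ctx} {C D : Con} {K : Kind} (s : ConStep C D)
    (h : ConKind Γ C K) : ConKind Γ D K := (s.kind_valid h).1

theorem ConStep.conEq {Γ : Ctx} {C D : Con} {K : Kind} (s : ConStep C D)
    (h : ConKind Γ C K) : ConEq Γ C D K := .step h (s.kind h) s

/-- The fundamental theorem for equivalence. Symmetry and transitivity are harmless because the
relation has both properties, and η holds because functions are compared through their applications.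
-/
theorem ConEq.valid {Γ : Ctx} {C D : Con} {K : Kind} (h : ConEq Γ C D K) :
    ValidEq Γ C D K := by
  induction h with
  | refl h => exact h.valid
  | symm _ ih => exact ⟨fun hσ => (ih.rel hσ.symm).symm⟩
  -- The first equation is used with the left substitution on both sides; the second then passes
  -- from the left to the right one.
  | trans _ _ ih ih' => exact ⟨fun hσ => (ih.rel hσ.refl_left).trans (ih'.rel hσ)⟩
  | sub _ s ih => exact ih.le (.sub s)
  | @eta Γ C K K' h =>
    refine ⟨fun {Γ' σ σ'} hσ => ?_⟩
    have r := h.valid.rel hσ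
    have e : ConEq Γ' (.lam K (.app (C.subst σ).shift (.var 0))) (C.subst σ) (.arrow K K') :=
      .eta r.conEq.regular.1
    simp only [Con.subst, Con.shift_subst_upCon]
    refine ⟨e.trans r.conEq, fun {Γ'' ξ E F} hξ q => ?_⟩
    -- Applied to an argument, the η-expansion β-reduces to the application of the original
    -- function.
    refine .whr_left .beta (.app (e.rename hξ).regular.1 q.conEq.regular.1) ?_
    simp only [Con.inst, Con.rename, Con.subst, Con.shift_rename_upRen, Con.shift_subst_scons,
      Con.subst_var]
    exact r.2 hξ q
  | lam _ ih => exact .lam ih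
  | app _ _ ih ih' => exact .app ih ih'
  | list _ ih => exact .list ih
  | record _ ih => exact .record ih
  | trace _ ih => exact .trace ih
  | step h _ s => exact (s.kind_valid h).2
  | rnil r _ => exact .rnil r
  | rcons r _ _ ih ih' => exact .rcons r ih ih'
  | swap r n h h' hS =>
    exact ⟨fun hσ => .swap r n (h.valid.rel hσ) (h'.valid.rel hσ) (hS.valid.rel hσ)⟩
  | rmap _ _ ih ih' => exact .rmap ih ih'
  | typerec t _ _ _ _ _ _ _ h hB hI hS hL hR hT => exact .typerec t h hB hI hS hL hR hT

theorem ConEq.logRel {Γ : Ctx} {C D : Con} {K : Kind} (h : ConEq Γ C D K) : LogRel K Γ C D := by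
  have := h.valid.rel (.id h.wf)
  rwa [Con.subst_var, Con.subst_var] at this

theorem ConSub.subRel {Γ Γ' : Ctx} {σ : ℕ → Con} (h : ConSub Γ Γ' σ) : SubRel Γ Γ' σ σ :=
  ⟨h.wf, fun hn => (ConEq.refl (h.tvar hn)).logRel⟩

theorem ConEq.subst {Γ Γ' : Ctx} {C D : Con} {K : Kind} {σ : ℕ → Con} (h : ConEq Γ C D K)
    (hσ : ConSub Γ Γ' σ) : ConEq Γ' (C.subst σ) (D.subst σ) K := (h.valid.rel hσ.subRel).conEq

/-! ### Kinding of types -/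

theorem TyKind.subst {Γ Γ' : Ctx} {A : Ty} {K : Kind} {σ : ℕ → Con} (h : TyKind Γ A K)
    (hσ : ConSub Γ Γ' σ) : TyKind Γ' (A.subst σ) K := by
  induction h using TyKind.induction generalizing Γ' σ with
  | T g h => exact .T g (h.subst hσ)
  | bool => exact .bool hσ.wf
  | int => exact .int hσ.wf
  | string => exact .string hσ.wf
  | sub _ s ih => exact .sub (ih hσ) s
  | all _ ih => exact .all (ih (hσ.up _))
  | fn _ _ ih ih' => exact .fn (ih hσ) (ih' hσ)
  | list _ ih => exact .list (ih hσ)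
  | record _ ih => exact .record (ih hσ)
  | trace _ ih => exact .trace (ih hσ)
  | rnil r => exact .rnil r hσ.wf
  | rcons r _ _ ih ih' => exact .rcons r (ih hσ) (ih' hσ)

theorem TyKind.le {Γ : Ctx} {A : Ty} {K K' : Kind} (h : TyKind Γ A K) (l : KindLe K K') :
    TyKind Γ A K' := by
  cases l with
  | refl => exact h
  | sub s => exact .sub h s

theorem TyEq.le {Γ : Ctx} {A B : Ty} {K K' : Kind} (h : TyEq Γ A B K) (l : KindLe K K') :
    TyEq Γ A B K' := by
  cases l with
  | refl => exact h
  | sub s => exact .sub h s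

theorem TyKind.rename {Γ Γ' : Ctx} {A : Ty} {K : Kind} {ξ : ℕ → ℕ} (h : TyKind Γ A K)
    (hξ : Ren Γ Γ' ξ) : TyKind Γ' (A.rename ξ) K := by
  rw [Ty.rename_eq_subst]; exact h.subst hξ.conSub

theorem TyKind.shift {Γ : Ctx} {A : Ty} {K : Kind} (h : TyKind Γ A K) (K' : Kind) :
    TyKind (.tvar Γ K') A.shift K := h.rename (.succ h.wf K')

theorem TyKind.addVar {Γ : Ctx} {A B : Ty} {K : Kind} (h : TyKind Γ A K)
    (w : WfCtx (.var Γ B)) : TyKind (.var Γ B) A K := by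
  have := h.rename (.addVar w)
  rwa [show (fun n => n) = (id : ℕ → ℕ) from rfl, Ty.rename_id] at this

theorem TyKind.dropVar {Γ : Ctx} {A B : Ty} {K : Kind} (h : TyKind (.var Γ B) A K) :
    TyKind Γ A K := by
  have := h.rename (.dropVar h.wf)
  rwa [show (fun n => n) = (id : ℕ → ℕ) from rfl, Ty.rename_id] at this

theorem TyKind.inst {Γ : Ctx} {A : Ty} {D : Con} {K K' : Kind} (h : TyKind (.tvar Γ K') A K)
    (hD : ConKind Γ D K') : TyKind Γ (A.inst D) K :=
  h.subst ((ConSub.id hD.wf).scons hD)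

theorem TyKind.T_inv {Γ : Ctx} {K : Kind} {C : Con} (h : TyKind Γ (.T C) K) :
    ConKind Γ C K := by
  generalize e : Ty.T C = X at h
  induction h using TyKind.induction with
  | T _ h => cases e; exact h
  | sub _ s ih => exact .sub (ih e) s
  | _ => cases e

theorem TyKind.fn_inv {Γ : Ctx} {K : Kind} {A B : Ty} (h : TyKind Γ (.fn A B) K) :
    TyKind Γ A .type ∧ TyKind Γ B .type := by
  generalize e : Ty.fn A B = X at h
  induction h using TyKind.induction with
  | fn h h' => cases e; exact ⟨h, h'⟩
  | sub _ s ih => exact ih e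
  | _ => cases e

theorem TyKind.all_inv {Γ : Ctx} {K K' : Kind} {A : Ty} (h : TyKind Γ (.all K' A) K) :
    TyKind (.tvar Γ K') A .type := by
  generalize e : Ty.all K' A = X at h
  induction h using TyKind.induction with
  | all h => cases e; exact h
  | sub _ s ih => exact ih e
  | _ => cases e

theorem TyKind.list_inv {Γ : Ctx} {K : Kind} {A : Ty} (h : TyKind Γ (.list A) K) :
    TyKind Γ A .type := by
  generalize e : Ty.list A = X at h
  induction h using TyKind.induction with
  | list h => cases e; exact h
  | sub _ s ih => exact ih e
  | _ => cases e

theorem TyKind.record_inv {Γ : Ctx} {K : Kind} {R : Ty} (h : TyKind Γ (.record R) K) :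
    TyKind Γ R .row := by
  generalize e : Ty.record R = X at h
  induction h using TyKind.induction with
  | record h => cases e; exact h
  | sub _ s ih => exact ih e
  | _ => cases e

theorem TyKind.trace_inv {Γ : Ctx} {K : Kind} {A : Ty} (h : TyKind Γ (.trace A) K) :
    TyKind Γ A .baseType := by
  generalize e : Ty.trace A = X at h
  induction h using TyKind.induction with
  | trace h => cases e; exact h
  | sub _ s ih => exact ih e
  | _ => cases e

/-- The base variant of the kinds is forgotten on purpose: only `Type` and `Row` are needed of the
components, which spares tracking subsumption. -/
theorem TyKind.rcons_inv {Γ : Ctx} {K : Kind} {l : Label} {A R : Ty}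
    (h : TyKind Γ (.rcons l A R) K) : TyKind Γ A .type ∧ TyKind Γ R .row := by
  generalize e : Ty.rcons l A R = X at h
  induction h using TyKind.induction with
  | rcons r h h' => cases e; exact ⟨h.le r.le.1, h'.le r.le.2⟩
  | sub _ s ih => exact ih e
  | _ => cases e

theorem TyEq.regular {Γ : Ctx} {A B : Ty} {K : Kind} (h : TyEq Γ A B K) :
    TyKind Γ A K ∧ TyKind Γ B K := by
  induction h with
  | refl h => exact ⟨h, h⟩
  | symm _ ih => exact ⟨ih.2, ih.1⟩
  | trans _ _ ih ih' => exact ⟨ih.1, ih'.2⟩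
  | sub _ s ih => exact ⟨.sub ih.1 s, .sub ih.2 s⟩
  | T_bool w => exact ⟨.T .baseType (.bool w), .bool w⟩
  | T_int w => exact ⟨.T .baseType (.int w), .int w⟩
  | T_string w => exact ⟨.T .baseType (.string w), .string w⟩
  | T_list h => exact ⟨.T .type (.list h), .list (.T .type h)⟩
  | T_record h => exact ⟨.T .type (.record h), .record (.T .row h)⟩
  | T_trace h => exact ⟨.T .type (.trace h), .trace (.T .baseType h)⟩
  | T_rnil r w => cases r <;> exact ⟨.T (by constructor) (.rnil (by constructor) w),
      .rnil (by constructor) w⟩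
  | T_rcons r h h' => cases r <;> exact ⟨.T (by constructor) (.rcons (by constructor) h h'),
      .rcons (by constructor) (.T (by constructor) h) (.T (by constructor) h')⟩
  | T_congr g e => exact ⟨.T g e.regular.1, .T g e.regular.2⟩
  | list _ ih => exact ⟨.list ih.1, .list ih.2⟩
  | record _ ih => exact ⟨.record ih.1, .record ih.2⟩
  | trace _ ih => exact ⟨.trace ih.1, .trace ih.2⟩
  | fn _ _ ih ih' => exact ⟨.fn ih.1 ih'.1, .fn ih.2 ih'.2⟩
  | all _ ih => exact ⟨.all ih.1, .all ih.2⟩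
  | rnil r w => exact ⟨.rnil r w, .rnil r w⟩
  | rcons r _ _ ih ih' => exact ⟨.rcons r ih.1 ih'.1, .rcons r ih.2 ih'.2⟩
  | swap r _ h h' hS => exact ⟨.rcons r h (.rcons r h' hS), .rcons r h' (.rcons r h hS)⟩

theorem TyEq.wf {Γ : Ctx} {A B : Ty} {K : Kind} (h : TyEq Γ A B K) : WfCtx Γ :=
  h.regular.1.wf

theorem TyEq.subst {Γ Γ' : Ctx} {A B : Ty} {K : Kind} {σ : ℕ → Con} (h : TyEq Γ A B K)
    (hσ : ConSub Γ Γ' σ) : TyEq Γ' (A.subst σ) (B.subst σ) K := by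
  induction h generalizing Γ' σ with
  | refl h => exact .refl (h.subst hσ)
  | symm _ ih => exact .symm (ih hσ)
  | trans _ _ ih ih' => exact .trans (ih hσ) (ih' hσ)
  | sub _ s ih => exact .sub (ih hσ) s
  | T_bool => exact .T_bool hσ.wf
  | T_int => exact .T_int hσ.wf
  | T_string => exact .T_string hσ.wf
  | T_list h => exact .T_list (h.subst hσ)
  | T_record h => exact .T_record (h.subst hσ)
  | T_trace h => exact .T_trace (h.subst hσ)
  | T_rnil r => exact .T_rnil r hσ.wf
  | T_rcons r h h' => exact .T_rcons r (h.subst hσ) (h'.subst hσ)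
  | T_congr g e => exact .T_congr g (e.subst hσ)
  | list _ ih => exact .list (ih hσ)
  | record _ ih => exact .record (ih hσ)
  | trace _ ih => exact .trace (ih hσ)
  | fn _ _ ih ih' => exact .fn (ih hσ) (ih' hσ)
  | all _ ih => exact .all (ih (hσ.up _))
  | rnil r => exact .rnil r hσ.wf
  | rcons r _ _ ih ih' => exact .rcons r (ih hσ) (ih' hσ)
  | swap r n h h' hR => exact .swap r n (h.subst hσ) (h'.subst hσ) (hR.subst hσ)

theorem TyEq.rename {Γ Γ' : Ctx} {A B : Ty} {K : Kind} {ξ : ℕ → ℕ} (h : TyEq Γ A B K)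
    (hξ : Ren Γ Γ' ξ) : TyEq Γ' (A.rename ξ) (B.rename ξ) K := by
  rw [Ty.rename_eq_subst, Ty.rename_eq_subst]; exact h.subst hξ.conSub

theorem TyEq.addVar {Γ : Ctx} {A B A' : Ty} {K : Kind} (h : TyEq Γ A B K)
    (w : WfCtx (.var Γ A')) : TyEq (.var Γ A') A B K := by
  have := h.rename (.addVar w)
  rwa [show (fun n => n) = (id : ℕ → ℕ) from rfl, Ty.rename_id, Ty.rename_id] at this

theorem TyEq.inst {Γ : Ctx} {A B : Ty} {D : Con} {K K' : Kind} (h : TyEq (.tvar Γ K') A B K)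
    (hD : ConKind Γ D K') : TyEq Γ (A.inst D) (B.inst D) K :=
  h.subst ((ConSub.id hD.wf).scons hD)

/-- Types are congruent in the constructors substituted into them. The embedded constructors are
handled by the fundamental theorem, the type formers by their congruence rules. -/
theorem TyKind.subst_eq {Γ Γ' : Ctx} {A : Ty} {K : Kind} {σ σ' : ℕ → Con} (h : TyKind Γ A K)
    (hσ : SubRel Γ Γ' σ σ') : TyEq Γ' (A.subst σ) (A.subst σ') K := by
  induction h using TyKind.induction generalizing Γ' σ σ' with
  | T g h => exact .T_congr g (h.valid.rel hσ).conEq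
  | bool => exact .refl (.bool hσ.wf)
  | int => exact .refl (.int hσ.wf)
  | string => exact .refl (.string hσ.wf)
  | sub _ s ih => exact .sub (ih hσ) s
  | all _ ih => exact .all (ih (hσ.up _))
  | fn _ _ ih ih' => exact .fn (ih hσ) (ih' hσ)
  | list _ ih => exact .list (ih hσ)
  | record _ ih => exact .record (ih hσ)
  | trace _ ih => exact .trace (ih hσ)
  | rnil r => exact .rnil r hσ.wf
  | rcons r _ _ ih ih' => exact .rcons r (ih hσ) (ih' hσ)

theorem TyKind.inst_eq {Γ : Ctx} {A : Ty} {C D : Con} {K K' : Kind}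
    (h : TyKind (.tvar Γ K') A K) (e : ConEq Γ C D K') :
    TyEq Γ (A.inst C) (A.inst D) K :=
  h.subst_eq ((SubRel.id e.wf).scons e.logRel)

/-! ### Injectivity of type equivalence -/

/-- Outermost formers of types of kind `Type`. -/
inductive Head : Type
  | bool
  | int
  | string
  | fn (A B : Ty)
  | list (A : Ty)
  | record (R : Ty)
  | trace (A : Ty)
  | all (K : Kind) (A : Ty)
  | ne

/-- The outermost former of a type, after evaluation of embedded constructors. -/
inductive TyHead : Ty → Head → Prop
  | bool : TyHead .bool .bool
  | int : TyHead .int .int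
  | string : TyHead .string .string
  | fn {A B : Ty} : TyHead (.fn A B) (.fn A B)
  | list {A : Ty} : TyHead (.list A) (.list A)
  | record {R : Ty} : TyHead (.record R) (.record R)
  | trace {A : Ty} : TyHead (.trace A) (.trace A)
  | all {K : Kind} {A : Ty} : TyHead (.all K A) (.all K A)
  | T_bool : TyHead (.T .bool) .bool
  | T_int : TyHead (.T .int) .int
  | T_string : TyHead (.T .string) .string
  | T_list {C : Con} : TyHead (.T (.list C)) (.list (.T C))
  | T_record {S : Con} : TyHead (.T (.record S)) (.record (.T S))
  | T_trace {C : Con} : TyHead (.T (.trace C)) (.trace (.T C))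
  | ne {C : Con} : Neutral C → TyHead (.T C) .ne
  | whr {C C' : Con} {h : Head} : Whr C C' → TyHead (.T C') h → TyHead (.T C) h

/-- Inherited from determinism of `Whr`; it lets comparisons of formers be chained through a middle
type. -/
theorem TyHead.deterministic {A : Ty} {h h' : Head} (t : TyHead A h) (t' : TyHead A h') :
    h = h' := by
  induction t generalizing h' with
  | whr w _ ih =>
    cases t' with
    | whr w' t' => cases w.deterministic w'; exact ih t'
    | ne n => exact (n.not_whr w).elim
    | _ => cases w
  | ne n =>
    cases t' with
    | whr w => exact (n.not_whr w).elim
    | ne => rfl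
    | _ => cases n
  | bool => cases t'; rfl
  | int => cases t'; rfl
  | string => cases t'; rfl
  | fn => cases t'; rfl
  | list => cases t'; rfl
  | record => cases t'; rfl
  | trace => cases t'; rfl
  | all => cases t'; rfl
  | T_bool =>
    cases t' with
    | whr w => cases w
    | ne n => cases n
    | T_bool => rfl
  | T_int =>
    cases t' with
    | whr w => cases w
    | ne n => cases n
    | T_int => rfl
  | T_string =>
    cases t' with
    | whr w => cases w
    | ne n => cases n
    | T_string => rfl
  | T_list =>
    cases t' with
    | whr w => cases w
    | ne n => cases n
    | T_list => rfl
  | T_record =>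
    cases t' with
    | whr w => cases w
    | ne n => cases n
    | T_record => rfl
  | T_trace =>
    cases t' with
    | whr w => cases w
    | ne n => cases n
    | T_trace => rfl

/-- Equal outermost formers with equivalent arguments. -/
inductive HeadEq (Γ : Ctx) : Head → Head → Prop
  | bool : HeadEq Γ .bool .bool
  | int : HeadEq Γ .int .int
  | string : HeadEq Γ .string .string
  | fn {A A' B B' : Ty} : TyEq Γ A A' .type → TyEq Γ B B' .type →
      HeadEq Γ (.fn A B) (.fn A' B')
  | list {A B : Ty} : TyEq Γ A B .type → HeadEq Γ (.list A) (.list B)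
  | record {R R' : Ty} : TyEq Γ R R' .row → HeadEq Γ (.record R) (.record R')
  | trace {A B : Ty} : TyEq Γ A B .baseType → HeadEq Γ (.trace A) (.trace B)
  | all {K : Kind} {A B : Ty} : TyEq (.tvar Γ K) A B .type → HeadEq Γ (.all K A) (.all K B)
  | ne : HeadEq Γ .ne .ne

theorem HeadEq.symm {Γ : Ctx} {h h' : Head} (e : HeadEq Γ h h') : HeadEq Γ h' h := by
  cases e <;> constructor <;> apply TyEq.symm <;> assumption

theorem HeadEq.trans {Γ : Ctx} {h h' h'' : Head} (e : HeadEq Γ h h') (e' : HeadEq Γ h' h'') :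
    HeadEq Γ h h'' := by
  cases e <;> cases e' <;> constructor <;> apply TyEq.trans <;> assumption

/-- Both types have the same outermost former. -/
def SameHead (Γ : Ctx) (A B : Ty) : Prop := ∃ h h', TyHead A h ∧ TyHead B h' ∧ HeadEq Γ h h'

/-- Only the equations between arguments survive. The recursive part of `TypeRel` has served its
purpose in the fundamental theorem. -/
theorem TypeRel.sameHead {Γ : Ctx} {C D : Con} (h : TypeRel Γ C D) :
    SameHead Γ (.T C) (.T D) := by
  induction h with
  | bool => exact ⟨_, _, .T_bool, .T_bool, .bool⟩
  | int => exact ⟨_, _, .T_int, .T_int, .int⟩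
  | string => exact ⟨_, _, .T_string, .T_string, .string⟩
  | list e => exact ⟨_, _, .T_list, .T_list, .list (.T_congr .type e)⟩
  | trace e => exact ⟨_, _, .T_trace, .T_trace, .trace (.T_congr .baseType e)⟩
  | record e => exact ⟨_, _, .T_record, .T_record, .record (.T_congr .row e)⟩
  | ne n n' => exact ⟨_, _, .ne n, .ne n', .ne⟩
  | whr_left w _ ih => obtain ⟨_, _, t, t', e⟩ := ih; exact ⟨_, _, .whr w t, t', e⟩
  | whr_right w _ ih => obtain ⟨_, _, t, t', e⟩ := ih; exact ⟨_, _, t, .whr w t', e⟩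

open Classical in
/-- `TyRowView R f`: `f` assigns to each label its first field in the row type `R`. -/
inductive TyRowView : Ty → (Label → Option Ty) → Prop
  | rnil : TyRowView .rnil (fun _ => none)
  | rcons {l : Label} {A R : Ty} {f : Label → Option Ty} : TyRowView R f →
      TyRowView (.rcons l A R) (Function.update f l (some A))
  | T {S : Con} {f : Label → Option Con} : RowView S f →
      TyRowView (.T S) (fun l => (f l).map Ty.T)

theorem TyRowView.deterministic {R : Ty} {f g : Label → Option Ty} (h : TyRowView R f)
    (h' : TyRowView R g) : f = g := by
  induction h generalizing g with
  | rnil => cases h'; rfl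
  | rcons _ ih => cases h' with | rcons h' => rw [ih h']
  | T v => cases h' with | T v' => rw [v.deterministic v']

/-- Equal labels have equivalent first fields. -/
def SameFields (Γ : Ctx) (R R' : Ty) : Prop :=
  ∃ f g, TyRowView R f ∧ TyRowView R' g ∧ Pointwise (fun A B => TyEq Γ A B .type) f g

theorem RowRel.sameFields {Γ : Ctx} {S S' : Con} (h : RowRel Γ S S') :
    SameFields Γ (.T S) (.T S') := by
  obtain ⟨f, g, v, v', p⟩ := h
  exact ⟨_, _, .T v, .T v', p.map fun h => .T_congr .type h.1⟩

theorem SameFields.rnil {Γ : Ctx} : SameFields Γ .rnil .rnil :=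
  ⟨_, _, .rnil, .rnil, .none⟩

theorem SameFields.rcons {Γ : Ctx} {l : Label} {A B R R' : Ty} (e : TyEq Γ A B .type)
    (h : SameFields Γ R R') : SameFields Γ (.rcons l A R) (.rcons l B R') := by
  obtain ⟨f, g, v, v', p⟩ := h
  exact ⟨_, _, .rcons v, .rcons v', p.update e l⟩

/-- Agreement of outermost formers at the kinds of types, of first fields at those of rows. -/
def SameShape : Kind → Ctx → Ty → Ty → Prop
  | .type => SameHead
  | .baseType => SameHead
  | .row => SameFields
  | .baseRow => SameFields
  | .arrow _ _ => fun _ _ _ => True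

theorem SameShape.symm {K : Kind} {Γ : Ctx} {A B : Ty} (h : SameShape K Γ A B) :
    SameShape K Γ B A := by
  have head (h : SameHead Γ A B) : SameHead Γ B A := by
    obtain ⟨_, _, t, t', e⟩ := h; exact ⟨_, _, t', t, e.symm⟩
  have fields (h : SameFields Γ A B) : SameFields Γ B A := by
    obtain ⟨f, g, v, v', p⟩ := h; exact ⟨g, f, v', v, p.symm.mono .symm⟩
  cases K
  exacts [head h, head h, fields h, fields h, trivial]

theorem SameShape.trans {K : Kind} {Γ : Ctx} {A B C : Ty} (h : SameShape K Γ A B)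
    (h' : SameShape K Γ B C) : SameShape K Γ A C := by
  have head (h : SameHead Γ A B) (h' : SameHead Γ B C) : SameHead Γ A C := by
    obtain ⟨_, _, t, t', e⟩ := h
    obtain ⟨_, _, u, u', e'⟩ := h'
    cases t'.deterministic u
    exact ⟨_, _, t, u', e.trans e'⟩
  have fields (h : SameFields Γ A B) (h' : SameFields Γ B C) : SameFields Γ A C := by
    obtain ⟨f, g, v, v', p⟩ := h
    obtain ⟨f', g', u, u', q⟩ := h'
    cases v'.deterministic u
    exact ⟨f, g', v, u', (p.trans q).mono fun ⟨_, h, h'⟩ => h.trans h'⟩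
  cases K
  exacts [head h h', head h h', fields h h', fields h h', trivial]

theorem SameShape.le {K K' : Kind} {Γ : Ctx} {A B : Ty} (h : SameShape K Γ A B)
    (l : KindLe K K') : SameShape K' Γ A B := by
  rcases l with _ | ⟨⟨⟩⟩ <;> exact h

theorem SameShape.ofFields {κ ρ : Kind} (r : RowOf κ ρ) {Γ : Ctx} {R R' : Ty} :
    SameShape ρ Γ R R' ↔ SameFields Γ R R' := by
  cases r <;> rfl

theorem LogRel.sameShape {K : Kind} {Γ : Ctx} {C D : Con} (h : LogRel K Γ C D) :
    SameShape K Γ (.T C) (.T D) := by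
  cases K
  exacts [h.2.sameHead, h.2.sameHead, h.2.sameFields, h.2.sameFields, trivial]

theorem TyKind.sameShape {Γ : Ctx} {A : Ty} {K : Kind} (h : TyKind Γ A K) :
    SameShape K Γ A A := by
  induction h using TyKind.induction with
  | T _ h => exact (ConEq.refl h).logRel.sameShape
  | bool => exact ⟨_, _, .bool, .bool, .bool⟩
  | int => exact ⟨_, _, .int, .int, .int⟩
  | string => exact ⟨_, _, .string, .string, .string⟩
  | sub _ s ih => exact ih.le (.sub s)
  | all h => exact ⟨_, _, .all, .all, .all (.refl h)⟩
  | fn h h' => exact ⟨_, _, .fn, .fn, .fn (.refl h) (.refl h')⟩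
  | list h => exact ⟨_, _, .list, .list, .list (.refl h)⟩
  | record h => exact ⟨_, _, .record, .record, .record (.refl h)⟩
  | trace h => exact ⟨_, _, .trace, .trace, .trace (.refl h)⟩
  | rnil r => exact (SameShape.ofFields r).2 .rnil
  | rcons r h _ _ ih =>
    exact (SameShape.ofFields r).2 (.rcons (.le (.refl h) r.le.1) ((SameShape.ofFields r).1 ih))

open Classical in
-- The source of all injectivity statements. `LogRel` enters through embedded constructors, in the
-- congruence rule for `T` and in reflexivity; elsewhere the equations of the components are at
-- hand. The equations of `T` with the formers match the evaluation of heads, and exchange is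
-- invisible in field maps.
theorem TyEq.sameShape {Γ : Ctx} {A B : Ty} {K : Kind} (h : TyEq Γ A B K) :
    SameShape K Γ A B := by
  induction h with
  | refl h => exact h.sameShape
  | symm _ ih => exact ih.symm
  | trans _ _ ih ih' => exact ih.trans ih'
  | sub _ s ih => exact ih.le (.sub s)
  | T_bool => exact ⟨_, _, .T_bool, .bool, .bool⟩
  | T_int => exact ⟨_, _, .T_int, .int, .int⟩
  | T_string => exact ⟨_, _, .T_string, .string, .string⟩
  | T_list h => exact ⟨_, _, .T_list, .list, .list (.refl (.T .type h))⟩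
  | T_record h => exact ⟨_, _, .T_record, .record, .record (.refl (.T .row h))⟩
  | T_trace h => exact ⟨_, _, .T_trace, .trace, .trace (.refl (.T .baseType h))⟩
  | T_rnil r => exact (SameShape.ofFields r).2 ⟨_, _, .T .rnil, .rnil, .none⟩
  | @T_rcons _ _ _ l C _ r h h' =>
    refine (SameShape.ofFields r).2 ?_
    obtain ⟨e, f, g, v, v', p⟩ := (LogRel.rowOf r).1 (ConEq.refl h').logRel
    refine ⟨_, _, .T v.rcons, .rcons (.T v'), ?_⟩
    have := (p.map (u := Ty.T) (v := Ty.T) (Q := fun A B => TyEq _ A B .type)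
      fun q => TyEq.T_congr .type q.1).update
      (TyEq.refl (.T .type (h.le r.le.1))) l
    -- Embedding all fields after adding one, or adding an embedded field after embedding the rest,
    -- gives the same field map.
    convert this using 1
    funext l'
    by_cases i : l' = l
    · subst i; simp
    · simp [i]
  | T_congr _ e => exact e.logRel.sameShape
  | list e => exact ⟨_, _, .list, .list, .list e⟩
  | record e => exact ⟨_, _, .record, .record, .record e⟩
  | trace e => exact ⟨_, _, .trace, .trace, .trace e⟩
  | fn e e' => exact ⟨_, _, .fn, .fn, .fn e e'⟩
  | all e => exact ⟨_, _, .all, .all, .all e⟩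
  | rnil r => exact (SameShape.ofFields r).2 .rnil
  | rcons r e _ _ ih =>
    exact (SameShape.ofFields r).2 (.rcons (e.le r.le.1) ((SameShape.ofFields r).1 ih))
  | @swap _ _ _ l l' _ _ _ r n h h' hR =>
    refine (SameShape.ofFields r).2 ?_
    obtain ⟨f, g, v, v', p⟩ := (SameShape.ofFields r).1 hR.sameShape
    refine ⟨_, _, v.rcons.rcons, v'.rcons.rcons, ?_⟩
    rw [Function.update_comm n.symm]
    exact (p.update (.le (.refl h) r.le.1) l).update (.le (.refl h') r.le.1) l'

theorem TyEq.fn_inj {Γ : Ctx} {A A' B B' : Ty} (h : TyEq Γ (.fn A B) (.fn A' B') .type) :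
    TyEq Γ A A' .type ∧ TyEq Γ B B' .type := by
  obtain ⟨_, _, ⟨⟩, ⟨⟩, ⟨⟩⟩ := h.sameShape
  exact ⟨‹_›, ‹_›⟩

theorem TyEq.list_inj {Γ : Ctx} {A B : Ty} (h : TyEq Γ (.list A) (.list B) .type) :
    TyEq Γ A B .type := by
  obtain ⟨_, _, ⟨⟩, ⟨⟩, ⟨⟩⟩ := h.sameShape
  assumption

theorem TyEq.trace_inj {Γ : Ctx} {A B : Ty} (h : TyEq Γ (.trace A) (.trace B) .type) :
    TyEq Γ A B .baseType := by
  obtain ⟨_, _, ⟨⟩, ⟨⟩, ⟨⟩⟩ := h.sameShape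
  assumption

theorem TyEq.all_inj {Γ : Ctx} {K K' : Kind} {A B : Ty}
    (h : TyEq Γ (.all K A) (.all K' B) .type) : K = K' ∧ TyEq (.tvar Γ K) A B .type := by
  obtain ⟨_, _, ⟨⟩, ⟨⟩, ⟨⟩⟩ := h.sameShape
  exact ⟨rfl, ‹_›⟩

/-- Because of exchange, equivalent rows need not start with the same label, so comparison of first
fields takes the place of injectivity of row extension. -/
theorem TyEq.record_fields {Γ : Ctx} {R R' : Ty} (h : TyEq Γ (.record R) (.record R') .type) :
    SameFields Γ R R' := by
  obtain ⟨_, _, ⟨⟩, ⟨⟩, e⟩ := h.sameShape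
  cases e with | record e => exact e.sameShape


/-! ### Trace types -/

theorem TRACE_kind {Γ : Ctx} (w : WfCtx Γ) : ConKind Γ TRACE (.arrow .type .type) := by
  have w₁ {Γ K} (w : WfCtx Γ) : WfCtx (.tvar Γ K) := .tvar w
  refine .lam (.typerec .type (.var (w₁ w) .here) (.trace (.bool (w₁ w))) (.trace (.int (w₁ w)))
    (.trace (.string (w₁ w))) (.lam (.lam (.list ?_))) (.lam (.lam (.record ?_)))
    (.lam (.lam ?_))) <;> exact .var (w₁ (w₁ (w₁ w))) .here

theorem traced_eq {Γ : Ctx} {C D : Con} (e : ConEq Γ C D .type) :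
    TyEq Γ (traced C) (traced D) .type :=
  .T_congr .type (.app (.refl (TRACE_kind e.wf)) e)

theorem ifTy_eq {Γ : Ctx} {A B : Ty} (e : TyEq Γ A B .baseType) :
    TyEq Γ (ifTy A) (ifTy B) .type :=
  .record (.rcons .row (.refl (.trace (.bool e.wf))) (.rcons .row (.trace e) (.rnil .row e.wf)))

theorem forTy_eq {Γ : Ctx} {C D : Con} {A B : Ty} (e : ConEq Γ C D .type)
    (e' : TyEq Γ A B .baseType) : TyEq Γ (forTy C A) (forTy D B) .type :=
  .record (.rcons .row (traced_eq e) (.rcons .row (.trace e') (.rnil .row e.wf)))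

theorem forTy_inst (C : Con) (A : Ty) : (forTy (.var 0) A.shift).inst C = forTy C A := by
  change forTy C (A.shift.inst C) = _
  rw [Ty.shift_inst]

theorem cellTy_eq {Γ : Ctx} {A B : Ty} (e : TyEq Γ A B .type) :
    TyEq Γ (cellTy A) (cellTy B) .type :=
  .record (.rcons .row (.refl (.sub (.string e.wf) .base))
    (.rcons .row (.refl (.sub (.string e.wf) .base))
      (.rcons .row (.refl (.sub (.int e.wf) .base)) (.rcons .row e (.rnil .row e.wf)))))

theorem opEqTy_eq {Γ : Ctx} {C D : Con} (e : ConEq Γ C D .type) :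
    TyEq Γ (opEqTy C) (opEqTy D) .type :=
  .record (.rcons .row (traced_eq e) (.rcons .row (traced_eq e) (.rnil .row e.wf)))

/-! ### Regularity of typing -/

theorem Ctx.VarAt.kind {Γ : Ctx} {n : ℕ} {A : Ty} (h : Γ.VarAt n A) (w : WfCtx Γ) :
    TyKind Γ A .type := by
  induction h with
  | here => exact w.of_var.addVar w
  | var _ ih => exact (ih w.of_var.wf).addVar w
  | tvar _ ih => cases w with | tvar w => exact (ih w).shift _

/-- Where a rule does not state the kind of its result, a premise supplies it by inversion of
kinding. Types of bodies descend to the outer context because kinds ignore term variables. -/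
theorem Typed.regular {Γ : Ctx} {M : Term} {A : Ty} (h : Typed Γ M A) : TyKind Γ A .type := by
  induction h with
  | @const _ c w =>
    cases c
    exacts [.sub (.bool w) .base, .sub (.int w) .base, .sub (.string w) .base]
  | var w h => exact h.kind w
  | lam hA _ ih => exact .fn hA ih.dropVar
  | app _ _ ih => exact ih.fn_inv.2
  | tlam _ ih => exact .all ih
  | tapp _ hC ih => exact ih.all_inv.inst hC
  | fix hA => exact hA
  | ite _ _ _ _ ih => exact ih
  | plus _ _ ih => exact ih
  | eq _ _ _ ih => exact .sub (.bool ih.wf) .base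
  | @table Γ n R w h =>
    -- The row of a table is closed, so the identity is vacuously a substitution from the empty
    -- context into `Γ`.
    have hR : TyKind Γ (R.subst Con.var) .baseRow := h.subst ⟨w, fun hn => by cases hn⟩
    rw [Ty.subst_var] at hR
    exact .list (.record (.rcons .row (.sub (.int w) .base) (.sub hR .baseRow)))
  | nil hA => exact .list hA
  | single _ ih => exact .list ih
  | append _ _ ih => exact ih
  | comp _ _ _ ih => exact ih.dropVar
  | rnil w => exact .record (.rnil .row w)
  | rcons _ _ ih ih' => exact .record (.rcons .row ih ih'.record_inv)
  | proj _ ih => exact ih.record_inv.rcons_inv.1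
  | conv _ e => exact e.regular.1
  | rmap hC _ _ _ ih => exact .T .type (.record (.rmap hC ih.T_inv.record_inv.2))
  | rfold _ _ _ _ ih => exact ih
  | typecase hC hB => exact hB.inst hC
  | trLit_bool _ ih => exact .trace (.bool ih.wf)
  | trLit_int _ ih => exact .trace (.int ih.wf)
  | trLit_string _ ih => exact .trace (.string ih.wf)
  | trIf _ ih => exact ih.record_inv.rcons_inv.2.rcons_inv.1
  | trFor _ _ ih => exact ih.record_inv.rcons_inv.2.rcons_inv.1
  | trCell hA => exact .trace hA
  | trOpEq hC => exact .trace (.bool hC.wf)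
  | trOpPlus _ ih => exact .trace (.int ih.wf)
  | tracecase _ _ _ _ _ _ _ _ ih => exact ih.dropVar

theorem Typed.wf {Γ : Ctx} {M : Term} {A : Ty} (h : Typed Γ M A) : WfCtx Γ := h.regular.wf

/-! ### Typing under substitution -/

theorem upTm_var_comp (ζ : ℕ → ℕ) :
    upTm (fun n => .var (ζ n)) = fun n => .var (upRen ζ n) := by
  funext n; cases n <;> rfl

theorem wkTm_var_comp (ζ : ℕ → ℕ) : wkTm (fun n => .var (ζ n)) = fun n => .var (ζ n) := rfl

theorem Term.rename_eq_subst (M : Term) (ξ ζ : ℕ → ℕ) :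
    M.rename ξ ζ = M.subst (fun n => .var (ξ n)) (fun n => .var (ζ n)) := by
  induction M generalizing ξ ζ <;>
    simp_all [Term.rename, Term.subst, upCon_var_comp, upTm_var_comp, wkTm_var_comp,
      Con.rename_eq_subst, Ty.rename_eq_subst]

/-- A class of simultaneous substitutions that is closed under binders and whose members preserve
the kinds of type variables and the types of term variables. -/
structure SubstClass (E : Ctx → Ctx → (ℕ → Con) → (ℕ → Term) → Prop) : Prop where
  con : ∀ {Γ Γ' σ τ}, E Γ Γ' σ τ → ConSub Γ Γ' σ
  tm : ∀ {Γ Γ' σ τ n A}, E Γ Γ' σ τ → Γ.VarAt n A → Typed Γ' (τ n) (A.subst σ)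
  upVar : ∀ {Γ Γ' σ τ A}, E Γ Γ' σ τ → WfCtx (.var Γ A) →
    E (.var Γ A) (.var Γ' (A.subst σ)) σ (upTm τ)
  upTVar : ∀ {Γ Γ' σ τ} (K : Kind), E Γ Γ' σ τ → E (.tvar Γ K) (.tvar Γ' K) (upCon σ) (wkTm τ)

/-- One induction serves renamings and substitutions alike. It is used first for renamings, whose
closure under binders is elementary; the resulting weakening then shows that substitutions are
closed under binders too. -/
theorem Typed.substOf {E : Ctx → Ctx → (ℕ → Con) → (ℕ → Term) → Prop} (hE : SubstClass E)
    {Γ Γ' : Ctx} {M : Term} {A : Ty} {σ : ℕ → Con} {τ : ℕ → Term} (h : Typed Γ M A)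
    (e : E Γ Γ' σ τ) : Typed Γ' (M.subst σ τ) (A.subst σ) := by
  induction h generalizing Γ' σ τ with
  | @const _ c => cases c <;> exact .const (hE.con e).wf
  | var _ hn => exact hE.tm e hn
  | lam hA hM ih => exact .lam (hA.subst (hE.con e)) (ih (hE.upVar e hM.wf))
  | app _ _ ih ih' => exact .app (ih e) (ih' e)
  | tlam _ ih => exact .tlam (ih (hE.upTVar _ e))
  | tapp _ hC ih => rw [Ty.inst_subst]; exact .tapp (ih e) (hC.subst (hE.con e))
  | fix hA hM ih => exact .fix (hA.subst (hE.con e)) (ih (hE.upVar e hM.wf))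
  | ite _ _ _ ih ih' ih'' => exact .ite (ih e) (ih' e) (ih'' e)
  | plus _ _ ih ih' => exact .plus (ih e) (ih' e)
  | eq _ _ hA ih ih' => exact .eq (ih e) (ih' e) (hA.subst (hE.con e))
  | table _ hR => exact .table (hE.con e).wf (hR.subst ⟨.nil, fun hn => by cases hn⟩)
  | nil hA => exact .nil (hA.subst (hE.con e))
  | single _ ih => exact .single (ih e)
  | append _ _ ih ih' => exact .append (ih e) (ih' e)
  | comp _ hN ih ih' => exact .comp (ih e) (ih' (hE.upVar e hN.wf))
  | rnil => exact .rnil (hE.con e).wf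
  | rcons _ _ ih ih' => exact .rcons (ih e) (ih' e)
  | proj _ ih => exact .proj (ih e)
  | conv _ q ih => exact .conv (ih e) (q.subst (hE.con e))
  | rmap hC _ _ ih ih' =>
    have := ih e
    simp only [Ty.subst, Con.subst, Con.shift_subst_upCon] at this
    exact .rmap (hC.subst (hE.con e)) this (ih' e)
  | rfold _ _ _ ih ih' ih'' =>
    have := ih'' e
    simp only [Ty.subst, Con.subst, Con.shift_subst_upCon] at this
    exact .rfold (ih e) (ih' e) this
  | typecase hC hB _ _ _ _ _ _ iB iI iS iL iR iT =>
    have iB := iB e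
    have iI := iI e
    have iS := iS e
    have iL := iL (hE.upTVar _ e)
    have iR := iR (hE.upTVar _ e)
    have iT := iT (hE.upTVar _ e)
    rw [Ty.inst_subst] at iB iI iS ⊢
    rw [Ty.instUnder_subst] at iL iR iT
    exact .typecase (hC.subst (hE.con e)) (hB.subst ((hE.con e).up _)) iB iI iS iL iR iT
  | trLit_bool _ ih => exact .trLit_bool (ih e)
  | trLit_int _ ih => exact .trLit_int (ih e)
  | trLit_string _ ih => exact .trLit_string (ih e)
  | trIf _ ih => exact .trIf (ih e)
  | trFor hC _ ih => exact .trFor (hC.subst (hE.con e)) (ih e)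
  | trCell hA _ ih => exact .trCell (hA.subst (hE.con e)) (ih e)
  | trOpEq hC _ ih => exact .trOpEq (hC.subst (hE.con e)) (ih e)
  | trOpPlus _ ih => exact .trOpPlus (ih e)
  | @tracecase _ A B _ _ _ _ _ _ _ _ hL hI hF hC hQ hP ih iL iI iF iC iQ iP =>
    have iF := iF (hE.upVar (hE.upTVar _ e) hF.wf)
    have iQ := iQ (hE.upVar (hE.upTVar _ e) hQ.wf)
    have eF : (forTy (.var 0) A.shift).subst (upCon σ) = forTy (.var 0) (A.subst σ).shift := by
      rw [← Ty.shift_subst_upCon]; rfl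
    rw [Ty.shift_subst_upCon] at iF iQ
    rw [eF] at iF
    exact .tracecase (ih e) (iL (hE.upVar e hL.wf)) (iI (hE.upVar e hI.wf)) iF
      (iC (hE.upVar e hC.wf)) iQ (iP (hE.upVar e hP.wf))

/-- Variables of `Γ` are renamed by `ξ` and `ζ` to variables of `Γ'`. -/
structure TmRen (Γ Γ' : Ctx) (ξ ζ : ℕ → ℕ) : Prop where
  ren : Ren Γ Γ' ξ
  var : ∀ {n A}, Γ.VarAt n A → Γ'.VarAt (ζ n) (A.rename ξ)

theorem TmRen.substClass : SubstClass fun Γ Γ' σ τ =>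
    ∃ ξ ζ : ℕ → ℕ, σ = (fun n => .var (ξ n)) ∧ τ = (fun n => .var (ζ n)) ∧ TmRen Γ Γ' ξ ζ where
  con := by rintro _ _ _ _ ⟨ξ, ζ, rfl, rfl, h⟩; exact h.ren.conSub
  tm := by
    rintro _ _ _ _ _ _ ⟨ξ, ζ, rfl, rfl, h⟩ hn
    rw [← Ty.rename_eq_subst]; exact .var h.ren.wf (h.var hn)
  upVar := by
    rintro Γ Γ' _ _ A ⟨ξ, ζ, rfl, rfl, h⟩ w
    rw [← Ty.rename_eq_subst]
    refine ⟨ξ, upRen ζ, rfl, upTm_var_comp ζ, ⟨.var (w.of_var.rename h.ren), fun hn => ?_⟩, ?_⟩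
    · cases hn with | var hn => exact .var (h.ren.tvar hn)
    · rintro _ _ (_ | hn)
      exacts [.here, .var (h.var (by assumption))]
  upTVar := by
    rintro Γ Γ' _ _ K ⟨ξ, ζ, rfl, rfl, h⟩
    refine ⟨upRen ξ, ζ, upCon_var_comp ξ, rfl, h.ren.up K, fun hn => ?_⟩
    cases hn with
    | @tvar _ _ A _ hn =>
      have : A.shift.rename (upRen ξ) = (A.rename ξ).shift := by
        simp only [Ty.rename_eq_subst, ← upCon_var_comp, Ty.shift_subst_upCon]
      rw [this]; exact .tvar (h.var hn)

theorem Typed.rename {Γ Γ' : Ctx} {M : Term} {A : Ty} {ξ ζ : ℕ → ℕ} (h : Typed Γ M A)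
    (r : TmRen Γ Γ' ξ ζ) : Typed Γ' (M.rename ξ ζ) (A.rename ξ) := by
  rw [Term.rename_eq_subst, Ty.rename_eq_subst]
  exact h.substOf TmRen.substClass ⟨ξ, ζ, rfl, rfl, r⟩

/-- `σ` and `τ` map the variables of `Γ` to constructors and terms of the same kind or type. -/
structure TmSub (Γ Γ' : Ctx) (σ : ℕ → Con) (τ : ℕ → Term) : Prop where
  con : ConSub Γ Γ' σ
  tm : ∀ {n A}, Γ.VarAt n A → Typed Γ' (τ n) (A.subst σ)

theorem TmSub.substClass : SubstClass TmSub where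
  con h := h.con
  tm h hn := h.tm hn
  upVar {Γ Γ' σ τ A} h w := by
    have w' : WfCtx (.var Γ' (A.subst σ)) := .var (w.of_var.subst h.con)
    have r : TmRen Γ' (.var Γ' (A.subst σ)) _root_.id Nat.succ :=
      ⟨.addVar w', fun hn => by rw [Ty.rename_id]; exact .var hn⟩
    have shift {M : Term} {B : Ty} (hM : Typed Γ' M B) :
        Typed (.var Γ' (A.subst σ)) (M.rename _root_.id Nat.succ) B := by
      have := hM.rename r
      rwa [Ty.rename_id] at this
    refine ⟨⟨w', fun hn => ?_⟩, fun hn => ?_⟩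
    · cases hn with
      | var hn =>
        have := (h.con.tvar hn).rename r.ren
        rwa [Con.rename_id] at this
    · cases hn with
      | here => exact .var w' .here
      | var hn => exact shift (h.tm hn)
  upTVar K h := by
    refine ⟨h.con.up K, fun hn => ?_⟩
    cases hn with
    | tvar hn =>
      rw [Ty.shift_subst_upCon]
      exact (h.tm hn).rename ⟨.succ h.con.wf K, .tvar⟩

theorem Typed.subst {Γ Γ' : Ctx} {M : Term} {A : Ty} {σ : ℕ → Con} {τ : ℕ → Term}
    (h : Typed Γ M A) (hσ : TmSub Γ Γ' σ τ) : Typed Γ' (M.subst σ τ) (A.subst σ) :=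
  h.substOf TmSub.substClass hσ

theorem Typed.instTm {Γ : Ctx} {M N : Term} {A B : Ty} (h : Typed (.var Γ A) M B)
    (hN : Typed Γ N A) : Typed Γ (M.instTm N) B := by
  rw [← Ty.subst_var B]
  refine h.subst ⟨(Ren.dropVar h.wf).conSub, fun hn => ?_⟩
  rw [Ty.subst_var]
  cases hn with
  | here => exact hN
  | var hn => exact .var hN.wf hn

theorem Typed.instTy {Γ : Ctx} {M : Term} {B : Ty} {C : Con} {K : Kind}
    (h : Typed (.tvar Γ K) M B) (hC : ConKind Γ C K) : Typed Γ (M.instTy C) (B.inst C) := by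
  refine h.subst ⟨(ConSub.id hC.wf).scons hC, fun hn => ?_⟩
  cases hn with
  | tvar hn => rw [Ty.shift_subst_scons, Ty.subst_var]; exact .var hC.wf hn

/-- For the `For` and `OpEq` branches of `tracecase`. The result type comes from outside both
binders, hence the weakened type in the hypothesis. -/
theorem Typed.instBoth {Γ : Ctx} {M N : Term} {A B : Ty} {C : Con} {K : Kind}
    (h : Typed (.var (.tvar Γ K) A) M B.shift) (hC : ConKind Γ C K)
    (hN : Typed Γ N (A.inst C)) : Typed Γ (M.instBoth C N) B := by
  rw [← Ty.shift_inst B C]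
  refine h.subst ⟨⟨hC.wf, fun hn => ?_⟩, fun hn => ?_⟩
  · cases hn with | var hn => exact ((ConSub.id hC.wf).scons hC).tvar hn
  · cases hn with
    | here => exact hN
    | var hn =>
      cases hn with
      | tvar hn => rw [Ty.shift_subst_scons, Ty.subst_var]; exact .var hC.wf hn

theorem Typed.shiftUnder {Γ : Ctx} {M : Term} {A B A' : Ty} (h : Typed (.var Γ A) M B)
    (w : WfCtx (.var Γ A')) : Typed (.var (.var Γ A') A) M.shiftUnder B := by
  have w' : WfCtx (.var (.var Γ A') A) := .var (h.wf.of_var.addVar w)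
  have := h.rename (ξ := id) (ζ := upRen Nat.succ) (Γ' := .var (.var Γ A') A)
    ⟨⟨w', fun hn => by cases hn with | var hn => exact .var (.var hn)⟩, fun hn => by
      rw [Ty.rename_id]
      cases hn with
      | here => exact .here
      | var hn => exact .var (.var hn)⟩
  rwa [Ty.rename_id] at this

/-! ### Inversion of typing -/

theorem Typed.lam_inv {Γ : Ctx} {A C : Ty} {M : Term} (h : Typed Γ (.lam A M) C) :
    ∃ B, Typed (.var Γ A) M B ∧ TyEq Γ C (.fn A B) .type := by
  generalize e : Term.lam A M = X at h
  induction h with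
  | lam hA hM => cases e; exact ⟨_, hM, .refl (Typed.lam hA hM).regular⟩
  | conv _ q ih => obtain ⟨B, hM, r⟩ := ih e; exact ⟨B, hM, q.trans r⟩
  | _ => cases e

theorem Typed.tlam_inv {Γ : Ctx} {K : Kind} {C : Ty} {M : Term} (h : Typed Γ (.tlam K M) C) :
    ∃ A, Typed (.tvar Γ K) M A ∧ TyEq Γ C (.all K A) .type := by
  generalize e : Term.tlam K M = X at h
  induction h with
  | tlam hM => cases e; exact ⟨_, hM, .refl (Typed.tlam hM).regular⟩
  | conv _ q ih => obtain ⟨B, hM, r⟩ := ih e; exact ⟨B, hM, q.trans r⟩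
  | _ => cases e

/-- A conversion of the whole can be pushed into both branches, so no equation is left over. This is
why moving conditionals outwards needs no injectivity. -/
theorem Typed.ite_inv {Γ : Ctx} {C : Ty} {L M N : Term} (h : Typed Γ (.ite L M N) C) :
    Typed Γ L .bool ∧ Typed Γ M C ∧ Typed Γ N C := by
  generalize e : Term.ite L M N = X at h
  induction h with
  | ite hL hM hN => cases e; exact ⟨hL, hM, hN⟩
  | conv _ q ih => obtain ⟨hL, hM, hN⟩ := ih e; exact ⟨hL, hM.conv q, hN.conv q⟩
  | _ => cases e

theorem Typed.append_inv {Γ : Ctx} {C : Ty} {M N : Term} (h : Typed Γ (.append M N) C) :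
    Typed Γ M C ∧ Typed Γ N C := by
  generalize e : Term.append M N = X at h
  induction h with
  | append hM hN => cases e; exact ⟨hM, hN⟩
  | conv _ q ih => obtain ⟨hM, hN⟩ := ih e; exact ⟨hM.conv q, hN.conv q⟩
  | _ => cases e

theorem Typed.single_inv {Γ : Ctx} {C : Ty} {M : Term} (h : Typed Γ (.single M) C) :
    ∃ A, Typed Γ M A ∧ TyEq Γ C (.list A) .type := by
  generalize e : Term.single M = X at h
  induction h with
  | single hM => cases e; exact ⟨_, hM, .refl (Typed.single hM).regular⟩
  | conv _ q ih => obtain ⟨A, hM, r⟩ := ih e; exact ⟨A, hM, q.trans r⟩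
  | _ => cases e

theorem Typed.comp_inv {Γ : Ctx} {C : Ty} {M N : Term} (h : Typed Γ (.comp M N) C) :
    ∃ A B, Typed Γ M (.list A) ∧ Typed (.var Γ A) N (.list B) ∧ TyEq Γ C (.list B) .type := by
  generalize e : Term.comp M N = X at h
  induction h with
  | comp hM hN => cases e; exact ⟨_, _, hM, hN, .refl (Typed.comp hM hN).regular⟩
  | conv _ q ih => obtain ⟨A, B, hM, hN, r⟩ := ih e; exact ⟨A, B, hM, hN, q.trans r⟩
  | _ => cases e

theorem Typed.rcons_inv {Γ : Ctx} {C : Ty} {l : Label} {M N : Term}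
    (h : Typed Γ (.rcons l M N) C) :
    ∃ A R, Typed Γ M A ∧ Typed Γ N (.record R) ∧ TyEq Γ C (.record (.rcons l A R)) .type := by
  generalize e : Term.rcons l M N = X at h
  induction h with
  | rcons hM hN => cases e; exact ⟨_, _, hM, hN, .refl (Typed.rcons hM hN).regular⟩
  | conv _ q ih => obtain ⟨A, R, hM, hN, r⟩ := ih e; exact ⟨A, R, hM, hN, q.trans r⟩
  | _ => cases e

theorem Typed.trLit_inv {Γ : Ctx} {C : Ty} {M : Term} (h : Typed Γ (.trLit M) C) :
    ∃ A, Typed Γ M A ∧ TyEq Γ C (.trace A) .type := by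
  generalize e : Term.trLit M = X at h
  induction h with
  | trLit_bool hM => cases e; exact ⟨_, hM, .refl (Typed.trLit_bool hM).regular⟩
  | trLit_int hM => cases e; exact ⟨_, hM, .refl (Typed.trLit_int hM).regular⟩
  | trLit_string hM => cases e; exact ⟨_, hM, .refl (Typed.trLit_string hM).regular⟩
  | conv _ q ih => obtain ⟨A, hM, r⟩ := ih e; exact ⟨A, hM, q.trans r⟩
  | _ => cases e

theorem Typed.trIf_inv {Γ : Ctx} {C : Ty} {M : Term} (h : Typed Γ (.trIf M) C) :
    ∃ A, Typed Γ M (ifTy A) ∧ TyEq Γ C (.trace A) .type := by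
  generalize e : Term.trIf M = X at h
  induction h with
  | trIf hM => cases e; exact ⟨_, hM, .refl (Typed.trIf hM).regular⟩
  | conv _ q ih => obtain ⟨A, hM, r⟩ := ih e; exact ⟨A, hM, q.trans r⟩
  | _ => cases e

theorem Typed.trFor_inv {Γ : Ctx} {B : Ty} {C : Con} {M : Term} (h : Typed Γ (.trFor C M) B) :
    ∃ A, ConKind Γ C .type ∧ Typed Γ M (forTy C A) ∧ TyEq Γ B (.trace A) .type := by
  generalize e : Term.trFor C M = X at h
  induction h with
  | trFor hC hM => cases e; exact ⟨_, hC, hM, .refl (Typed.trFor hC hM).regular⟩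
  | conv _ q ih => obtain ⟨A, hC, hM, r⟩ := ih e; exact ⟨A, hC, hM, q.trans r⟩
  | _ => cases e

theorem Typed.trCell_inv {Γ : Ctx} {C : Ty} {M : Term} (h : Typed Γ (.trCell M) C) :
    ∃ A, Typed Γ M (cellTy A) ∧ TyEq Γ C (.trace A) .type := by
  generalize e : Term.trCell M = X at h
  induction h with
  | trCell hA hM => cases e; exact ⟨_, hM, .refl (Typed.trCell hA hM).regular⟩
  | conv _ q ih => obtain ⟨A, hM, r⟩ := ih e; exact ⟨A, hM, q.trans r⟩
  | _ => cases e

/-- The contents of an `OpEq` trace do not depend on the type traced, so the equation for `A` can be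
dropped. -/
theorem Typed.trOpEq_inv {Γ : Ctx} {A : Ty} {C : Con} {M : Term} (h : Typed Γ (.trOpEq C M) A) :
    ConKind Γ C .baseType ∧ Typed Γ M (opEqTy C) := by
  generalize e : Term.trOpEq C M = X at h
  induction h with
  | trOpEq hC hM => cases e; exact ⟨hC, hM⟩
  | conv _ _ ih => exact ih e
  | _ => cases e

theorem Typed.trOpPlus_inv {Γ : Ctx} {A : Ty} {M : Term} (h : Typed Γ (.trOpPlus M) A) :
    Typed Γ M opPlusTy := by
  generalize e : Term.trOpPlus M = X at h
  induction h with
  | trOpPlus hM => cases e; exact hM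
  | conv _ _ ih => exact ih e
  | _ => cases e

/-! ### Records -/

open Classical in
-- The row `R` may list the fields in another order than the literal, so the induction follows the
-- first `l`-field of the type through the field map instead of the syntax of `R`.
theorem Typed.field {Γ : Ctx} {l : Label} {P M : Term} {A R : Ty} {f : Label → Option Ty}
    (h : FieldOf l P M) (hP : Typed Γ P (.record R)) (v : TyRowView R f) (hf : f l = some A) :
    Typed Γ M A := by
  induction h generalizing R f A with
  | here =>
    obtain ⟨_, _, hM, _, q⟩ := hP.rcons_inv
    obtain ⟨_, _, v', u, p⟩ := q.record_fields
    cases v.deterministic v'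
    obtain ⟨_, hg, r⟩ := p.exists_right hf
    cases u
    rw [Function.update_self] at hg
    cases hg
    exact hM.conv r
  | there n _ ih =>
    obtain ⟨_, _, _, hN, q⟩ := hP.rcons_inv
    obtain ⟨_, _, v', u, p⟩ := q.record_fields
    cases v.deterministic v'
    obtain ⟨_, hg, r⟩ := p.exists_right hf
    cases u with
    | rcons u =>
      -- The literal starts with another label, so its first `l`-field is that of the tail.
      rw [Function.update_of_ne n.symm] at hg
      exact (ih hN u hg).conv r

open Classical in
theorem Typed.proj_field {Γ : Ctx} {l : Label} {P M : Term} {A R : Ty} (h : FieldOf l P M)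
    (hP : Typed Γ P (.record (.rcons l A R))) : Typed Γ M A := by
  -- Comparing the row type with itself provides a field map; that one exists at all is a
  -- consequence of the fundamental theorem.
  obtain ⟨_, _, v, _, _⟩ := hP.regular.record_inv.sameShape
  refine hP.field h v ?_
  cases v
  exact Function.update_self ..

/-- The field is carried to the front by successive exchanges, each of which is legal because the
labels are distinct. -/
theorem ConEq.field_first {Γ : Ctx} {fs : List (Label × Con)} {l : Label} {C : Con}
    (h : ConKind Γ (Con.ofFields fs) .row) (d : (fs.map Prod.fst).Nodup) (m : (l, C) ∈ fs) :
    ∃ S, ConEq Γ (Con.ofFields fs) (.rcons l C S) .row := by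
  induction fs with
  | nil => cases m
  | cons p fs ih =>
    obtain ⟨l', D⟩ := p
    rw [List.map_cons, List.nodup_cons] at d
    rcases List.mem_cons.1 m with e | m
    · cases e; exact ⟨_, .refl h⟩
    · have n : l' ≠ l := by
        rintro rfl
        have := List.mem_map_of_mem (f := Prod.fst) m
        exact d.1 this
      obtain ⟨_, _, r, hD, hS, _⟩ := ConKind.rcons_inv h
      obtain ⟨S, e⟩ := ih (hS.le r.le.2) d.2 m
      obtain ⟨_, _, r', hC, hS', _⟩ := e.regular.2.rcons_inv
      have hD := hD.le r.le.1
      exact ⟨_, (ConEq.rcons .row (.refl hD) e).trans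
        (.swap .row n hD (hC.le r'.le.1) (hS'.le r'.le.2))⟩

/-- The row is explicit only up to equivalence because for `rfold` it is an unevaluated `Rmap`; for
`rmap` the equation is reflexivity. -/
theorem Typed.proj_ofFields {Γ : Ctx} {S : Con} {N : Term} {fs : List (Label × Con)} {l : Label}
    {C : Con} (hN : Typed Γ N (.T (.record S))) (e : ConEq Γ S (Con.ofFields fs) .row)
    (d : (fs.map Prod.fst).Nodup) (m : (l, C) ∈ fs) : Typed Γ (.proj N l) (.T C) := by
  obtain ⟨S', e'⟩ := ConEq.field_first e.regular.2 d m
  have e := e.trans e'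
  obtain ⟨_, _, r, hC, hS, _⟩ := e.regular.2.rcons_inv
  have hC := hC.le r.le.1
  have hS := hS.le r.le.2
  refine .proj (R := .T S') (hN.conv (.symm ?_))
  exact (TyEq.T_congr .type (.record e)).trans <|
    (TyEq.T_record e.regular.2).trans (.record (.T_rcons .row hC hS))

theorem ConKind.of_mem {Γ : Ctx} {fs : List (Label × Con)} {p : Label × Con}
    (h : ConKind Γ (Con.ofFields fs) .row) (m : p ∈ fs) : ConKind Γ p.2 .type := by
  induction fs with
  | nil => cases m
  | cons q fs ih =>
    obtain ⟨_, _, r, hC, hS, _⟩ := ConKind.rcons_inv h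
    rcases List.mem_cons.1 m with rfl | m
    · exact hC.le r.le.1
    · exact ih (hS.le r.le.2) m

/-- Apply `F` to all fields. -/
def mapFields (F : Con) (fs : List (Label × Con)) : List (Label × Con) :=
  fs.map fun p => (p.1, .app F p.2)

theorem mapFields_labels (F : Con) (fs : List (Label × Con)) :
    (mapFields F fs).map Prod.fst = fs.map Prod.fst := by
  simp [mapFields]

theorem ConEq.rmap_ofFields {Γ : Ctx} {F : Con} {fs : List (Label × Con)}
    (hF : ConKind Γ F (.arrow .type .type)) (h : ConKind Γ (Con.ofFields fs) .row) :
    ConEq Γ (.rmap F (Con.ofFields fs)) (Con.ofFields (mapFields F fs)) .row := by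
  induction fs with
  | nil => exact ConStep.rmap_rnil.conEq (.rmap hF h)
  | cons p fs ih =>
    obtain ⟨_, _, r, hC, hS, _⟩ := ConKind.rcons_inv h
    exact (ConStep.rmap_rcons.conEq (.rmap hF h)).trans
      (.rcons .row (.refl (.app hF (hC.le r.le.1))) (ih (hS.le r.le.2)))

theorem Typed.unrollMap {Γ : Ctx} {F : Con} {M N : Term} {fs : List (Label × Con)}
    (hF : ConKind Γ F (.arrow .type .type))
    (hM : Typed Γ M (.all .type (.fn (.T (.var 0)) (.T (.app F.shift (.var 0))))))
    (h : ∀ p ∈ fs, ConKind Γ p.2 .type ∧ Typed Γ (.proj N p.1) (.T p.2)) :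
    Typed Γ (LinksT.unrollMap M N fs) (.record (.T (Con.ofFields (mapFields F fs)))) := by
  induction fs with
  | nil => exact .conv (.rnil hF.wf) (.record (.T_rnil .row hF.wf))
  | cons p fs ih =>
    obtain ⟨hC, hN⟩ := h p List.mem_cons_self
    have tail := ih fun q m => h q (List.mem_cons_of_mem _ m)
    have hM := hM.tapp hC
    change Typed Γ _ (.fn (.T p.2) (.T (.app (F.shift.inst p.2) p.2))) at hM
    rw [Con.shift_inst] at hM
    exact .conv (.rcons (.app hM hN) tail)
      (.record (.T_rcons .row (.app hF hC) tail.regular.record_inv.T_inv))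

theorem Typed.unrollFold {Γ : Ctx} {A : Ty} {L M N : Term} {fs : List (Label × Con)}
    (hL : Typed Γ L (.fn A (.fn A A))) (hM : Typed Γ M A)
    (h : ∀ p ∈ fs, Typed Γ (.proj N p.1) A) : Typed Γ (LinksT.unrollFold L M N fs) A := by
  induction fs with
  | nil => exact hM
  | cons p fs ih =>
    exact .app (.app hL (h p List.mem_cons_self)) (ih fun q m => h q (List.mem_cons_of_mem _ m))

theorem Typed.rmap_unroll {Γ : Ctx} {C : Con} {M N : Term} {fs : List (Label × Con)}
    (d : (fs.map Prod.fst).Nodup) (hC : ConKind Γ C (.arrow .type .type))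
    (hM : Typed Γ M (.all .type (.fn (.T (.var 0)) (.T (.app C.shift (.var 0))))))
    (hN : Typed Γ N (.T (.record (Con.ofFields fs)))) :
    Typed Γ (LinksT.unrollMap M N fs) (.T (.record (.rmap C (Con.ofFields fs)))) := by
  have hS := hN.regular.T_inv.record_inv.2
  have e := ConEq.rmap_ofFields hC hS
  refine .conv (hM.unrollMap hC fun p m => ⟨hS.of_mem m, hN.proj_ofFields (.refl hS) d m⟩) ?_
  exact (TyEq.T_congr .type (.record e)).trans (.T_record e.regular.2)

theorem Typed.rfold_unroll {Γ : Ctx} {C : Con} {L M N : Term} {fs : List (Label × Con)}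
    (d : (fs.map Prod.fst).Nodup) (hL : Typed Γ L (.fn (.T C) (.fn (.T C) (.T C))))
    (hM : Typed Γ M (.T C))
    (hN : Typed Γ N (.T (.record (.rmap (.lam .type C.shift) (Con.ofFields fs))))) :
    Typed Γ (LinksT.unrollFold L M N fs) (.T C) := by
  obtain ⟨_, hF, hS⟩ := hN.regular.T_inv.record_inv.2.rmap_inv
  refine hL.unrollFold hM fun p m => ?_
  -- Evaluated, the row of `N` assigns to every label the type `(λα. C) D`, which β-reduces to `C`.
  have hp := hN.proj_ofFields (ConEq.rmap_ofFields hF hS) (by rwa [mapFields_labels])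
    (List.mem_map_of_mem m)
  refine hp.conv (.symm ?_)
  have e := (ConStep.beta (K := .type) (C := C.shift) (D := p.2)).conEq (.app hF (hS.of_mem m))
  rw [Con.shift_inst] at e
  exact .T_congr .type e

/-! ### Preservation -/

theorem Typed.preservation {Γ : Ctx} {M M' : Term} {A : Ty} (h : Typed Γ M A)
    (s : Step M M') : Typed Γ M' A := by
  induction h generalizing M' with
  | const => cases s
  | var => cases s
  | lam hA _ ih => cases s with | lam s => exact .lam hA (ih s)
  | app hM hN ih ih' => cases s with
    | beta =>
      obtain ⟨_, hM, q⟩ := hM.lam_inv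
      obtain ⟨qA, qB⟩ := q.fn_inj
      exact (hM.instTm (hN.conv qA.symm)).conv qB
    | app_ite =>
      obtain ⟨hL, h₁, h₂⟩ := hM.ite_inv
      exact .ite hL (.app h₁ hN) (.app h₂ hN)
    | app_fun s => exact .app (ih s) hN
    | app_arg s => exact .app hM (ih' s)
  | tlam _ ih => cases s with | tlam s => exact .tlam (ih s)
  | tapp hM hC ih => cases s with
    | tbeta =>
      obtain ⟨_, hM, q⟩ := hM.tlam_inv
      obtain ⟨rfl, qA⟩ := q.all_inj
      exact (hM.instTy hC).conv (qA.inst hC)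
    | tapp_ite =>
      obtain ⟨hL, h₁, h₂⟩ := hM.ite_inv
      exact .ite hL (.tapp h₁ hC) (.tapp h₂ hC)
    | tapp_fun s => exact .tapp (ih s) hC
    | tapp_arg s =>
      -- The argument occurs in the type, so the new term has the type instantiated at the reduct
      -- and is converted back.
      exact .conv (.tapp hM (s.kind hC)) (hM.regular.all_inv.inst_eq (s.conEq hC))
  | fix hA hM => cases s with | fix => exact hM.instTm (.fix hA hM)
  | ite hL hM hN ih ih' ih'' => cases s with
    | ite_true => exact hM
    | ite_false => exact hN
    | ite_ite =>
      obtain ⟨hL, h₁, h₂⟩ := hL.ite_inv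
      exact .ite hL (.ite h₁ hM hN) (.ite h₂ hM hN)
    | ite_cond s => exact .ite (ih s) hM hN
    | ite_then s => exact .ite hL (ih' s) hN
    | ite_else s => exact .ite hL hM (ih'' s)
  | plus hM hN ih ih' => cases s with
    | plus_left s => exact .plus (ih s) hN
    | plus_right s => exact .plus hM (ih' s)
  | eq hM hN hA ih ih' => cases s with
    | eq_left s => exact .eq (ih s) hN hA
    | eq_right s => exact .eq hM (ih' s) hA
  | table => cases s
  | nil => cases s
  | single _ ih => cases s with | single s => exact .single (ih s)
  | append hM hN ih ih' => cases s with
    | append_left s => exact .append (ih s) hN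
    | append_right s => exact .append hM (ih' s)
  | comp hM hN ih ih' => cases s with
    -- The element type of the new empty list comes from the body, whose type does not depend on the
    -- bound variable.
    | comp_nil => exact .nil hN.regular.dropVar.list_inv
    | comp_single =>
      obtain ⟨_, hM, q⟩ := hM.single_inv
      exact hN.instTm (hM.conv q.list_inj)
    | comp_append =>
      obtain ⟨h₁, h₂⟩ := hM.append_inv
      exact .append (.comp h₁ hN) (.comp h₂ hN)
    | comp_comp =>
      obtain ⟨_, _, hL, hM, q⟩ := hM.comp_inv
      exact .comp hL (.comp (hM.conv (q.addVar hM.wf)) (hN.shiftUnder hM.wf))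
    | comp_ite =>
      obtain ⟨hL, h₁, h₂⟩ := hM.ite_inv
      exact .ite hL (.comp h₁ hN) (.comp h₂ hN)
    | comp_src s => exact .comp (ih s) hN
    | comp_body s => exact .comp hM (ih' s)
  | rnil => cases s
  | rcons hM hN ih ih' => cases s with
    | rcons_head s => exact .rcons (ih s) hN
    | rcons_tail s => exact .rcons hM (ih' s)
  | proj hM ih => cases s with
    | proj_record f => exact hM.proj_field f
    | proj_ite =>
      obtain ⟨hL, h₁, h₂⟩ := hM.ite_inv
      exact .ite hL (.proj h₁) (.proj h₂)
    | proj s => exact .proj (ih s)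
  | conv _ q ih => exact (ih s).conv q
  | rmap hC hM hN ih ih' => cases s with
    | rmap_unroll d => exact hM.rmap_unroll d hC hN
    | rmap_row s =>
      -- The row occurs both in the type demanded of `N` and in the type of the result, so the
      -- equation is used once in each direction.
      have hS := hN.regular.T_inv.record_inv.2
      have e := s.conEq hS
      exact .conv (.rmap hC hM (hN.conv (.T_congr .type (.record e.symm))))
        (.T_congr .type (.record (.rmap (.refl hC) e)))
    | rmap_fun s => exact .rmap hC (ih s) hN
    | rmap_arg s => exact .rmap hC hM (ih' s)
  | rfold hL hM hN ih ih' ih'' => cases s with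
    | rfold_unroll d => exact hL.rfold_unroll d hM hN
    | rfold_row s =>
      obtain ⟨_, hC, hS⟩ := hN.regular.T_inv.record_inv.2.rmap_inv
      exact .rfold hL hM
        (hN.conv (.T_congr .type (.record (.rmap (.refl hC) (s.conEq hS).symm))))
    | rfold_fun s => exact .rfold (ih s) hM hN
    | rfold_init s => exact .rfold hL (ih' s) hN
    | rfold_arg s => exact .rfold hL hM (ih'' s)
  | typecase hC hB hMB hMI hMS hML hMR hMT iB iI iS iL iR iT => cases s with
    | typecase_bool => exact hMB
    | typecase_int => exact hMI
    | typecase_string => exact hMS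
    | typecase_list =>
      have := hML.instTy hC.list_inv.2
      rwa [Ty.instUnder_inst] at this
    | typecase_record =>
      have := hMR.instTy hC.record_inv.2
      rwa [Ty.instUnder_inst] at this
    | typecase_trace =>
      have := hMT.instTy hC.trace_inv.2
      rwa [Ty.instUnder_inst] at this
    | typecase_scrut s =>
      exact .conv (.typecase (s.kind hC) hB hMB hMI hMS hML hMR hMT) (hB.inst_eq (s.conEq hC))
    | typecase_B s => exact .typecase hC hB (iB s) hMI hMS hML hMR hMT
    | typecase_I s => exact .typecase hC hB hMB (iI s) hMS hML hMR hMT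
    | typecase_S s => exact .typecase hC hB hMB hMI (iS s) hML hMR hMT
    | typecase_L s => exact .typecase hC hB hMB hMI hMS (iL s) hMR hMT
    | typecase_R s => exact .typecase hC hB hMB hMI hMS hML (iR s) hMT
    | typecase_T s => exact .typecase hC hB hMB hMI hMS hML hMR (iT s)
  -- Literal traces are typable only around constants, and constants do not reduce.
  | trLit_bool => cases s with | trLit s => cases s
  | trLit_int => cases s with | trLit s => cases s
  | trLit_string => cases s with | trLit s => cases s
  | trIf _ ih => cases s with | trIf s => exact .trIf (ih s)
  | trFor hC hM ih => cases s with
    | trFor_con s =>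
      refine .trFor (s.kind hC) (hM.conv (forTy_eq (s.conEq hC).symm (.refl ?_)))
      exact hM.regular.record_inv.rcons_inv.2.rcons_inv.1.trace_inv
    | trFor s => exact .trFor hC (ih s)
  | trCell hA _ ih => cases s with | trCell s => exact .trCell hA (ih s)
  | trOpEq hC hM ih => cases s with
    | trOpEq_con s =>
      exact .trOpEq (s.kind hC) (hM.conv (opEqTy_eq (.sub (s.conEq hC).symm .base)))
    | trOpEq s => exact .trOpEq hC (ih s)
  | trOpPlus _ ih => cases s with | trOpPlus s => exact .trOpPlus (ih s)
  | tracecase hM hL hI hF hC hE hP ih iL iI iF iC iE iP => cases s with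
    | tracecase_lit =>
      obtain ⟨_, hM, q⟩ := hM.trLit_inv
      exact hL.instTm (hM.conv (.sub q.trace_inj .base))
    | tracecase_if =>
      obtain ⟨_, hM, q⟩ := hM.trIf_inv
      exact hI.instTm (hM.conv (ifTy_eq q.trace_inj))
    | tracecase_for =>
      obtain ⟨_, hD, hM, q⟩ := hM.trFor_inv
      refine hF.instBoth hD ?_
      -- Inversion finds the contents at a traced type that is only equivalent to the one on which
      -- the branch was checked; injectivity of `Trace` repairs this while the constructor stays
      -- fixed.
      have := hM.conv (forTy_eq (.refl hD) q.trace_inj)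
      rwa [← forTy_inst] at this
    | tracecase_cell =>
      obtain ⟨_, hM, q⟩ := hM.trCell_inv
      exact hC.instTm (hM.conv (cellTy_eq (.sub q.trace_inj .base)))
    | tracecase_opEq =>
      obtain ⟨hD, hM⟩ := hM.trOpEq_inv
      exact hE.instBoth hD hM
    | tracecase_opPlus => exact hP.instTm hM.trOpPlus_inv
    | tracecase_ite =>
      obtain ⟨hL', h₁, h₂⟩ := hM.ite_inv
      exact .ite hL' (.tracecase h₁ hL hI hF hC hE hP) (.tracecase h₂ hL hI hF hC hE hP)
    | tracecase_scrut s => exact .tracecase (ih s) hL hI hF hC hE hP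
    | tracecase_L s => exact .tracecase hM (iL s) hI hF hC hE hP
    | tracecase_I s => exact .tracecase hM hL (iI s) hF hC hE hP
    | tracecase_F s => exact .tracecase hM hL hI (iF s) hC hE hP
    | tracecase_C s => exact .tracecase hM hL hI hF (iC s) hE hP
    | tracecase_E s => exact .tracecase hM hL hI hF hC (iE s) hP
    | tracecase_P s => exact .tracecase hM hL hI hF hC hE (iP s)

end LinksT

/-- Preservation: reduction preserves typing. -/
theorem mainTheorem2 (Γ : LinksT.Ctx) (M M' : LinksT.Term) (A : LinksT.Ty)
    (hM : LinksT.Typed Γ M A) (hstep : LinksT.Step M M') : LinksT.Typed Γ M' A :=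
  hM.preservation hstep
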